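/- Let $V:(0,\infty)\to\mathbb C$ be a measurable complex-valued potential with $$\int_0^\infty x|V(x)|\,dx<\infty ,$$ and let $L_V=-d^2/dx^2+V$ be the Schrödinger operator in $\mathcal H=L^2(0,\infty)$ with Dirichlet condition at $0$: its domain consists of all $y\in L^2(0,\infty)$ such that $y,y'$ are locally absolutely continuous on $(0,\infty)$, $y(0+)=0$ and $-y''+Vy\in L^2(0,\infty)$, and $L_Vy=-y''+Vy$. (If $V$ is bounded, then $L_V=L_0+V$ with the domain of $L_0$.) Let $R_V(\lambda)=(L_V-\lambda)^{-1}$. For $k\in\overline{\mathbb C}_+=\{k\in\mathbb C:\operatorname{Im}k\ge 0\}$ let $e(x,k)$, $x\ge 0$, be the Jost solution, i.e. the solution of $-y''+Vy=k^2y$ on $(0,\infty)$, continuous at $x=0$, with $e(x,k)e^{-ikx}\to1$ as $x\to\infty$, and let $e(k)=e(0,k)$ be the Jost function. Let $A$ be the operator in $\mathcal H$ of multiplication, on its maximal domain, by a measurable function $a$ with $|a(x)|^2=|V(x)|$ for almost every $x$ (for instance $a=\sqrt V$ for any measurable branch of the square root, or $a=V|V|^{-1/2}$). Suppose that $e(k)\neq0$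 for all $k\in\overline{\mathbb C}_+$ (including $k=0$). Then $A$ is smooth relative to $L_V$ in the sense of Kato, that is: (i) every $\lambda\in\mathbb C\setminus\mathbb R$ belongs to the resolvent set of $L_V$, the range of $R_V(\lambda)$ is contained in the domain of $A$, and for every $\varphi\in\mathcal H$ the function $\lambda\mapsto AR_V(\lambda)\varphi$ is analytic in the upper and in the lower half-plane; (ii) for every $\varphi\in\mathcal H$ with $\|\varphi\|=1$ and either sign the boundary value $AR_V(\tau\pm i0)\varphi=\lim_{\varepsilon\downarrow0}AR_V(\tau\pm i\varepsilon)\varphi$ exists in the norm of $\mathcal H$ for almost every $\tau\in\mathbb R$, and $$\sup_{\|\varphi\|=1,\ \varepsilon\ge0}\int_{\mathbb R}\|AR_V(\tau\pm i\varepsilon)\varphi\|^2\,d\tau<\infty ,$$ where for $\varepsilon=0$ the integrand is formed with the boundary values. -/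

import Mathlib

open MeasureTheory Set Filter Topology
open scoped ENNReal NNReal Interval

section UnboundedOperators

variable {H : Type*} [NormedAddCommGroup H] [InnerProductSpace ℂ H]

/-- `R` is the bounded everywhere defined two-sided inverse of `L - z : D(L) → H`. -/
def LinearPMap.IsResolventAt (L : H →ₗ.[ℂ] H) (z : ℂ) (R : H →L[ℂ] H) : Prop :=
  (∀ f : H, ∃ h : R f ∈ L.domain, L ⟨R f, h⟩ - z • R f = f) ∧
    ∀ u : L.domain, R (L u - z • (u : H)) = u

/-- The resolvent set of a (possibly unbounded) operator. -/
def LinearPMap.resolventSet (L : H →ₗ.[ℂ] H) : Set ℂ :=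
  {z | ∃ R : H →L[ℂ] H, L.IsResolventAt z R}

open Classical in
/-- The resolvent `(L - z)⁻¹` for `z` in the resolvent set (and `0` elsewhere). -/
noncomputable def LinearPMap.resolvent (L : H →ₗ.[ℂ] H) (z : ℂ) : H →L[ℂ] H :=
  if h : z ∈ L.resolventSet then h.choose else 0

theorem LinearPMap.isResolventAt_resolvent {L : H →ₗ.[ℂ] H} {z : ℂ} (h : z ∈ L.resolventSet) :
    L.IsResolventAt z (L.resolvent z) := by
  unfold LinearPMap.resolvent
  rw [dif_pos h]
  exact h.choose_spec

theorem LinearPMap.IsResolventAt.unique {L : H →ₗ.[ℂ] H} {z : ℂ} {R S : H →L[ℂ] H}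
    (hR : L.IsResolventAt z R) (hS : L.IsResolventAt z S) : R = S := by
  ext f
  obtain ⟨h, hf⟩ := hR.1 f
  have := hS.2 ⟨R f, h⟩
  rw [hf] at this
  exact this.symm

open Classical in
/-- The vector `A (L - z)⁻¹ φ` (meaningful when `(L - z)⁻¹ φ` belongs to the domain of `A`). -/
noncomputable def LinearPMap.compResolvent (A L : H →ₗ.[ℂ] H) (φ : H) (z : ℂ) : H :=
  if h : L.resolvent z φ ∈ A.domain then A ⟨L.resolvent z φ, h⟩ else 0

/-- `A` is smooth relative to `L` in the sense of Kato: every `z ∉ ℝ` is in the resolvent set of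
`L`, the vector `A (L - z)⁻¹ φ` is well defined and analytic in `z` in both half-planes, and
`∫ ‖A (L - (τ ± iε))⁻¹ φ‖² dτ` is bounded uniformly in `‖φ‖ = 1` and `ε ≥ 0`.  The sign `±` is `s`.
For `ε = 0` the integrand is the boundary value `G τ = A (L - (τ ± i0))⁻¹ φ`, i.e. the norm limit as
`ε ↓ 0`, which has to exist for almost every `τ`. -/
structure LinearPMap.IsKatoSmooth (A L : H →ₗ.[ℂ] H) : Prop where
  mem_resolventSet : ∀ z : ℂ, z.im ≠ 0 → z ∈ L.resolventSet
  resolvent_mem_domain : ∀ z : ℂ, z.im ≠ 0 → ∀ φ : H, L.resolvent z φ ∈ A.domain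
  differentiableOn : ∀ φ : H, DifferentiableOn ℂ (A.compResolvent L φ) {z : ℂ | z.im ≠ 0}
  bounded : ∃ C : ℝ≥0, ∀ φ : H, ‖φ‖ = 1 → ∀ s : ℝ, (s = 1 ∨ s = -1) →
    (∀ ε : ℝ, 0 < ε →
      ∫⁻ τ : ℝ, ‖A.compResolvent L φ (τ + (s * ε : ℝ) * Complex.I)‖ₑ ^ 2 ≤ C) ∧
    ∃ G : ℝ → H,
      (∀ᵐ τ : ℝ, Tendsto (fun ε : ℝ => A.compResolvent L φ (τ + (s * ε : ℝ) * Complex.I))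
        (𝓝[>] 0) (𝓝 (G τ))) ∧
      ∫⁻ τ : ℝ, ‖G τ‖ₑ ^ 2 ≤ C

end UnboundedOperators

namespace HalfLine

/-- Lebesgue measure on `(0, ∞)`. -/
noncomputable abbrev μ : Measure ℝ := volume.restrict (Ioi 0)

/-- The Hilbert space `L²(0, ∞)`. -/
noncomputable abbrev L2 : Type := Lp ℂ 2 μ

/-- On `(0, ∞)` the function `y` is differentiable, its derivative is locally absolutely
continuous, and `y'' = g` almost everywhere. -/
def HasSecondDeriv (y g : ℝ → ℂ) : Prop :=
  (∀ x, 0 < x → DifferentiableAt ℝ y x) ∧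
    ∀ a b, 0 < a → 0 < b → IntervalIntegrable g volume a b ∧
      deriv y b - deriv y a = ∫ x in a..b, g x

/-- `e` is the Jost solution `e(·, k)` on `[0, ∞)`: a solution of `-y'' + V y = k² y` on `(0, ∞)`,
continuous at `0`, with `e(x) ~ exp(ikx)` as `x → ∞`. -/
structure IsJostSolution (V : ℝ → ℂ) (k : ℂ) (e : ℝ → ℂ) : Prop where
  tendsto_zero : Tendsto e (𝓝[>] 0) (𝓝 (e 0))
  equation : HasSecondDeriv e (fun x => (V x - k ^ 2) * e x)
  asymptotics : Tendsto (fun x : ℝ => e x * Complex.exp (-(Complex.I * k * x))) atTop (𝓝 1)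

/-- `u` is in the domain of the Dirichlet operator `-d²/dx² + V` on `L²(0, ∞)` and is mapped to `f`:
`u` has a representative `y` with `y, y'` locally absolutely continuous on `(0, ∞)`, `y(0+) = 0`,
and `-y'' + V y = f`. -/
def SchrodingerRel (V : ℝ → ℂ) (u f : L2) : Prop :=
  ∃ y : ℝ → ℂ, u =ᵐ[μ] y ∧ Tendsto y (𝓝[>] 0) (𝓝 0) ∧
    HasSecondDeriv y (fun x => V x * y x - f x)

theorem HasSecondDeriv.congr {y g g' : ℝ → ℂ} (h : HasSecondDeriv y g) (hg : g =ᵐ[μ] g') :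
    HasSecondDeriv y g' := by
  refine ⟨h.1, fun a b ha hb => ?_⟩
  have hsub : Ι a b ⊆ Ioi (0 : ℝ) := fun x hx => lt_of_lt_of_le (lt_min ha hb) hx.1.le
  have hab : g =ᵐ[volume.restrict (Ι a b)] g' := ae_restrict_of_ae_restrict_of_subset hsub hg
  obtain ⟨h1, h2⟩ := h.2 a b ha hb
  refine ⟨h1.congr_ae hab, ?_⟩
  rw [h2]
  exact intervalIntegral.integral_congr_ae_restrict hab

theorem HasSecondDeriv.add {y g y' g' : ℝ → ℂ} (h : HasSecondDeriv y g)
    (h' : HasSecondDeriv y' g') : HasSecondDeriv (y + y') (g + g') := by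
  refine ⟨fun x hx => (h.1 x hx).add (h'.1 x hx), fun a b ha hb => ?_⟩
  obtain ⟨h1, h2⟩ := h.2 a b ha hb
  obtain ⟨h1', h2'⟩ := h'.2 a b ha hb
  refine ⟨h1.add h1', ?_⟩
  rw [deriv_add (h.1 b hb) (h'.1 b hb), deriv_add (h.1 a ha) (h'.1 a ha)]
  simp only [Pi.add_apply]
  rw [intervalIntegral.integral_add h1 h1', ← h2, ← h2']
  ring

theorem HasSecondDeriv.const_smul {y g : ℝ → ℂ} (c : ℂ) (h : HasSecondDeriv y g) :
    HasSecondDeriv (c • y) (c • g) := by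
  refine ⟨fun x hx => (h.1 x hx).const_smul c, fun a b ha hb => ?_⟩
  obtain ⟨h1, h2⟩ := h.2 a b ha hb
  refine ⟨h1.smul c, ?_⟩
  rw [deriv_const_smul c (h.1 b hb), deriv_const_smul c (h.1 a ha)]
  simp only [Pi.smul_apply]
  rw [intervalIntegral.integral_smul, ← h2, smul_sub]

theorem HasSecondDeriv.ae_eq_zero {y g : ℝ → ℂ} (h : HasSecondDeriv y g)
    (hy : ∀ x, 0 < x → y x = 0) : g =ᵐ[μ] 0 := by
  have hd : ∀ x, 0 < x → deriv y x = 0 := by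
    intro x hx
    have : y =ᶠ[𝓝 x] fun _ => 0 := by
      filter_upwards [Ioi_mem_nhds hx] with t ht using hy t ht
    rw [this.deriv_eq, deriv_const]
  have key : ∀ n : ℕ, ∀ᵐ x, x ∈ Ioo (1 / ((n : ℝ) + 1)) (n + 1) → g x = 0 := by
    intro n
    have hn : (0 : ℝ) < 1 / ((n : ℝ) + 1) := by positivity
    have hn' : (0 : ℝ) < (n : ℝ) + 1 := by positivity
    have hle : 1 / ((n : ℝ) + 1) ≤ (n : ℝ) + 1 := by
      rw [div_le_iff₀ hn']; nlinarith [(Nat.cast_nonneg n : (0 : ℝ) ≤ n)]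
    filter_upwards [(h.2 _ _ hn hn').1.ae_hasDerivAt_integral] with x hx hxI
    have hx1 : x ∈ uIcc (1 / ((n : ℝ) + 1)) ((n : ℝ) + 1) := by
      rw [uIcc_of_le hle]; exact Ioo_subset_Icc_self hxI
    have hD := hx hx1 (1 / ((n : ℝ) + 1)) left_mem_uIcc
    have h0 : (fun t => ∫ s in (1 / ((n : ℝ) + 1))..t, g s) =ᶠ[𝓝 x] fun _ => 0 := by
      filter_upwards [Ioi_mem_nhds (hn.trans hxI.1)] with t ht
      rw [← (h.2 _ t hn ht).2, hd t ht, hd _ hn, sub_zero]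
    rw [← hD.deriv, h0.deriv_eq, deriv_const]
  rw [EventuallyEq, ae_restrict_iff' measurableSet_Ioi]
  filter_upwards [ae_all_iff.2 key] with x hx hx0
  have hx0' : (0 : ℝ) < x := hx0
  obtain ⟨n, hn⟩ := exists_nat_gt (max x (1 / x))
  refine hx n ⟨?_, ?_⟩
  · rw [one_div_lt (by positivity) hx0']
    have := (le_max_right x (1 / x)).trans_lt hn
    linarith
  · have := (le_max_left x (1 / x)).trans_lt hn
    linarith

/-- The graph of the Dirichlet operator `-d²/dx² + V`. -/
noncomputable def schrodingerGraph (V : ℝ → ℂ) : Submodule ℂ (L2 × L2) where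
  carrier := {p | SchrodingerRel V p.1 p.2}
  add_mem' := by
    rintro ⟨u, f⟩ ⟨u', f'⟩ ⟨y, hu, h0, hy⟩ ⟨y', hu', h0', hy'⟩
    refine ⟨y + y', (Lp.coeFn_add u u').trans (hu.add hu'), by
      have := h0.add h0'
      rwa [add_zero] at this,
      (hy.add hy').congr ?_⟩
    filter_upwards [Lp.coeFn_add f f'] with x hx
    simp only [Prod.mk_add_mk, hx, Pi.add_apply]
    ring
  zero_mem' := by
    refine ⟨0, Lp.coeFn_zero _ _ _, tendsto_const_nhds, ?_⟩
    have h : HasSecondDeriv 0 0 := by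
      have hd : deriv (0 : ℝ → ℂ) = 0 := by
        funext x; exact deriv_const x (0 : ℂ)
      refine ⟨fun x _ => differentiableAt_const (0 : ℂ), fun a b _ _ => ⟨?_, ?_⟩⟩
      · exact intervalIntegrable_const (c := (0 : ℂ))
      · simp [hd]
    refine h.congr ?_
    filter_upwards [Lp.coeFn_zero ℂ 2 μ] with x hx
    change 0 = V x * 0 - ((0 : L2) : ℝ → ℂ) x
    rw [hx]
    simp
  smul_mem' := by
    rintro c ⟨u, f⟩ ⟨y, hu, h0, hy⟩
    refine ⟨c • y, (Lp.coeFn_smul c u).trans (hu.const_smul c), by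
      have := h0.const_smul c
      rwa [smul_zero] at this,
      (hy.const_smul c).congr ?_⟩
    filter_upwards [Lp.coeFn_smul c f] with x hx
    simp only [Prod.smul_mk, hx, Pi.smul_apply, smul_eq_mul]
    ring

theorem schrodingerGraph_single_valued (V : ℝ → ℂ) (p : L2 × L2) (hp : p ∈ schrodingerGraph V)
    (h0 : p.1 = 0) : p.2 = 0 := by
  obtain ⟨u, f⟩ := p
  obtain ⟨y, hu, -, hy⟩ := hp
  simp only at h0 hu hy ⊢
  subst h0
  have hy0 : y =ᵐ[μ] fun _ => (0 : ℂ) := hu.symm.trans (Lp.coeFn_zero ℂ 2 μ)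
  have hyz : EqOn y (fun _ => (0 : ℂ)) (Ioi 0) :=
    Measure.eqOn_open_of_ae_eq hy0 isOpen_Ioi
      (fun x hx => (hy.1 x hx).continuousAt.continuousWithinAt) continuousOn_const
  have hg := hy.ae_eq_zero fun x hx => hyz hx
  refine Lp.ext ?_
  filter_upwards [hg, Lp.coeFn_zero ℂ 2 μ, ae_restrict_mem measurableSet_Ioi] with x hx hx' hxp
  rw [hx']
  simpa [hyz hxp] using hx

/-- The Schrödinger operator `L_V = -d²/dx² + V` in `L²(0, ∞)` with Dirichlet condition at `0`. -/
noncomputable def schrodingerOp (V : ℝ → ℂ) : L2 →ₗ.[ℂ] L2 :=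
  (schrodingerGraph V).toLinearPMap

theorem schrodingerOp_graph (V : ℝ → ℂ) : (schrodingerOp V).graph = schrodingerGraph V :=
  Submodule.toLinearPMap_graph_eq _ (schrodingerGraph_single_valued V)

/-- The maximal operator of multiplication by the function `a` in `L²(0, ∞)`. -/
noncomputable def mulOp (a : ℝ → ℂ) : L2 →ₗ.[ℂ] L2 where
  domain :=
    { carrier := {u | MemLp (fun x => a x * u x) 2 μ}
      add_mem' := by
        intro u v hu hv
        refine (hu.add hv).ae_eq ?_
        filter_upwards [Lp.coeFn_add u v] with x hx
        simp only [Pi.add_apply, hx]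
        ring
      zero_mem' := by
        refine (MemLp.zero (ε := ℂ)).ae_eq ?_
        filter_upwards [Lp.coeFn_zero ℂ 2 μ] with x hx
        change 0 = a x * ((0 : L2) : ℝ → ℂ) x
        rw [hx]
        simp
      smul_mem' := by
        intro c u hu
        refine (hu.const_smul c).ae_eq ?_
        filter_upwards [Lp.coeFn_smul c u] with x hx
        simp only [Pi.smul_apply, hx, smul_eq_mul]
        ring }
  toFun :=
    { toFun := fun u => MemLp.toLp (fun x => a x * (u : L2) x) u.2
      map_add' := by
        intro u v
        rw [← MemLp.toLp_add]
        refine MemLp.toLp_congr _ _ ?_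
        filter_upwards [Lp.coeFn_add (u : L2) (v : L2)] with x hx
        simp only [Submodule.coe_add, Pi.add_apply, hx]
        ring
      map_smul' := by
        intro c u
        rw [RingHom.id_apply, ← MemLp.toLp_const_smul]
        refine MemLp.toLp_congr _ _ ?_
        filter_upwards [Lp.coeFn_smul c (u : L2)] with x hx
        simp only [Submodule.coe_smul, Pi.smul_apply, hx, smul_eq_mul]
        ring }

end HalfLine

/-! Write the spectral parameter as `k ^ 2` with Im k > 0 and factor V = b a with |a|² = |b|² = |V|.
The free Green function exp(ik max(x,y)) sin(k min(x,y))/k has squared modulus at most xy throughout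
Im k ≥ 0. Hence Q(k) = a R₀(k²) b is Hilbert-Schmidt, with a bound depending only on ∫ x|V|, and the
resolvent identity gives a R_V(k²) = (1 + Q(k))⁻¹ a R₀(k²). Two facts remain: (1 + Q(k))⁻¹ is
bounded uniformly on Im k ≥ 0, and a is smooth relative to the free operator.

For the inverse, Q(k) is compact, norm continuous up to the real axis including k = 0, and tends to
0 as |k| → ∞. By the Fredholm alternative only a vector with Q(k)v = -v can obstruct invertibility.
Such a vector produces a solution u = -R₀(k²)(Vu) with u(0) = 0 and u(x) exp(-ikx) → c. If c ≠ 0,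
then u/c is a Jost solution vanishing at 0, which is excluded; if c = 0, then u solves a homogeneous
Volterra equation at infinity and is zero. This is `lippmannSchwinger_eq_zero`, used in
`isUnit_one_add_bsOp` and `exists_norm_inverse_le`.

For the free operator, the Fourier transform writes a R₀(z)φ as a superposition of the vectors a(x)
sin(2πxξ), whose squared L² norm is O(|ξ|) since sin² t ≤ 2|t|. The substitution l = 4π²ξ² has
Jacobian proportional to ξ, which compensates exactly. So a R₀(z)φ is the Cauchy transform of an
L²-valued density in L²(ℝ) with norm bounded by a multiple of ‖φ‖ (`lintegral_density_le`,
`mulFreeResolvent_eq_cauchy`). Such a Cauchy transform is the Poisson integral of an L² function,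
which gives the uniform bound and the boundary values almost everywhere (`cauchyTransform`).

It must also be shown that the operator so constructed is the resolvent of `schrodingerOp V`. Since
V is complex there is no self-adjointness; injectivity comes from a Wronskian identity
(`eq_zero_of_schrodingerRel`). Analyticity follows from the first resolvent identity, and the bound
on the boundary values from Fatou's lemma. -/

/-! ### The free Green function and its pointwise bounds. -/

namespace HalfLine

/-- The function `y ↦ sin (k y) / k`, equal to `y` for `k = 0`. -/
noncomputable def sinK (k : ℂ) (y : ℝ) : ℂ :=
  (y / 2 : ℂ) * ∫ t in (-1 : ℝ)..1, Complex.exp (Complex.I * k * y * t)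

theorem sinK_zero_left (y : ℝ) : sinK 0 y = y := by
  simp [sinK]
  norm_num

theorem sinK_zero_right (k : ℂ) : sinK k 0 = 0 := by
  simp [sinK]

theorem mul_sinK (k : ℂ) (y : ℝ) : k * sinK k y = Complex.sin (k * y) := by
  rcases eq_or_ne (k * y) 0 with h | h
  · rcases mul_eq_zero.1 h with h | h
    · simp [h]
    · simp [sinK, h]
  · have hk : k ≠ 0 := left_ne_zero_of_mul h
    have hy : (y : ℂ) ≠ 0 := right_ne_zero_of_mul h
    have hc : Complex.I * k * y ≠ 0 := by
      rw [mul_assoc]; exact mul_ne_zero Complex.I_ne_zero h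
    rw [sinK, integral_exp_mul_complex hc, Complex.sin]
    push_cast
    have h1 : Complex.I * k * y * 1 = k * y * Complex.I := by ring
    have h2 : Complex.I * k * y * -1 = -(k * y) * Complex.I := by ring
    rw [h1, h2]
    field_simp
    linear_combination (Complex.exp (k * y * Complex.I) - Complex.exp (-(k * y * Complex.I))) *
      Complex.I_sq

theorem sinK_of_ne_zero {k : ℂ} (hk : k ≠ 0) (y : ℝ) : sinK k y = Complex.sin (k * y) / k := by
  rw [← mul_sinK, mul_div_cancel_left₀ _ hk]

/-- Here the integral form of `sinK` pays off: it is jointly continuous with no special treatment of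
k = 0, a point that must be included in the closed half-plane. -/
theorem continuous_sinK : Continuous fun p : ℂ × ℝ => sinK p.1 p.2 := by
  unfold sinK
  refine Continuous.mul (by fun_prop) ?_
  exact intervalIntegral.continuous_parametric_intervalIntegral_of_continuous' (by fun_prop) _ _

theorem norm_sinK_le {k : ℂ} (hk : 0 ≤ k.im) {y : ℝ} (hy : 0 ≤ y) :
    ‖sinK k y‖ ≤ y * Real.exp (k.im * y) := by
  have h : ‖∫ t in (-1 : ℝ)..1, Complex.exp (Complex.I * k * y * t)‖ ≤
      Real.exp (k.im * y) * |1 - (-1)| := by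
    refine intervalIntegral.norm_integral_le_of_norm_le_const fun t ht => ?_
    rw [uIoc_of_le (by norm_num)] at ht
    rw [Complex.norm_exp]
    have : (Complex.I * k * y * t).re = -(k.im * y * t) := by
      simp [Complex.mul_re]
    rw [this]
    refine Real.exp_le_exp.2 ?_
    nlinarith [mul_nonneg hk hy, ht.1]
  rw [sinK, norm_mul]
  have h2 : ‖(y / 2 : ℂ)‖ = y / 2 := by
    rw [norm_div, Complex.norm_real, Real.norm_of_nonneg hy]; simp
  rw [h2]
  norm_num at h
  nlinarith

theorem norm_sin_le {k : ℂ} (hk : 0 ≤ k.im) {y : ℝ} (hy : 0 ≤ y) :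
    ‖Complex.sin (k * y)‖ ≤ Real.exp (k.im * y) := by
  have h1 : ‖Complex.exp (-(k * y) * Complex.I)‖ = Real.exp (k.im * y) := by
    rw [Complex.norm_exp]; simp
  have h2 : ‖Complex.exp (k * y * Complex.I)‖ ≤ Real.exp (k.im * y) := by
    rw [Complex.norm_exp]
    refine Real.exp_le_exp.2 ?_
    simp
    nlinarith [mul_nonneg hk hy]
  rw [Complex.sin, norm_div, norm_mul, Complex.norm_I]
  simp only [mul_one, Complex.norm_ofNat]
  have := norm_sub_le (Complex.exp (-(k * y) * Complex.I)) (Complex.exp (k * y * Complex.I))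
  linarith

theorem norm_cos_le {k : ℂ} (hk : 0 ≤ k.im) {y : ℝ} (hy : 0 ≤ y) :
    ‖Complex.cos (k * y)‖ ≤ Real.exp (k.im * y) := by
  have h1 : ‖Complex.exp (-(k * y) * Complex.I)‖ = Real.exp (k.im * y) := by
    rw [Complex.norm_exp]; simp
  have h2 : ‖Complex.exp (k * y * Complex.I)‖ ≤ Real.exp (k.im * y) := by
    rw [Complex.norm_exp]
    refine Real.exp_le_exp.2 ?_
    simp
    nlinarith [mul_nonneg hk hy]
  rw [Complex.cos, norm_div]
  simp only [Complex.norm_ofNat]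
  have := norm_add_le (Complex.exp (k * y * Complex.I)) (Complex.exp (-(k * y) * Complex.I))
  linarith

theorem hasDerivAt_sinK (k : ℂ) (y : ℝ) : HasDerivAt (sinK k) (Complex.cos (k * y)) y := by
  rcases eq_or_ne k 0 with rfl | hk
  · have : sinK 0 = fun y : ℝ => (y : ℂ) := funext sinK_zero_left
    rw [this]
    simpa using (hasDerivAt_id y).ofReal_comp
  · have : sinK k = fun y : ℝ => Complex.sin (k * y) / k := funext (sinK_of_ne_zero hk)
    rw [this]
    have h1 : HasDerivAt (fun y : ℝ => k * (y : ℂ)) k y := by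
      simpa using ((hasDerivAt_id y).ofReal_comp).const_mul k
    have := ((Complex.hasDerivAt_sin _).comp y h1).div_const k
    convert! this using 1
    field_simp

theorem hasDerivAt_cexp (k : ℂ) (y : ℝ) :
    HasDerivAt (fun y : ℝ => Complex.exp (Complex.I * k * y))
      (Complex.I * k * Complex.exp (Complex.I * k * y)) y := by
  have h1 : HasDerivAt (fun y : ℝ => Complex.I * k * (y : ℂ)) (Complex.I * k) y := by
    simpa using ((hasDerivAt_id y).ofReal_comp).const_mul (Complex.I * k)
  simpa [mul_comm] using h1.cexp

theorem norm_cexp (k : ℂ) (y : ℝ) :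
    ‖Complex.exp (Complex.I * k * y)‖ = Real.exp (-(k.im * y)) := by
  rw [Complex.norm_exp]; simp

/-- The Green function of `-d²/dx² - k²` on the half-line with Dirichlet condition at `0`. -/
noncomputable def green (k : ℂ) (x y : ℝ) : ℂ :=
  Complex.exp (Complex.I * k * (max x y : ℝ)) * sinK k (min x y)

theorem green_comm (k : ℂ) (x y : ℝ) : green k x y = green k y x := by
  rw [green, green, max_comm, min_comm]

theorem green_of_le {x y : ℝ} (k : ℂ) (h : x ≤ y) :
    green k x y = Complex.exp (Complex.I * k * y) * sinK k x := by
  rw [green, max_eq_right h, min_eq_left h]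

theorem green_of_ge {x y : ℝ} (k : ℂ) (h : y ≤ x) :
    green k x y = Complex.exp (Complex.I * k * x) * sinK k y := by
  rw [green, max_eq_left h, min_eq_right h]

theorem continuous_green : Continuous fun p : ℂ × ℝ × ℝ => green p.1 p.2.1 p.2.2 := by
  unfold green
  refine Continuous.mul (by fun_prop) ?_
  exact continuous_sinK.comp (f := fun p : ℂ × ℝ × ℝ => (p.1, min p.2.1 p.2.2)) (by fun_prop)

/-- The growth exp(Im k · min) of the sine is absorbed by the decay exp(-Im k · max), since max -
min = |x - y|. The factor min(x, y) survives uniformly as k → 0. -/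
theorem norm_green_le {k : ℂ} (hk : 0 ≤ k.im) {x y : ℝ} (hx : 0 ≤ x) (hy : 0 ≤ y) :
    ‖green k x y‖ ≤ min x y * Real.exp (-(k.im * |x - y|)) := by
  rw [green, norm_mul, norm_cexp]
  have h := norm_sinK_le hk (le_min hx hy)
  have e : Real.exp (-(k.im * |x - y|)) =
      Real.exp (-(k.im * max x y)) * Real.exp (k.im * min x y) := by
    rw [← Real.exp_add, ← max_sub_min_eq_abs' x y]
    congr 1
    ring
  rw [e]
  calc _ ≤ Real.exp (-(k.im * max x y)) * (min x y * Real.exp (k.im * min x y)) := by gcongr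
    _ = _ := by ring

/-- The companion bound for large |k|: the sine is estimated without using its zero at the origin,
and the division by k gives decay. -/
theorem norm_green_le_inv {k : ℂ} (hk : 0 ≤ k.im) (hk0 : k ≠ 0) {x y : ℝ} (hx : 0 ≤ x)
    (hy : 0 ≤ y) : ‖green k x y‖ ≤ ‖k‖⁻¹ * Real.exp (-(k.im * |x - y|)) := by
  rw [green, norm_mul, norm_cexp, sinK_of_ne_zero hk0, norm_div]
  have h := norm_sin_le hk (le_min hx hy)
  have e : Real.exp (-(k.im * |x - y|)) =
      Real.exp (-(k.im * max x y)) * Real.exp (k.im * min x y) := by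
    rw [← Real.exp_add, ← max_sub_min_eq_abs' x y]
    congr 1
    ring
  rw [e]
  calc _ ≤ Real.exp (-(k.im * max x y)) * (Real.exp (k.im * min x y) / ‖k‖) := by gcongr
    _ = _ := by ring

theorem norm_green_le_min {k : ℂ} (hk : 0 ≤ k.im) {x y : ℝ} (hx : 0 ≤ x) (hy : 0 ≤ y) :
    ‖green k x y‖ ≤ min x y := by
  refine (norm_green_le hk hx hy).trans (mul_le_of_le_one_right (le_min hx hy) ?_)
  rw [Real.exp_le_one_iff]
  have := mul_nonneg hk (abs_nonneg (x - y))
  linarith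

/-- The splitting min² ≤ xy separates the variables independently of k. It is what makes the finite
first moment of |V| sufficient for Hilbert-Schmidt bounds. -/
theorem norm_green_sq_le {k : ℂ} (hk : 0 ≤ k.im) {x y : ℝ} (hx : 0 ≤ x) (hy : 0 ≤ y) :
    ‖green k x y‖ ^ 2 ≤ x * y := by
  have h := norm_green_le_min hk hx hy
  calc _ ≤ min x y ^ 2 := by gcongr
    _ = min x y * min x y := sq _
    _ ≤ x * y := mul_le_mul (min_le_left _ _) (min_le_right _ _) (le_min hx hy) hx

theorem norm_green_le_sqrt {k : ℂ} (hk : 0 ≤ k.im) {x y : ℝ} (hx : 0 ≤ x) (hy : 0 ≤ y) :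
    ‖green k x y‖ ≤ √x * √y := by
  rw [← Real.sqrt_mul hx]
  exact Real.le_sqrt_of_sq_le (norm_green_sq_le hk hx hy)

end HalfLine

/-! ### The multiplication formula for the Fourier transform on vector-valued L². -/

section FourierPairing
open FourierTransform

variable {E : Type*} [NormedAddCommGroup E] [InnerProductSpace ℂ E] [CompleteSpace E]

/-- For Schwartz h this is Fubini. Both sides are continuous in h for the L² norm, because p and its
transform are square integrable, so density finishes the proof. -/
theorem integral_fourier_smul_eq_of_memLp {p : ℝ → ℂ} (hp : Integrable p) (hp2 : MemLp p 2)
    (hq2 : MemLp (𝓕 p) 2) (h : Lp E 2 (volume : Measure ℝ)) :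
    ∫ x, 𝓕 p x • h x = ∫ x, p x • (𝓕 h : Lp E 2 (volume : Measure ℝ)) x := by
  have key : ∀ {q : ℝ → ℂ} (hq : MemLp q 2) (h : Lp E 2 (volume : Measure ℝ)),
      ∫ x, q x • h x = (ContinuousLinearMap.lsmul ℂ ℂ (E := E)).lpPairing volume 2 2
        (hq.toLp q) h := by
    intro q hq h
    rw [ContinuousLinearMap.lpPairing_eq_integral]
    refine integral_congr_ae ?_
    filter_upwards [hq.coeFn_toLp] with x hx
    simp [hx]
  induction h using DenseRange.induction_on
    (SchwartzMap.denseRange_toLpCLM (E := ℝ) (F := E) (μ := volume) (p := 2)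
      ENNReal.ofNat_ne_top) with
  | hp =>
    simp_rw [key hq2, key hp2]
    exact isClosed_eq (by fun_prop)
      ((ContinuousLinearMap.continuous _).comp (Lp.fourierTransformₗᵢ ℝ E).continuous)
  | ih f =>
    have e1 : ∀ f : SchwartzMap ℝ E, SchwartzMap.toLpCLM ℝ E 2 volume f = f.toLp 2 := fun _ => rfl
    rw [e1, SchwartzMap.toLp_fourier_eq]
    have l1 : ∫ x, 𝓕 p x • (f.toLp 2 : Lp E 2 volume) x = ∫ x, 𝓕 p x • f x := by
      refine integral_congr_ae ?_
      filter_upwards [f.coeFn_toLp 2 volume] with x hx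
      rw [hx]
    have l2 : ∫ x, p x • ((𝓕 f).toLp 2 : Lp E 2 volume) x = ∫ x, p x • (𝓕 f) x := by
      refine integral_congr_ae ?_
      filter_upwards [(𝓕 f).coeFn_toLp 2 volume] with x hx
      rw [hx]
    rw [l1, l2]
    have := VectorFourier.integral_fourierIntegral_smul_eq_flip (μ := (volume : Measure ℝ))
      (ν := (volume : Measure ℝ)) (L := innerₗ ℝ) (f := p) (g := f)
      Real.continuous_fourierChar continuous_inner hp f.integrable
    rw [flip_innerₗ] at this
    exact this

end FourierPairing

/-! ### The Poisson kernel and convergence at Lebesgue points. -/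

section Poisson

variable {E : Type*} [NormedAddCommGroup E] [NormedSpace ℝ E] [CompleteSpace E]

/-- The Poisson kernel of the upper half-plane. -/
noncomputable def poissonKernelLine (ε s : ℝ) : ℝ := Real.pi⁻¹ * ε * (s ^ 2 + ε ^ 2)⁻¹

theorem poissonKernelLine_nonneg {ε : ℝ} (hε : 0 ≤ ε) (s : ℝ) : 0 ≤ poissonKernelLine ε s := by
  unfold poissonKernelLine; positivity

theorem continuous_poissonKernelLine {ε : ℝ} (hε : 0 < ε) : Continuous (poissonKernelLine ε) := by
  unfold poissonKernelLine
  exact continuous_const.mul ((by fun_prop : Continuous fun s : ℝ => s ^ 2 + ε ^ 2).inv₀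
    fun s => by positivity)

theorem poissonKernelLine_sub {ε : ℝ} (hε : 0 < ε) (τ s : ℝ) :
    poissonKernelLine ε (s - τ) = ProbabilityTheory.cauchyPDFReal τ ⟨ε, hε.le⟩ s := rfl

theorem integrable_poissonKernelLine {ε : ℝ} (hε : 0 < ε) (τ : ℝ) :
    Integrable fun s => poissonKernelLine ε (s - τ) := by
  simp_rw [poissonKernelLine_sub hε]
  exact ProbabilityTheory.integrable_cauchyPDFReal _

theorem integral_poissonKernelLine {ε : ℝ} (hε : 0 < ε) (τ : ℝ) :
    ∫ s, poissonKernelLine ε (s - τ) = 1 := by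
  simp_rw [poissonKernelLine_sub hε]
  exact ProbabilityTheory.integral_cauchyPDFReal_eq_one _ fun h => hε.ne' (congrArg NNReal.toReal h)

theorem poissonKernelLine_le {ε : ℝ} (hε : 0 < ε) (s : ℝ) :
    poissonKernelLine ε s ≤ Real.pi⁻¹ * ε⁻¹ := by
  unfold poissonKernelLine
  have h : (s ^ 2 + ε ^ 2)⁻¹ ≤ (ε ^ 2)⁻¹ := inv_anti₀ (by positivity) (by nlinarith [sq_nonneg s])
  calc _ ≤ Real.pi⁻¹ * ε * (ε ^ 2)⁻¹ := by gcongr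
    _ = _ := by field_simp

/-- Take the least m with |s| ≤ 2^m ε. Either m = 0 and the maximum of the kernel suffices, or |s| >
2^(m-1) ε and the tail ε/(π s²) is at most the m-th height; the factor 4 pays for the shift from m
to m - 1. -/
theorem ofReal_poissonKernelLine_le_tsum {ε : ℝ} (hε : 0 < ε) (s : ℝ) :
    ENNReal.ofReal (poissonKernelLine ε s) ≤ ∑' n : ℕ,
      (Metric.closedBall (0 : ℝ) (2 ^ n * ε)).indicator
        (fun _ => ENNReal.ofReal (4 * Real.pi⁻¹ * ε⁻¹ * (1 / 4) ^ n)) s := by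
  obtain ⟨n, hn⟩ : ∃ n : ℕ, |s| ≤ 2 ^ n * ε := by
    obtain ⟨n, hn⟩ := pow_unbounded_of_one_lt (|s| / ε) (one_lt_two)
    exact ⟨n, (div_le_iff₀ hε).1 hn.le⟩
  classical
  have hfind := Nat.find_spec (⟨n, hn⟩ : ∃ n : ℕ, |s| ≤ 2 ^ n * ε)
  set m := Nat.find (⟨n, hn⟩ : ∃ n : ℕ, |s| ≤ 2 ^ n * ε) with hm
  refine le_trans ?_ (ENNReal.le_tsum m)
  rw [indicator_of_mem (by simpa using hfind)]
  refine ENNReal.ofReal_le_ofReal ?_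
  rcases Nat.eq_zero_or_pos m with h0 | hpos
  · rw [h0, pow_zero, mul_one]
    refine (poissonKernelLine_le hε s).trans ?_
    have : 0 ≤ Real.pi⁻¹ * ε⁻¹ := by positivity
    linarith
  · have hlt : 2 ^ (m - 1) * ε < |s| := not_le.1 (Nat.find_min _ (Nat.sub_lt hpos one_pos))
    obtain ⟨j, hj⟩ : ∃ j, m = j + 1 := ⟨m - 1, by omega⟩
    rw [hj] at hlt ⊢
    simp only [Nat.add_sub_cancel] at hlt
    have h4 : (2 ^ j * ε) ^ 2 ≤ s ^ 2 := by
      rw [← sq_abs s]; gcongr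
    have h4' : ((2 : ℝ) ^ j) ^ 2 = 4 ^ j := by rw [← pow_mul, mul_comm, pow_mul]; norm_num
    unfold poissonKernelLine
    have h5 : (s ^ 2 + ε ^ 2)⁻¹ ≤ (4 ^ j * ε ^ 2)⁻¹ :=
      inv_anti₀ (by positivity) (by rw [mul_pow, h4'] at h4; nlinarith [sq_nonneg ε])
    calc _ ≤ Real.pi⁻¹ * ε * (4 ^ j * ε ^ 2)⁻¹ := by gcongr
      _ = _ := by
        rw [one_div, inv_pow, pow_succ]
        field_simp
        ring

/-- The dyadic majorant bounds the Poisson integral by a series of averages of N over balls of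
radius 2^n ε with weights 2^(-n). Each average tends to 0 and all averages are bounded, so dominated
convergence for series applies. -/
theorem tendsto_poisson_of_lebesgue_point {N : ℝ → ℝ} (hN0 : ∀ s, 0 ≤ N s)
    (hN : LocallyIntegrable N) {τ B : ℝ}
    (hB : ∀ r, 1 ≤ r → ∫ s in Metric.closedBall τ r, N s ≤ B * r)
    (hL : Tendsto (fun r => ⨍ s in Metric.closedBall τ r, N s) (𝓝[>] 0) (𝓝 0)) :
    Tendsto (fun ε => ∫⁻ s, ENNReal.ofReal (poissonKernelLine ε (s - τ)) * ENNReal.ofReal (N s))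
      (𝓝[>] 0) (𝓝 0) := by
  set A : ℝ → ℝ := fun r => ⨍ s in Metric.closedBall τ r, N s with hA
  have hAe : ∀ r, 0 < r → A r = (2 * r)⁻¹ * ∫ s in Metric.closedBall τ r, N s := by
    intro r hr
    rw [hA]
    simp only [setAverage_eq, smul_eq_mul, measureReal_def, Real.volume_closedBall]
    rw [ENNReal.toReal_ofReal (by positivity)]
  have hA0 : ∀ r, 0 < r → 0 ≤ A r := by
    intro r hr
    rw [hAe r hr]
    have := setIntegral_nonneg (μ := volume) (s := Metric.closedBall τ r) measurableSet_closedBall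
      fun s _ => hN0 s
    positivity
  obtain ⟨B', hB'0, hB'⟩ : ∃ B', 0 ≤ B' ∧ ∀ r, 0 < r → A r ≤ B' := by
    have := hL.eventually (gt_mem_nhds one_pos)
    obtain ⟨r₀, hr₀, hr₀'⟩ := mem_nhdsGT_iff_exists_Ioc_subset.1 this
    have hr₀ : 0 < r₀ := hr₀
    have hB0 : 0 ≤ B := by
      have h1 := hB 1 le_rfl
      have h2 := setIntegral_nonneg (μ := volume) (s := Metric.closedBall τ 1)
        measurableSet_closedBall fun s _ => hN0 s
      linarith
    refine ⟨1 + B * (1 + 1 / r₀), by positivity, fun r hr => ?_⟩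
    rcases le_or_gt r r₀ with h | h
    · have : A r < 1 := hr₀' ⟨hr, h⟩
      have : 0 ≤ B * (1 + 1 / r₀) := by positivity
      linarith
    · rw [hAe r hr]
      -- The growth hypothesis only concerns radii at least 1, so the ball is first enlarged by 1.
      have h1 : ∫ s in Metric.closedBall τ r, N s ≤ B * (r + 1) :=
        (setIntegral_mono_set (hN.integrableOn_isCompact (isCompact_closedBall _ _))
          (Eventually.of_forall hN0)
          (Metric.closedBall_subset_closedBall (by linarith)).eventuallyLE).trans
          (hB (r + 1) (by linarith))
      calc _ ≤ (2 * r)⁻¹ * (B * (r + 1)) := by gcongr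
        _ = B * (1 + 1 / r) / 2 := by field_simp
        _ ≤ B * (1 + 1 / r₀) / 2 := by gcongr
        _ ≤ _ := by
          have : 0 ≤ B * (1 + 1 / r₀) := by positivity
          linarith
  have hsum : Tendsto (fun ε => ∑' n : ℕ, (8 * Real.pi⁻¹) * (1 / 2) ^ n * A (2 ^ n * ε))
      (𝓝[>] 0) (𝓝 0) := by
    have h0 : ∑' n : ℕ, (8 * Real.pi⁻¹) * (1 / 2) ^ n * (0 : ℝ) = 0 := by simp
    rw [← show 𝓝 (∑' n : ℕ, (8 * Real.pi⁻¹) * (1 / 2) ^ n * (0 : ℝ)) = 𝓝 0 from congrArg 𝓝 h0]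
    refine tendsto_tsum_of_dominated_convergence
      (bound := fun n => (8 * Real.pi⁻¹) * (1 / 2) ^ n * B') ?_ ?_ ?_
    · exact (summable_geometric_two.mul_left _).mul_right _
    · intro n
      refine Tendsto.const_mul _ (hL.comp ?_)
      refine tendsto_nhdsWithin_iff.2 ⟨?_, ?_⟩
      · have : Tendsto (fun ε : ℝ => 2 ^ n * ε) (𝓝 0) (𝓝 (2 ^ n * 0)) :=
          (continuous_const_mul _).tendsto 0
        rw [mul_zero] at this
        exact this.mono_left nhdsWithin_le_nhds
      · filter_upwards [self_mem_nhdsWithin] with ε hε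
        have : (0 : ℝ) < ε := hε
        exact mem_Ioi.2 (by positivity)
    · filter_upwards [self_mem_nhdsWithin] with ε hε n
      have hε : (0 : ℝ) < ε := hε
      have hp : 0 < 2 ^ n * ε := by positivity
      rw [Real.norm_of_nonneg (by have := hA0 _ hp; positivity)]
      gcongr
      exact hB' _ hp
  have hsum' := ENNReal.tendsto_ofReal hsum
  rw [ENNReal.ofReal_zero] at hsum'
  refine tendsto_of_tendsto_of_tendsto_of_le_of_le' tendsto_const_nhds hsum'
    (Eventually.of_forall fun _ => zero_le) ?_
  filter_upwards [self_mem_nhdsWithin] with ε hε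
  have hε : (0 : ℝ) < ε := hε
  have hNm : AEMeasurable (fun s => ENNReal.ofReal (N s)) :=
    hN.aestronglyMeasurable.aemeasurable.ennreal_ofReal
  calc _ ≤ ∫⁻ s, ∑' n : ℕ, (Metric.closedBall τ (2 ^ n * ε)).indicator
        (fun s => ENNReal.ofReal (4 * Real.pi⁻¹ * ε⁻¹ * (1 / 4) ^ n) * ENNReal.ofReal (N s)) s := by
        refine lintegral_mono fun s => ?_
        refine (mul_le_mul_left (ofReal_poissonKernelLine_le_tsum hε (s - τ)) _).trans ?_
        rw [← ENNReal.tsum_mul_right]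
        refine ENNReal.tsum_le_tsum fun n => ?_
        by_cases h : s ∈ Metric.closedBall τ (2 ^ n * ε)
        · rw [indicator_of_mem h, indicator_of_mem]
          simpa [Real.dist_eq] using h
        · rw [indicator_of_notMem h, indicator_of_notMem, zero_mul]
          simpa [Real.dist_eq] using h
    _ = ∑' n : ℕ, ENNReal.ofReal ((8 * Real.pi⁻¹) * (1 / 2) ^ n * A (2 ^ n * ε)) := by
        rw [lintegral_tsum fun n =>
          (hNm.const_mul _).indicator measurableSet_closedBall]
        refine tsum_congr fun n => ?_
        have hp : 0 < 2 ^ n * ε := by positivity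
        rw [lintegral_indicator measurableSet_closedBall, lintegral_const_mul'' _ hNm.restrict,
          ← ofReal_integral_eq_lintegral_ofReal
            (hN.integrableOn_isCompact (isCompact_closedBall _ _))
            (Eventually.of_forall hN0), ← ENNReal.ofReal_mul (by positivity), hAe _ hp]
        congr 1
        have h24 : ((1 : ℝ) / 4) ^ n = (1 / 2) ^ n * (1 / 2) ^ n := by
          rw [← mul_pow]; norm_num
        rw [h24]
        simp only [one_div, inv_pow]
        field_simp
        ring
    _ = _ := by
        rw [ENNReal.ofReal_tsum_of_nonneg]
        · intro n
          have := hA0 (2 ^ n * ε) (by positivity)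
          positivity
        · refine Summable.of_nonneg_of_le (fun n => ?_) (fun n => ?_)
            ((summable_geometric_two.mul_left (8 * Real.pi⁻¹)).mul_right B')
          · have := hA0 (2 ^ n * ε) (by positivity)
            positivity
          · have := hB' (2 ^ n * ε) (by positivity)
            gcongr

end Poisson

theorem MeasureTheory.Integrable.memLp_two_of_bound {α E : Type*} [MeasurableSpace α]
    {μ : Measure α} [NormedAddCommGroup E] {f : α → E} (hf : Integrable f μ) {C : ℝ}
    (hC : ∀ x, ‖f x‖ ≤ C) : MemLp f 2 μ := by
  rw [memLp_two_iff_integrable_sq_norm hf.1]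
  refine (hf.norm.const_mul C).mono' (hf.1.norm.pow 2) (Eventually.of_forall fun x => ?_)
  rw [Real.norm_of_nonneg (by positivity), sq]
  exact mul_le_mul_of_nonneg_right (hC x) (norm_nonneg _)

/-! ### Explicit exponential integrals. -/

section ExpAbs

theorem integrable_exp_neg_mul_abs {c : ℂ} (hc : 0 < c.re) (θ : ℝ) :
    Integrable fun t : ℝ => Complex.exp (Complex.I * θ * t - c * |t|) := by
  rw [← integrableOn_univ, ← Iic_union_Ioi (a := (0 : ℝ))]
  refine IntegrableOn.union ?_ ?_
  · refine (integrableOn_exp_mul_complex_Iic (a := Complex.I * θ + c) (by simpa using hc)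
      0).congr_fun (fun t ht => ?_) measurableSet_Iic
    simp only [abs_of_nonpos (show t ≤ 0 from ht)]
    push_cast
    ring_nf
  · refine (integrableOn_exp_mul_complex_Ioi (a := Complex.I * θ - c) (by simpa using hc)
      0).congr_fun (fun t ht => ?_) measurableSet_Ioi
    simp only [abs_of_nonneg (show 0 ≤ t from le_of_lt ht)]
    ring_nf

theorem integral_exp_neg_mul_abs {c : ℂ} (hc : 0 < c.re) (θ : ℝ) :
    ∫ t : ℝ, Complex.exp (Complex.I * θ * t - c * |t|) = 2 * c / (c ^ 2 + θ ^ 2) := by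
  have hi := integrable_exp_neg_mul_abs hc θ
  rw [← intervalIntegral.integral_Iic_add_Ioi (b := 0) hi.integrableOn hi.integrableOn]
  have h1 : ∫ t in Iic (0 : ℝ), Complex.exp (Complex.I * θ * t - c * |t|) =
      ∫ t in Iic (0 : ℝ), Complex.exp ((Complex.I * θ + c) * t) := by
    refine setIntegral_congr_fun measurableSet_Iic fun t ht => ?_
    simp only [abs_of_nonpos (show t ≤ 0 from ht)]
    push_cast
    ring_nf
  have h2 : ∫ t in Ioi (0 : ℝ), Complex.exp (Complex.I * θ * t - c * |t|) =
      ∫ t in Ioi (0 : ℝ), Complex.exp ((Complex.I * θ - c) * t) := by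
    refine setIntegral_congr_fun measurableSet_Ioi fun t ht => ?_
    simp only [abs_of_nonneg (show 0 ≤ t from le_of_lt ht)]
    ring_nf
  rw [h1, h2, integral_exp_mul_complex_Iic (by simpa using hc),
    integral_exp_mul_complex_Ioi (by simpa using hc)]
  have n1 : Complex.I * θ + c ≠ 0 := fun h => by
    have := congrArg Complex.re h
    simp at this
    linarith
  have n2 : Complex.I * θ - c ≠ 0 := fun h => by
    have := congrArg Complex.re h
    simp at this
    linarith
  have n3 : c ^ 2 + θ ^ 2 = -((Complex.I * θ + c) * (Complex.I * θ - c)) := by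
    linear_combination ((θ : ℂ) ^ 2) * Complex.I_sq
  have n4 : c ^ 2 + (θ : ℂ) ^ 2 ≠ 0 := by
    rw [n3]; exact neg_ne_zero.2 (mul_ne_zero n1 n2)
  simp only [Complex.ofReal_zero, mul_zero, Complex.exp_zero]
  rw [n3]
  field_simp
  ring

theorem integral_exp_Ioi_fourier {z : ℂ} (hz : 0 < z.im) (l : ℝ) :
    ∫ t in Ioi (0 : ℝ), Complex.exp (2 * Real.pi * Complex.I * (z - l) * t) =
      (2 * Real.pi * Complex.I)⁻¹ * ((l : ℂ) - z)⁻¹ := by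
  have hre : (2 * Real.pi * Complex.I * (z - l)).re < 0 := by
    simp
    positivity
  rw [integral_exp_mul_complex_Ioi hre]
  have n : z - l ≠ 0 := fun h => by
    have := congrArg Complex.im h
    simp at this
    linarith
  have n' : (l : ℂ) - z ≠ 0 := by rw [← neg_sub]; exact neg_ne_zero.2 n
  have hpi : (Real.pi : ℂ) ≠ 0 := by exact_mod_cast Real.pi_ne_zero
  have hI := Complex.I_ne_zero
  simp only [Complex.ofReal_zero, mul_zero, Complex.exp_zero]
  rw [← neg_sub z (l : ℂ)]
  field_simp

end ExpAbs

/-! ### Cauchy transforms as Poisson integrals. -/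

section Cauchy
open FourierTransform

theorem norm_ofReal_sub_inv_sq {z : ℂ} (hz : 0 < z.im) (l : ℝ) :
    ‖((l : ℂ) - z)⁻¹‖ ^ 2 = Real.pi / z.im * poissonKernelLine z.im (l - z.re) := by
  rw [norm_inv, inv_pow, ← Complex.normSq_eq_norm_sq, Complex.normSq_apply, poissonKernelLine]
  have : 0 < Real.pi := Real.pi_pos
  simp only [Complex.sub_re, Complex.ofReal_re, Complex.sub_im, Complex.ofReal_im, zero_sub]
  have e : (l - z.re) * (l - z.re) + -z.im * -z.im = (l - z.re) ^ 2 + z.im ^ 2 := by ring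
  rw [e]
  field_simp

theorem continuous_ofReal_sub_inv {z : ℂ} (hz : z.im ≠ 0) :
    Continuous fun l : ℝ => ((l : ℂ) - z)⁻¹ := by
  refine Continuous.inv₀ (by fun_prop) fun l h => hz ?_
  have := congrArg Complex.im h
  simpa using this

theorem memLp_ofReal_sub_inv {z : ℂ} (hz : 0 < z.im) :
    MemLp (fun l : ℝ => ((l : ℂ) - z)⁻¹) 2 := by
  rw [memLp_two_iff_integrable_sq_norm (continuous_ofReal_sub_inv hz.ne').aestronglyMeasurable]
  simp_rw [norm_ofReal_sub_inv_sq hz]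
  exact (integrable_poissonKernelLine hz _).const_mul _

variable {E : Type*} [NormedAddCommGroup E] [InnerProductSpace ℂ E] [CompleteSpace E]

/-- Up to the factor 2πi, the Cauchy kernel is the Fourier transform of exp(2πizt) on t > 0. Moving
the transform onto F leaves a pairing with F̂ cut off to t > 0. After the cutoff the exponential may
be replaced by its even-decay extension, whose Fourier transform is the Poisson kernel. So G is 2πi
times the Riesz projection of F. -/
theorem exists_poisson_representation (F : Lp E 2 (volume : Measure ℝ)) :
    ∃ G : Lp E 2 (volume : Measure ℝ), ‖G‖ ≤ 2 * Real.pi * ‖F‖ ∧ ∀ τ ε : ℝ, 0 < ε →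
      ∫ l : ℝ, ((l : ℂ) - (τ + ε * Complex.I))⁻¹ • F l =
        ∫ s : ℝ, poissonKernelLine ε (s - τ) • G s := by
  have hmem : MemLp ((Ioi (0 : ℝ)).indicator (𝓕 F : Lp E 2 (volume : Measure ℝ))) 2 :=
    (Lp.memLp _).indicator measurableSet_Ioi
  set H : Lp E 2 (volume : Measure ℝ) := hmem.toLp _ with hH
  have hHn : ‖H‖ ≤ ‖F‖ := by
    rw [← Lp.norm_fourier_eq F, hH, Lp.norm_toLp, Lp.norm_def]
    exact ENNReal.toReal_mono (Lp.eLpNorm_ne_top _) (eLpNorm_indicator_le _)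
  set cc : ℂ := 2 * Real.pi * Complex.I with hcc
  have hcc0 : cc ≠ 0 := by
    rw [hcc]; simp [Real.pi_ne_zero]
  refine ⟨cc • (𝓕⁻ H : Lp E 2 (volume : Measure ℝ)), ?_, fun τ ε hε => ?_⟩
  · rw [norm_smul, ← Lp.norm_fourier_eq (𝓕⁻ H : Lp E 2 (volume : Measure ℝ)),
      FourierTransform.fourier_fourierInv_eq]
    have : ‖cc‖ = 2 * Real.pi := by
      simp [hcc, abs_of_pos Real.pi_pos]
    rw [this]
    gcongr
  set z : ℂ := τ + ε * Complex.I with hz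
  have hzim : z.im = ε := by simp [hz]
  have hzre : z.re = τ := by simp [hz]
  have hz0 : 0 < z.im := by rw [hzim]; exact hε
  -- On t > 0 this equals exp(2πizt); the values on t < 0 are free because `H` vanishes there.
  set p : ℝ → ℂ := fun t => Complex.exp (Complex.I * (2 * Real.pi * τ : ℝ) * t -
    (2 * Real.pi * ε : ℝ) * |t|) with hp
  have hre : 0 < ((2 * Real.pi * ε : ℝ) : ℂ).re := by
    rw [Complex.ofReal_re]; positivity
  have hpi : Integrable p := integrable_exp_neg_mul_abs hre _
  have hpn : ∀ t, ‖p t‖ ≤ 1 := by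
    intro t
    rw [hp, Complex.norm_exp, Real.exp_le_one_iff]
    simp
    positivity
  have hp2 : MemLp p 2 := hpi.memLp_two_of_bound hpn
  have hFp : 𝓕 p = fun s : ℝ => ((poissonKernelLine ε (s - τ) : ℝ) : ℂ) := by
    ext s
    rw [Real.fourier_real_eq_integral_exp_smul]
    have e : ∀ t : ℝ, Complex.exp (((-2 * Real.pi * t * s : ℝ) : ℂ) * Complex.I) • p t =
        Complex.exp (Complex.I * (2 * Real.pi * (τ - s) : ℝ) * t -
          ((2 * Real.pi * ε : ℝ) : ℂ) * |t|) := by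
      intro t
      rw [hp, smul_eq_mul, ← Complex.exp_add]
      congr 1
      push_cast
      ring
    simp_rw [e]
    rw [integral_exp_neg_mul_abs hre]
    rw [poissonKernelLine]
    norm_cast
    have h1 : 0 < (s - τ) ^ 2 + ε ^ 2 := by positivity
    have h2 : (2 * Real.pi * ε) ^ 2 + (2 * Real.pi * (τ - s)) ^ 2 =
      4 * Real.pi ^ 2 * ((s - τ) ^ 2 + ε ^ 2) := by ring
    have := Real.pi_pos
    rw [h2]
    field_simp
    ring
  have hFp2 : MemLp (𝓕 p) 2 := by
    rw [hFp]
    refine (integrable_poissonKernelLine hε τ).ofReal.memLp_two_of_bound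
      (C := Real.pi⁻¹ * ε⁻¹) fun s => ?_
    rw [Complex.norm_real, Real.norm_of_nonneg (poissonKernelLine_nonneg hε.le _)]
    exact poissonKernelLine_le hε _
  set h : ℝ → ℂ := (Ioi (0 : ℝ)).indicator p with hh
  have hhi : Integrable h := hpi.indicator measurableSet_Ioi
  have hh2 : MemLp h 2 := hp2.indicator measurableSet_Ioi
  have hFh : 𝓕 h = fun l : ℝ => cc⁻¹ * ((l : ℂ) - z)⁻¹ := by
    ext l
    rw [Real.fourier_real_eq_integral_exp_smul, ← integral_exp_Ioi_fourier hz0,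
      ← integral_indicator measurableSet_Ioi]
    refine integral_congr_ae (Eventually.of_forall fun t => ?_)
    simp only [hh, indicator_apply]
    split_ifs with ht
    · rw [hp, smul_eq_mul]
      simp only [abs_of_pos (show 0 < t from ht)]
      rw [← Complex.exp_add]
      congr 1
      rw [hz]
      push_cast
      linear_combination (-(2 * Real.pi * ε * t : ℂ)) * Complex.I_sq
    · simp
  have hFh2 : MemLp (𝓕 h) 2 := by
    rw [hFh]
    exact (memLp_ofReal_sub_inv hz0).const_mul _
  have l1 : ∫ l : ℝ, ((l : ℂ) - z)⁻¹ • F l = cc • ∫ l, 𝓕 h l • F l := by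
    rw [← integral_smul]
    refine integral_congr_ae (Eventually.of_forall fun l => ?_)
    simp only [hFh, smul_smul]
    rw [mul_inv_cancel_left₀ hcc0]
  have l2 : ∫ t, h t • (𝓕 F : Lp E 2 (volume : Measure ℝ)) t = ∫ t, p t • H t := by
    refine integral_congr_ae ?_
    filter_upwards [hmem.coeFn_toLp] with t ht
    rw [hH, ht, hh, indicator_apply, indicator_apply]
    split_ifs <;> simp
  have l3 : ∫ s : ℝ, poissonKernelLine ε (s - τ) •
      (cc • (𝓕⁻ H : Lp E 2 (volume : Measure ℝ)) : Lp E 2 (volume : Measure ℝ)) s =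
      cc • ∫ s, 𝓕 p s • (𝓕⁻ H : Lp E 2 (volume : Measure ℝ)) s := by
    rw [← integral_smul]
    refine integral_congr_ae ?_
    filter_upwards [Lp.coeFn_smul cc (𝓕⁻ H : Lp E 2 (volume : Measure ℝ))] with s hs
    rw [hs, hFp, Pi.smul_apply, smul_comm]
    rw [← Complex.coe_smul]
  rw [l1, l3, integral_fourier_smul_eq_of_memLp hhi hh2 hFh2, l2,
    integral_fourier_smul_eq_of_memLp hpi hp2 hFp2, FourierTransform.fourier_fourierInv_eq]

end Cauchy

/-! ### Cauchy-Schwarz inequalities for lower integrals. -/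

section CauchySchwarz

variable {α : Type*} [MeasurableSpace α] {μ : Measure α}

theorem ENNReal.sq_lintegral_mul_le {f g : α → ℝ≥0∞} (hf : AEMeasurable f μ)
    (hg : AEMeasurable g μ) :
    (∫⁻ x, f x * g x ∂μ) ^ 2 ≤ (∫⁻ x, f x ^ 2 ∂μ) * ∫⁻ x, g x ^ 2 ∂μ := by
  have h := ENNReal.lintegral_mul_le_Lp_mul_Lq μ Real.HolderConjugate.two_two hf hg
  simp only [Pi.mul_apply, ENNReal.rpow_two] at h
  calc _ ≤ ((∫⁻ x, f x ^ 2 ∂μ) ^ ((1 : ℝ) / 2) * (∫⁻ x, g x ^ 2 ∂μ) ^ ((1 : ℝ) / 2)) ^ 2 := by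
        gcongr
    _ = _ := by
        rw [mul_pow, ← ENNReal.rpow_two, ← ENNReal.rpow_two, ← ENNReal.rpow_mul,
          ← ENNReal.rpow_mul]
        norm_num

theorem ENNReal.sq_lintegral_le {f : α → ℝ≥0∞} (hf : AEMeasurable f μ) :
    (∫⁻ x, f x ∂μ) ^ 2 ≤ μ univ * ∫⁻ x, f x ^ 2 ∂μ := by
  simpa using ENNReal.sq_lintegral_mul_le (f := fun _ => 1) aemeasurable_const hf

/-- This is Cauchy-Schwarz against the constant 1 for the measure with density w. -/
theorem ENNReal.sq_lintegral_mul_le_weight {w f : α → ℝ≥0∞} (hw : AEMeasurable w μ)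
    (hf : AEMeasurable f μ) :
    (∫⁻ x, w x * f x ∂μ) ^ 2 ≤ (∫⁻ x, w x ∂μ) * ∫⁻ x, w x * f x ^ 2 ∂μ := by
  have h := ENNReal.sq_lintegral_le (μ := μ.withDensity w)
    (hf.mono_ac (withDensity_absolutelyContinuous _ _))
  rw [lintegral_withDensity_eq_lintegral_mul₀ hw hf,
    lintegral_withDensity_eq_lintegral_mul₀ hw (hf.pow_const 2)] at h
  simpa using h

end CauchySchwarz

/-! ### Uniform bounds and boundary values of Cauchy transforms. -/

section Cauchy

variable {E : Type*} [NormedAddCommGroup E] [InnerProductSpace ℂ E]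

theorem lintegral_enorm_sq_eq {α : Type*} [MeasurableSpace α] {μ : Measure α} {F : Type*}
    [NormedAddCommGroup F] (G : Lp F 2 μ) : ∫⁻ x, ‖G x‖ₑ ^ 2 ∂μ = ENNReal.ofReal (‖G‖ ^ 2) := by
  rw [ENNReal.ofReal_pow (norm_nonneg _), ofReal_norm, Lp.enorm_def,
    eLpNorm_eq_lintegral_rpow_enorm_toReal (by norm_num) (by norm_num)]
  simp only [ENNReal.toReal_ofNat, ENNReal.rpow_ofNat]
  rw [← ENNReal.rpow_two, ← ENNReal.rpow_mul]
  norm_num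

/-- The kernel has mass 1 in s, so the square passes inside the integral; Tonelli and the symmetry
of the kernel then give mass 1 in τ as well. -/
theorem lintegral_poisson_sq_le (G : Lp E 2 (volume : Measure ℝ)) {ε : ℝ} (hε : 0 < ε) :
    ∫⁻ τ : ℝ, ‖∫ s : ℝ, poissonKernelLine ε (s - τ) • G s‖ₑ ^ 2 ≤ ENNReal.ofReal (‖G‖ ^ 2) := by
  have hPm : Measurable (poissonKernelLine ε) := (continuous_poissonKernelLine hε).measurable
  have hGm : AEMeasurable (fun s => ‖G s‖ₑ ^ 2) := (Lp.aestronglyMeasurable G).enorm.pow_const 2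
  have h1 : ∀ τ : ℝ, ∫⁻ s, ENNReal.ofReal (poissonKernelLine ε (s - τ)) = 1 := by
    intro τ
    rw [← ofReal_integral_eq_lintegral_ofReal (integrable_poissonKernelLine hε τ)
      (Eventually.of_forall fun s => poissonKernelLine_nonneg hε.le _),
      integral_poissonKernelLine hε, ENNReal.ofReal_one]
  calc _ ≤ ∫⁻ τ : ℝ, ∫⁻ s, ENNReal.ofReal (poissonKernelLine ε (s - τ)) * ‖G s‖ₑ ^ 2 := by
        refine lintegral_mono fun τ => ?_
        have hw : AEMeasurable fun s => ENNReal.ofReal (poissonKernelLine ε (s - τ)) := by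
          fun_prop
        have := ENNReal.sq_lintegral_mul_le_weight hw (Lp.aestronglyMeasurable G).enorm
        rw [h1, one_mul] at this
        refine le_trans ?_ this
        gcongr
        refine (enorm_integral_le_lintegral_enorm _).trans (lintegral_mono fun s => ?_)
        rw [enorm_smul, Real.enorm_of_nonneg (poissonKernelLine_nonneg hε.le _)]
    _ = ∫⁻ s, ∫⁻ τ : ℝ, ENNReal.ofReal (poissonKernelLine ε (s - τ)) * ‖G s‖ₑ ^ 2 := by
        rw [lintegral_lintegral_swap]
        exact AEMeasurable.mul (by fun_prop) (hGm.comp_quasiMeasurePreserving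
          Measure.quasiMeasurePreserving_snd)
    _ = ∫⁻ s, ‖G s‖ₑ ^ 2 := by
        refine lintegral_congr fun s => ?_
        rw [lintegral_mul_const _ (by fun_prop)]
        have : ∀ τ, poissonKernelLine ε (s - τ) = poissonKernelLine ε (τ - s) := by
          intro τ
          rw [poissonKernelLine, poissonKernelLine, ← neg_sub, neg_sq]
        simp_rw [this]
        rw [h1, one_mul]
    _ = _ := lintegral_enorm_sq_eq G

variable [CompleteSpace E]

theorem ae_tendsto_poisson (G : Lp E 2 (volume : Measure ℝ)) :
    ∀ᵐ τ : ℝ, Tendsto (fun ε : ℝ => ∫ s : ℝ, poissonKernelLine ε (s - τ) • G s)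
      (𝓝[>] 0) (𝓝 (G τ)) := by
  have hG2 : Integrable (fun s => ‖G s‖ ^ 2) :=
    (memLp_two_iff_integrable_sq_norm (Lp.aestronglyMeasurable G)).1 (Lp.memLp G)
  have hGl : LocallyIntegrable G := (Lp.memLp G).locallyIntegrable (by norm_num)
  filter_upwards [IsUnifLocDoublingMeasure.ae_tendsto_average_norm_sub (μ := volume) hGl 1]
    with τ hτ
  have hL : Tendsto (fun r => ⨍ s in Metric.closedBall τ r, ‖G s - G τ‖) (𝓝[>] 0) (𝓝 0) := by
    refine hτ (l := 𝓝[>] 0) (fun _ => τ) (fun r => r) tendsto_id ?_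
    filter_upwards [self_mem_nhdsWithin] with r hr
    exact Metric.mem_closedBall_self (by rw [one_mul]; exact le_of_lt hr)
  have hN : LocallyIntegrable (fun s => ‖G s - G τ‖) :=
    fun x => ((hGl.sub (locallyIntegrable_const (G τ))) x).imp fun _ h => ⟨h.1, h.2.norm⟩
  -- Linear growth follows from ‖G s - G τ‖ ≤ 1 + ‖G τ‖ + ‖G s‖²: the constant contributes its value
  -- times 2r, and the square is globally integrable.
  have hB : ∀ r, 1 ≤ r → ∫ s in Metric.closedBall τ r, ‖G s - G τ‖ ≤
      (2 * (1 + ‖G τ‖) + ∫ s, ‖G s‖ ^ 2) * r := by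
    intro r hr
    have hI : 0 ≤ ∫ s, ‖G s‖ ^ 2 := integral_nonneg fun s => by positivity
    have hv : (volume : Measure ℝ).real (Metric.closedBall τ r) = 2 * r := by
      rw [measureReal_def, Real.volume_closedBall, ENNReal.toReal_ofReal (by positivity)]
    have hc : IntegrableOn (fun _ : ℝ => 1 + ‖G τ‖) (Metric.closedBall τ r) :=
      (locallyIntegrable_const _).integrableOn_isCompact (isCompact_closedBall _ _)
    calc _ ≤ ∫ s in Metric.closedBall τ r, ((1 + ‖G τ‖) + ‖G s‖ ^ 2) := by
          refine integral_mono (hN.integrableOn_isCompact (isCompact_closedBall _ _))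
            (hc.add hG2.integrableOn) fun s => ?_
          have := norm_sub_le (G s) (G τ)
          simp only
          nlinarith [sq_nonneg (‖G s‖ - 1), norm_nonneg (G s)]
      _ = (1 + ‖G τ‖) * (2 * r) + ∫ s in Metric.closedBall τ r, ‖G s‖ ^ 2 := by
          rw [integral_add hc hG2.integrableOn, setIntegral_const, hv, smul_eq_mul]
          ring
      _ ≤ (1 + ‖G τ‖) * (2 * r) + ∫ s, ‖G s‖ ^ 2 := by
          refine add_le_add le_rfl ?_
          exact setIntegral_le_integral hG2 (Eventually.of_forall fun s => by positivity)
      _ ≤ _ := by nlinarith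
  have key := tendsto_poisson_of_lebesgue_point (fun s => norm_nonneg _) hN hB hL
  rw [tendsto_iff_edist_tendsto_0]
  refine tendsto_of_tendsto_of_tendsto_of_le_of_le' tendsto_const_nhds key
    (Eventually.of_forall fun _ => zero_le) ?_
  filter_upwards [self_mem_nhdsWithin] with ε hε
  have hε : (0 : ℝ) < ε := hε
  have hPc : Continuous fun s => poissonKernelLine ε (s - τ) :=
    (continuous_poissonKernelLine hε).comp (by fun_prop)
  have hP2 : MemLp (fun s => poissonKernelLine ε (s - τ)) 2 :=
    (integrable_poissonKernelLine hε τ).memLp_two_of_bound (C := Real.pi⁻¹ * ε⁻¹) fun s => by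
      rw [Real.norm_of_nonneg (poissonKernelLine_nonneg hε.le _)]
      exact poissonKernelLine_le hε _
  have i1 : Integrable fun s => poissonKernelLine ε (s - τ) • G s := by
    rw [← memLp_one_iff_integrable]
    have := MemLp.smul (𝕜 := ℝ) (r := 1) (Lp.memLp G) hP2
    exact this
  have i2 : Integrable fun s => poissonKernelLine ε (s - τ) • G τ :=
    (integrable_poissonKernelLine hε τ).smul_const _
  have e : G τ = ∫ s, poissonKernelLine ε (s - τ) • G τ := by
    rw [integral_smul_const, integral_poissonKernelLine hε, one_smul]
  rw [edist_eq_enorm_sub, show (∫ s : ℝ, poissonKernelLine ε (s - τ) • G s) - G τ =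
    ∫ s : ℝ, (poissonKernelLine ε (s - τ) • G s - poissonKernelLine ε (s - τ) • G τ) by
      rw [integral_sub i1 i2, ← e] ]
  refine (enorm_integral_le_lintegral_enorm _).trans (lintegral_mono fun s => ?_)
  rw [← smul_sub, enorm_smul, Real.enorm_of_nonneg (poissonKernelLine_nonneg hε.le _),
    ofReal_norm]

theorem cauchyTransform_upper (F : Lp E 2 (volume : Measure ℝ)) :
    (∀ ε : ℝ, 0 < ε → ∫⁻ τ : ℝ, ‖∫ l : ℝ, ((l : ℂ) - (τ + ε * Complex.I))⁻¹ • F l‖ₑ ^ 2 ≤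
      ENNReal.ofReal ((2 * Real.pi * ‖F‖) ^ 2)) ∧
    ∀ᵐ τ : ℝ, ∃ g : E, Tendsto
      (fun ε : ℝ => ∫ l : ℝ, ((l : ℂ) - (τ + ε * Complex.I))⁻¹ • F l) (𝓝[>] 0) (𝓝 g) := by
  obtain ⟨G, hG, hrep⟩ := exists_poisson_representation F
  constructor
  · intro ε hε
    simp_rw [fun τ => hrep τ ε hε]
    refine (lintegral_poisson_sq_le G hε).trans (ENNReal.ofReal_le_ofReal ?_)
    gcongr
  · filter_upwards [ae_tendsto_poisson G] with τ hτ
    refine ⟨G τ, hτ.congr' ?_⟩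
    filter_upwards [self_mem_nhdsWithin] with ε hε
    exact (hrep τ ε hε).symm

/-- The Cauchy transform of a square integrable function with values in a Hilbert space: uniform
bound along horizontal lines, and boundary values almost everywhere. -/
theorem cauchyTransform {F : ℝ → E} (hF : MemLp F 2) {C : ℝ≥0∞} (hC : ∫⁻ l, ‖F l‖ₑ ^ 2 ≤ C)
    {s : ℝ} (hs : s = 1 ∨ s = -1) :
    (∀ ε : ℝ, 0 < ε →
      ∫⁻ τ : ℝ, ‖∫ l : ℝ, ((l : ℂ) - (τ + (s * ε : ℝ) * Complex.I))⁻¹ • F l‖ₑ ^ 2 ≤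
      ENNReal.ofReal ((2 * Real.pi) ^ 2) * C) ∧
    ∀ᵐ τ : ℝ, ∃ g : E, Tendsto
      (fun ε : ℝ => ∫ l : ℝ, ((l : ℂ) - (τ + (s * ε : ℝ) * Complex.I))⁻¹ • F l)
        (𝓝[>] 0) (𝓝 g) := by
  have up : ∀ {F : ℝ → E} (hF : MemLp F 2), ∫⁻ l, ‖F l‖ₑ ^ 2 ≤ C →
      (∀ ε : ℝ, 0 < ε → ∫⁻ τ : ℝ, ‖∫ l : ℝ, ((l : ℂ) - (τ + ε * Complex.I))⁻¹ • F l‖ₑ ^ 2 ≤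
        ENNReal.ofReal ((2 * Real.pi) ^ 2) * C) ∧
      ∀ᵐ τ : ℝ, ∃ g : E, Tendsto
        (fun ε : ℝ => ∫ l : ℝ, ((l : ℂ) - (τ + ε * Complex.I))⁻¹ • F l) (𝓝[>] 0) (𝓝 g) := by
    intro F hF hC
    have h := cauchyTransform_upper (hF.toLp F)
    have hn : ENNReal.ofReal (‖hF.toLp F‖ ^ 2) ≤ C := by
      rw [← lintegral_enorm_sq_eq]
      refine le_trans (le_of_eq ?_) hC
      refine lintegral_congr_ae ?_
      filter_upwards [hF.coeFn_toLp] with l hl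
      rw [hl]
    have e : ∀ z : ℂ, ∫ l : ℝ, ((l : ℂ) - z)⁻¹ • hF.toLp F l = ∫ l : ℝ, ((l : ℂ) - z)⁻¹ • F l := by
      intro z
      refine integral_congr_ae ?_
      filter_upwards [hF.coeFn_toLp] with l hl
      rw [hl]
    simp_rw [e] at h
    refine ⟨fun ε hε => (h.1 ε hε).trans ?_, h.2⟩
    rw [mul_pow, ENNReal.ofReal_mul (by positivity)]
    gcongr
  rcases hs with rfl | rfl
  · simpa only [one_mul] using up hF hC
  -- The lower half-plane reduces to the upper one by the reflection l ↦ -l, τ ↦ -τ, at the cost of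
  -- a sign.
  · have hF' : MemLp (fun l => F (-l)) 2 :=
      hF.comp_measurePreserving (Measure.measurePreserving_neg volume)
    have hC' : ∫⁻ l, ‖F (-l)‖ₑ ^ 2 ≤ C := by
      rwa [lintegral_neg_eq_self (μ := volume) (fun l => ‖F l‖ₑ ^ 2)]
    have e : ∀ τ ε : ℝ, ∫ l : ℝ, ((l : ℂ) - (τ + ((-1 : ℝ) * ε : ℝ) * Complex.I))⁻¹ • F l =
        -∫ l : ℝ, ((l : ℂ) - ((-τ : ℝ) + ε * Complex.I))⁻¹ • F (-l) := by
      intro τ ε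
      rw [← integral_neg_eq_self, ← integral_neg]
      refine integral_congr_ae (Eventually.of_forall fun l => ?_)
      simp only
      rw [← neg_smul, ← inv_neg]
      congr 2
      push_cast
      ring
    obtain ⟨h1, h2⟩ := up hF' hC'
    constructor
    · intro ε hε
      simp_rw [e, enorm_neg]
      rw [lintegral_neg_eq_self (μ := volume)
        (fun τ : ℝ => ‖∫ l : ℝ, ((l : ℂ) - (τ + ε * Complex.I))⁻¹ • F (-l)‖ₑ ^ 2)]
      exact h1 ε hε
    · have h3 := (Measure.measurePreserving_neg (volume : Measure ℝ)).quasiMeasurePreserving.ae h2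
      filter_upwards [h3] with τ hτ
      obtain ⟨g, hg⟩ := hτ
      refine ⟨-g, ?_⟩
      simp_rw [e]
      exact hg.neg

end Cauchy

/-! ### Hilbert-Schmidt operators are compact. -/

section HilbertSchmidt

/-- Truncating the basis expansion gives finite rank operators. By Cauchy-Schwarz and Bessel the
error in operator norm is at most the square root of the tail of Σ ‖T eᵢ‖². -/
theorem isCompactOperator_of_sum_norm_sq_le {ι H : Type*} [NormedAddCommGroup H]
    [InnerProductSpace ℂ H] [CompleteSpace H] (e : HilbertBasis ι ℂ H) (T : H →L[ℂ] H) {C : ℝ}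
    (hC : ∀ F : Finset ι, ∑ i ∈ F, ‖T (e i)‖ ^ 2 ≤ C) : IsCompactOperator T := by
  have hs : Summable fun i => ‖T (e i)‖ ^ 2 :=
    summable_of_sum_le (fun i => by positivity) hC
  classical
  set TF : Finset ι → H →L[ℂ] H := fun F =>
    ∑ i ∈ F, (ContinuousLinearMap.toSpanSingleton ℂ (T (e i))).comp (innerSL ℂ (e i)) with hTF
  have hTFa : ∀ F v, TF F v = ∑ i ∈ F, inner ℂ (e i) v • T (e i) := by
    intro F v
    simp [hTF]
  have hlim : Tendsto TF atTop (𝓝 T) := by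
    rw [Metric.tendsto_atTop]
    intro ε hε
    obtain ⟨F₀, hF₀⟩ := summable_iff_vanishing_norm.1 hs ((ε / 2) ^ 2) (by positivity)
    refine ⟨F₀, fun F hF => ?_⟩
    rw [dist_eq_norm, ← norm_neg, neg_sub]
    refine lt_of_le_of_lt (ContinuousLinearMap.opNorm_le_bound _ (half_pos hε).le fun v => ?_)
      (half_lt_self hε)
    have hsum : HasSum (fun i => inner ℂ (e i) v • T (e i)) (T v) := by
      have := (e.hasSum_repr v).mapL T
      simpa [HilbertBasis.repr_apply_apply] using this
    have ht : Tendsto (fun F' : Finset ι => ‖∑ i ∈ F', inner ℂ (e i) v • T (e i) - TF F v‖) atTop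
        (𝓝 ‖T v - TF F v‖) := (hsum.sub_const _).norm
    refine le_of_tendsto ht ?_
    filter_upwards [eventually_ge_atTop F] with F' hF'
    rw [hTFa, ← Finset.sum_sdiff_eq_sub hF']
    have hd : Disjoint (F' \ F) F₀ := Finset.disjoint_of_subset_right hF Finset.sdiff_disjoint
    have h1 := hF₀ _ hd
    rw [Real.norm_of_nonneg (Finset.sum_nonneg fun i _ => by positivity)] at h1
    have h2 : ∑ i ∈ F' \ F, ‖inner ℂ (e i) v‖ ^ 2 ≤ ‖v‖ ^ 2 :=
      e.orthonormal.sum_inner_products_le v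
    calc _ ≤ ∑ i ∈ F' \ F, ‖inner ℂ (e i) v‖ * ‖T (e i)‖ :=
          (norm_sum_le _ _).trans_eq (Finset.sum_congr rfl fun i _ => norm_smul _ _)
      _ ≤ √(∑ i ∈ F' \ F, ‖inner ℂ (e i) v‖ ^ 2) * √(∑ i ∈ F' \ F, ‖T (e i)‖ ^ 2) :=
          Real.sum_mul_le_sqrt_mul_sqrt _ _ _
      _ ≤ √(‖v‖ ^ 2) * √((ε / 2) ^ 2) := by gcongr
      _ = _ := by
          rw [Real.sqrt_sq (norm_nonneg _), Real.sqrt_sq (by positivity), mul_comm]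
  refine isCompactOperator_of_tendsto hlim (Eventually.of_forall fun F => ?_)
  have hc : ∀ i, IsCompactOperator
      ((ContinuousLinearMap.toSpanSingleton ℂ (T (e i))).comp (innerSL ℂ (e i))) := fun i =>
    ((isCompactOperator_id (E := ℂ)).clm_comp
      (ContinuousLinearMap.toSpanSingleton ℂ (T (e i)))).comp_clm (innerSL ℂ (e i))
  have : TF F ∈ compactOperator (RingHom.id ℂ) H H :=
    Submodule.sum_mem _ fun i _ => hc i
  exact this

end HilbertSchmidt

/-! ### Integral operators on L². -/

section IntegralOperators

variable {α : Type*} [MeasurableSpace α] {μ : Measure α}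

/-- `T` is the integral operator with kernel `K`. -/
def IsIntegralOperator (μ : Measure α) (K : α → α → ℂ) (T : Lp ℂ 2 μ →L[ℂ] Lp ℂ 2 μ) : Prop :=
  ∀ f : Lp ℂ 2 μ, T f =ᵐ[μ] fun x => ∫ y, K x y * f y ∂μ

variable [SFinite μ]

/-- The bound concerns |K| acting on |f|, so the integrals converge absolutely for almost every x,
which is what linearity needs. -/
theorem exists_isIntegralOperator {K : α → α → ℂ}
    (hK : AEStronglyMeasurable (Function.uncurry K) (μ.prod μ)) (C : ℝ≥0)
    (hC : ∀ f : Lp ℂ 2 μ, ∫⁻ x, (∫⁻ y, ‖K x y‖ₑ * ‖f y‖ₑ ∂μ) ^ 2 ∂μ ≤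
      ENNReal.ofReal ((C * ‖f‖) ^ 2)) :
    ∃ T : Lp ℂ 2 μ →L[ℂ] Lp ℂ 2 μ, IsIntegralOperator μ K T ∧ ‖T‖ ≤ C := by
  have hKf : ∀ f : Lp ℂ 2 μ,
      AEStronglyMeasurable (fun p : α × α => K p.1 p.2 * f p.2) (μ.prod μ) :=
    fun f => hK.mul (Lp.aestronglyMeasurable f).comp_snd
  have hm : ∀ f : Lp ℂ 2 μ, AEStronglyMeasurable (fun x => ∫ y, K x y * f y ∂μ) μ :=
    fun f => (hKf f).integral_prod_right'
  have hi : ∀ f : Lp ℂ 2 μ, ∀ᵐ x ∂μ, Integrable (fun y => K x y * f y) μ := by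
    intro f
    have h1 : AEMeasurable (fun x => (∫⁻ y, ‖K x y‖ₑ * ‖f y‖ₑ ∂μ) ^ 2) μ := by
      have := (hKf f).enorm.lintegral_prod_right'
      simp only [enorm_mul] at this
      exact this.pow_const 2
    have h2 := ae_lt_top' h1 ((hC f).trans_lt ENNReal.ofReal_lt_top).ne
    filter_upwards [h2, (hKf f).prodMk_left] with x hx hx'
    refine ⟨hx', ?_⟩
    rw [HasFiniteIntegral]
    simp only [enorm_mul]
    exact (ENNReal.pow_lt_top_iff.1 hx).resolve_right two_ne_zero
  have hn : ∀ f : Lp ℂ 2 μ, eLpNorm (fun x => ∫ y, K x y * f y ∂μ) 2 μ ≤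
      ENNReal.ofReal (C * ‖f‖) := by
    intro f
    have h1 : ∫⁻ x, ‖∫ y, K x y * f y ∂μ‖ₑ ^ 2 ∂μ ≤ ENNReal.ofReal ((C * ‖f‖) ^ 2) := by
      refine le_trans (lintegral_mono fun x => ?_) (hC f)
      gcongr
      refine (enorm_integral_le_lintegral_enorm _).trans_eq ?_
      simp only [enorm_mul]
    rw [eLpNorm_eq_lintegral_rpow_enorm_toReal (by norm_num) (by norm_num)]
    simp only [ENNReal.toReal_ofNat, ENNReal.rpow_ofNat]
    refine (ENNReal.rpow_le_rpow h1 (by norm_num)).trans_eq ?_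
    rw [ENNReal.ofReal_pow (by positivity), ← ENNReal.rpow_two, ← ENNReal.rpow_mul]
    norm_num
  have hmem : ∀ f : Lp ℂ 2 μ, MemLp (fun x => ∫ y, K x y * f y ∂μ) 2 μ := fun f =>
    ⟨hm f, (hn f).trans_lt ENNReal.ofReal_lt_top⟩
  let L : Lp ℂ 2 μ →ₗ[ℂ] Lp ℂ 2 μ :=
    { toFun := fun f => (hmem f).toLp _
      map_add' := by
        intro f g
        rw [← MemLp.toLp_add]
        refine MemLp.toLp_congr _ _ ?_
        filter_upwards [hi f, hi g] with x h1 h2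
        rw [Pi.add_apply, ← integral_add h1 h2]
        refine integral_congr_ae ?_
        filter_upwards [Lp.coeFn_add f g] with y hy
        rw [hy, Pi.add_apply, mul_add]
      map_smul' := by
        intro c f
        rw [RingHom.id_apply, ← MemLp.toLp_const_smul]
        refine MemLp.toLp_congr _ _ (Eventually.of_forall fun x => ?_)
        rw [Pi.smul_apply, ← integral_smul]
        refine integral_congr_ae ?_
        filter_upwards [Lp.coeFn_smul c f] with y hy
        rw [hy, Pi.smul_apply, smul_eq_mul, smul_eq_mul]
        ring }
  have hL : ∀ f, ‖L f‖ ≤ C * ‖f‖ := fun f => by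
    change ‖(hmem f).toLp _‖ ≤ _
    rw [Lp.norm_toLp]
    exact ENNReal.toReal_le_of_le_ofReal (by positivity) (hn f)
  refine ⟨L.mkContinuous C hL, fun f => (hmem f).coeFn_toLp, L.mkContinuous_norm_le C.2 hL⟩

theorem lintegral_sq_kernel_le {K : α → α → ℂ}
    (hK : AEStronglyMeasurable (Function.uncurry K) (μ.prod μ)) (f : Lp ℂ 2 μ) :
    ∫⁻ x, (∫⁻ y, ‖K x y‖ₑ * ‖f y‖ₑ ∂μ) ^ 2 ∂μ ≤
      (∫⁻ x, ∫⁻ y, ‖K x y‖ₑ ^ 2 ∂μ ∂μ) * ENNReal.ofReal (‖f‖ ^ 2) := by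
  have hm : AEMeasurable (fun x => ∫⁻ y, ‖K x y‖ₑ ^ 2 ∂μ) μ :=
    (hK.enorm.pow_const 2).lintegral_prod_right'
  rw [← lintegral_mul_const'' _ hm]
  refine lintegral_mono_ae ?_
  filter_upwards [hK.prodMk_left] with x hx
  refine (ENNReal.sq_lintegral_mul_le hx.enorm (Lp.aestronglyMeasurable f).enorm).trans_eq ?_
  rw [lintegral_enorm_sq_eq]
  rfl

theorem exists_isIntegralOperator_of_sq {K : α → α → ℂ}
    (hK : AEStronglyMeasurable (Function.uncurry K) (μ.prod μ)) {C : ℝ≥0}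
    (hC : ∫⁻ x, ∫⁻ y, ‖K x y‖ₑ ^ 2 ∂μ ∂μ ≤ C ^ 2) :
    ∃ T : Lp ℂ 2 μ →L[ℂ] Lp ℂ 2 μ, IsIntegralOperator μ K T ∧ ‖T‖ ≤ C := by
  refine exists_isIntegralOperator hK C fun f => (lintegral_sq_kernel_le hK f).trans ?_
  rw [mul_pow, ENNReal.ofReal_mul (by positivity)]
  gcongr
  refine hC.trans_eq ?_
  rw [ENNReal.ofReal_pow C.coe_nonneg, ENNReal.ofReal_coe_nnreal]

theorem integrable_kernel_mul {K : α → α → ℂ}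
    (hK : AEStronglyMeasurable (Function.uncurry K) (μ.prod μ))
    (hC : ∫⁻ x, ∫⁻ y, ‖K x y‖ₑ ^ 2 ∂μ ∂μ ≠ ∞) (f : Lp ℂ 2 μ) :
    ∀ᵐ x ∂μ, Integrable (fun y => K x y * f y) μ := by
  have hm : AEMeasurable (fun x => ∫⁻ y, ‖K x y‖ₑ ^ 2 ∂μ) μ :=
    (hK.enorm.pow_const 2).lintegral_prod_right'
  filter_upwards [ae_lt_top' hm hC, hK.prodMk_left] with x hx hx'
  have h1 : MemLp (fun y => K x y) 2 μ := by
    refine ⟨hx', ?_⟩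
    rw [eLpNorm_lt_top_iff_lintegral_rpow_enorm_lt_top (by norm_num) (by norm_num)]
    simpa using hx
  rw [← memLp_one_iff_integrable]
  exact MemLp.smul (𝕜 := ℂ) (r := 1) (Lp.memLp f) h1

theorem IsIntegralOperator.norm_sub_le {K K' : α → α → ℂ} {T T' : Lp ℂ 2 μ →L[ℂ] Lp ℂ 2 μ}
    (hT : IsIntegralOperator μ K T) (hT' : IsIntegralOperator μ K' T')
    (hK : AEStronglyMeasurable (Function.uncurry K) (μ.prod μ))
    (hK' : AEStronglyMeasurable (Function.uncurry K') (μ.prod μ))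
    (hC : ∫⁻ x, ∫⁻ y, ‖K x y‖ₑ ^ 2 ∂μ ∂μ ≠ ∞) (hC' : ∫⁻ x, ∫⁻ y, ‖K' x y‖ₑ ^ 2 ∂μ ∂μ ≠ ∞)
    {C : ℝ≥0} (h : ∫⁻ x, ∫⁻ y, ‖K x y - K' x y‖ₑ ^ 2 ∂μ ∂μ ≤ C ^ 2) : ‖T - T'‖ ≤ C := by
  obtain ⟨S, hS, hSn⟩ := exists_isIntegralOperator_of_sq (K := fun x y => K x y - K' x y)
    (hK.sub hK') h
  have : T - T' = S := by
    refine ContinuousLinearMap.ext fun f => Lp.ext ?_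
    rw [sub_apply]
    filter_upwards [Lp.coeFn_sub (T f) (T' f), hT f, hT' f, hS f, integrable_kernel_mul hK hC f,
      integrable_kernel_mul hK' hC' f] with x h0 h1 h2 h3 h4 h5
    rw [h0, Pi.sub_apply, h1, h2, h3, ← integral_sub h4 h5]
    simp only [sub_mul]
  rw [this]
  exact hSn

/-- For almost every x the numbers (T eᵢ)(x) are the inner products of eᵢ with the conjugate of K(x,
·). Bessel's inequality at fixed x, integrated in x, bounds Σ ‖T eᵢ‖² by the squared L² norm of the
kernel. -/
theorem IsIntegralOperator.isCompactOperator {K : α → α → ℂ} {T : Lp ℂ 2 μ →L[ℂ] Lp ℂ 2 μ}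
    (hT : IsIntegralOperator μ K T)
    (hK : AEStronglyMeasurable (Function.uncurry K) (μ.prod μ))
    (hC : ∫⁻ x, ∫⁻ y, ‖K x y‖ₑ ^ 2 ∂μ ∂μ ≠ ∞) : IsCompactOperator T := by
  obtain ⟨w, e, -⟩ := exists_hilbertBasis (𝕜 := ℂ) (E := Lp ℂ 2 μ)
  refine isCompactOperator_of_sum_norm_sq_le e T
    (C := (∫⁻ x, ∫⁻ y, ‖K x y‖ₑ ^ 2 ∂μ ∂μ).toReal) fun F => ?_
  have hm : AEMeasurable (fun x => ∫⁻ y, ‖K x y‖ₑ ^ 2 ∂μ) μ :=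
    (hK.enorm.pow_const 2).lintegral_prod_right'
  rw [← ENNReal.ofReal_le_iff_le_toReal hC,
    ENNReal.ofReal_sum_of_nonneg fun i _ => by positivity]
  simp_rw [← lintegral_enorm_sq_eq]
  rw [← lintegral_finsetSum' _ fun i _ => (Lp.aestronglyMeasurable _).enorm.pow_const 2]
  refine lintegral_mono_ae ?_
  have hall : ∀ᵐ x ∂μ, ∀ i ∈ F, T (e i) x = ∫ y, K x y * e i y ∂μ :=
    (ae_ball_iff F.countable_toSet).2 fun i _ => hT (e i)
  filter_upwards [ae_lt_top' hm hC, hK.prodMk_left, hall] with x hx hx' hxe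
  have h1 : MemLp (fun y => (starRingEnd ℂ) (K x y)) 2 μ := by
    have : MemLp (fun y => K x y) 2 μ := by
      refine ⟨hx', ?_⟩
      rw [eLpNorm_lt_top_iff_lintegral_rpow_enorm_lt_top (by norm_num) (by norm_num)]
      simpa using hx
    exact this.star
  have h2 : ∀ i ∈ F, T (e i) x = inner ℂ (h1.toLp _) (e i) := by
    intro i hi
    rw [hxe i hi, L2.inner_def]
    refine integral_congr_ae ?_
    filter_upwards [h1.coeFn_toLp] with y hy
    rw [hy]
    simp [mul_comm]
  have h3 : ∑ i ∈ F, ‖T (e i) x‖ₑ ^ 2 = ENNReal.ofReal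
      (∑ i ∈ F, ‖inner ℂ (e i) (h1.toLp _)‖ ^ 2) := by
    rw [ENNReal.ofReal_sum_of_nonneg fun i _ => by positivity]
    refine Finset.sum_congr rfl fun i hi => ?_
    rw [h2 i hi, ENNReal.ofReal_pow (norm_nonneg _), norm_inner_symm, ofReal_norm]
  have h4 : ∫⁻ y, ‖K x y‖ₑ ^ 2 ∂μ = ENNReal.ofReal (‖h1.toLp _‖ ^ 2) := by
    rw [← lintegral_enorm_sq_eq]
    refine lintegral_congr_ae ?_
    filter_upwards [h1.coeFn_toLp] with y hy
    rw [hy]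
    simp
  rw [h3, h4]
  exact ENNReal.ofReal_le_ofReal (e.orthonormal.sum_inner_products_le _)

/-- The Schur test. -/
theorem exists_isIntegralOperator_of_schur {K : α → α → ℂ}
    (hK : AEStronglyMeasurable (Function.uncurry K) (μ.prod μ)) {C : ℝ≥0}
    (h1 : ∀ᵐ x ∂μ, ∫⁻ y, ‖K x y‖ₑ ∂μ ≤ C) (h2 : ∀ᵐ y ∂μ, ∫⁻ x, ‖K x y‖ₑ ∂μ ≤ C) :
    ∃ T : Lp ℂ 2 μ →L[ℂ] Lp ℂ 2 μ, IsIntegralOperator μ K T ∧ ‖T‖ ≤ C := by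
  refine exists_isIntegralOperator hK C fun f => ?_
  have hf := (Lp.aestronglyMeasurable f).enorm
  have hf2 : AEMeasurable (fun p : α × α => ‖f p.2‖ₑ ^ 2) (μ.prod μ) :=
    (Lp.aestronglyMeasurable f).comp_snd.enorm.pow_const 2
  have hKf : AEMeasurable (fun p : α × α => ‖K p.1 p.2‖ₑ * ‖f p.2‖ₑ ^ 2) (μ.prod μ) :=
    hK.enorm.mul hf2
  -- Cauchy-Schwarz with weight |K(x, ·)| uses the row bound; after Tonelli the column bound is
  -- used.
  calc _ ≤ ∫⁻ x, C * ∫⁻ y, ‖K x y‖ₑ * ‖f y‖ₑ ^ 2 ∂μ ∂μ := by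
        refine lintegral_mono_ae ?_
        filter_upwards [h1, hK.prodMk_left] with x hx hx'
        refine (ENNReal.sq_lintegral_mul_le_weight hx'.enorm hf).trans ?_
        exact mul_le_mul_left hx _
    _ = C * ∫⁻ y, ∫⁻ x, ‖K x y‖ₑ * ‖f y‖ₑ ^ 2 ∂μ ∂μ := by
        rw [lintegral_const_mul' _ _ ENNReal.coe_ne_top, lintegral_lintegral_swap hKf]
    _ ≤ C * ∫⁻ y, C * ‖f y‖ₑ ^ 2 ∂μ := by
        gcongr 1
        refine lintegral_mono_ae ?_
        have := hK.prod_swap.prodMk_left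
        filter_upwards [h2, this] with y hy hy'
        have hy'' : AEStronglyMeasurable (fun x => K x y) μ := hy'
        rw [lintegral_mul_const'' _ hy''.enorm]
        exact mul_le_mul_left hy _
    _ = _ := by
        rw [lintegral_const_mul' _ _ ENNReal.coe_ne_top, lintegral_enorm_sq_eq, mul_pow,
          ENNReal.ofReal_mul (by positivity), ENNReal.ofReal_pow C.coe_nonneg, ENNReal.ofReal_coe_nnreal]
        ring

end IntegralOperators

/-! ### The Green operator solves the inhomogeneous equation. -/

namespace HalfLine

/-- The derivative of `green k · y` (from the right at `y`). -/
noncomputable def greenDeriv (k : ℂ) (x y : ℝ) : ℂ :=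
  if y ≤ x then Complex.I * k * Complex.exp (Complex.I * k * x) * sinK k y
  else Complex.exp (Complex.I * k * y) * Complex.cos (k * x)

theorem hasDerivAt_green {k : ℂ} {x y : ℝ} (h : x ≠ y) :
    HasDerivAt (fun t => green k t y) (greenDeriv k x y) x := by
  rcases lt_or_gt_of_ne h with h | h
  · rw [greenDeriv, if_neg (not_le.2 h)]
    refine ((hasDerivAt_sinK k x).const_mul (Complex.exp (Complex.I * k * y))).congr_of_eventuallyEq
      ?_
    filter_upwards [Iio_mem_nhds h] with t ht
    exact green_of_le k (le_of_lt ht)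
  · rw [greenDeriv, if_pos h.le]
    refine ((hasDerivAt_cexp k x).mul_const (sinK k y)).congr_of_eventuallyEq ?_
    filter_upwards [Ioi_mem_nhds h] with t ht
    exact green_of_ge k (le_of_lt ht)

theorem hasDerivWithinAt_green (k : ℂ) (x y : ℝ) :
    HasDerivWithinAt (fun t => green k t y) (greenDeriv k x y) (Ici x) x := by
  rcases eq_or_ne x y with rfl | h
  · rw [greenDeriv, if_pos le_rfl]
    refine ((hasDerivAt_cexp k x).mul_const (sinK k x)).hasDerivWithinAt.congr ?_ ?_
    · intro t ht
      exact green_of_ge k ht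
    · exact green_of_ge k le_rfl
  · exact (hasDerivAt_green h).hasDerivWithinAt

theorem norm_greenDeriv_le_of_ge {k : ℂ} (hk : 0 ≤ k.im) {x y : ℝ} (hy : 0 ≤ y) (h : y ≤ x) :
    ‖greenDeriv k x y‖ ≤ (1 + ‖k‖) * min 1 y * Real.exp (-(k.im * |x - y|)) := by
  rw [greenDeriv, if_pos h, abs_of_nonneg (sub_nonneg.2 h)]
  have e : Complex.I * k * Complex.exp (Complex.I * k * x) * sinK k y =
      Complex.I * (Complex.exp (Complex.I * k * x) * (k * sinK k y)) := by ring
  have e2 : Real.exp (-(k.im * (x - y))) = Real.exp (-(k.im * x)) * Real.exp (k.im * y) := by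
    rw [← Real.exp_add]; congr 1; ring
  rw [e, norm_mul, Complex.norm_I, one_mul, norm_mul, norm_cexp, e2]
  have h1 : ‖k * sinK k y‖ ≤ Real.exp (k.im * y) := by
    rw [mul_sinK]; exact norm_sin_le hk hy
  have h2 : ‖k * sinK k y‖ ≤ ‖k‖ * (y * Real.exp (k.im * y)) := by
    rw [norm_mul]
    gcongr
    exact norm_sinK_le hk hy
  have h3 : ‖k * sinK k y‖ ≤ (1 + ‖k‖) * min 1 y * Real.exp (k.im * y) := by
    have he := Real.exp_pos (k.im * y)
    rcases le_total 1 y with h | h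
    · rw [min_eq_left h]
      nlinarith [mul_nonneg (norm_nonneg k) he.le]
    · rw [min_eq_right h]
      nlinarith [mul_nonneg hy he.le]
  calc _ ≤ Real.exp (-(k.im * x)) * ((1 + ‖k‖) * min 1 y * Real.exp (k.im * y)) := by gcongr
    _ = _ := by ring

theorem norm_greenDeriv_le_of_lt {k : ℂ} (hk : 0 ≤ k.im) {x y : ℝ} (hx : 0 ≤ x) (h : x < y) :
    ‖greenDeriv k x y‖ ≤ Real.exp (-(k.im * |x - y|)) := by
  rw [greenDeriv, if_neg (not_le.2 h), abs_of_nonpos (sub_nonpos.2 h.le)]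
  have e2 : Real.exp (-(k.im * -(x - y))) = Real.exp (-(k.im * y)) * Real.exp (k.im * x) := by
    rw [← Real.exp_add]; congr 1; ring
  rw [norm_mul, norm_cexp, e2]
  gcongr
  exact norm_cos_le hk hx

theorem norm_greenDeriv_le {k : ℂ} (hk : 0 ≤ k.im) {x y : ℝ} (hx : 0 ≤ x) (hy : 0 ≤ y) :
    ‖greenDeriv k x y‖ ≤ (1 + ‖k‖) * Real.exp (-(k.im * |x - y|)) := by
  rcases le_or_gt y x with h | h
  · refine (norm_greenDeriv_le_of_ge hk hy h).trans ?_
    have : min 1 y ≤ 1 := min_le_left _ _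
    have h0 : 0 ≤ min 1 y := le_min zero_le_one hy
    have hn := norm_nonneg k
    gcongr
    nlinarith
  · refine (norm_greenDeriv_le_of_lt hk hx h).trans ?_
    exact le_mul_of_one_le_left (Real.exp_pos _).le (by linarith [norm_nonneg k])

/-- The weight which controls the kernel `green k`. -/
noncomputable def greenWeight (k : ℂ) (y : ℝ) : ℝ := min 1 y * Real.exp (-(k.im * y))

theorem greenWeight_nonneg (k : ℂ) {y : ℝ} (hy : 0 ≤ y) : 0 ≤ greenWeight k y :=
  mul_nonneg (le_min zero_le_one hy) (Real.exp_pos _).le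

theorem continuous_greenWeight (k : ℂ) : Continuous (greenWeight k) := by
  unfold greenWeight; fun_prop

theorem exp_abs_le {k : ℂ} (hk : 0 ≤ k.im) {x y b : ℝ} (hb : x ≤ b) :
    Real.exp (-(k.im * |x - y|)) ≤ Real.exp (k.im * b) * Real.exp (-(k.im * y)) := by
  rw [← Real.exp_add]
  refine Real.exp_le_exp.2 ?_
  have : y - b ≤ |x - y| := by
    rw [abs_sub_comm]
    exact le_trans (by linarith) (le_abs_self _)
  nlinarith

theorem norm_green_le_weight {k : ℂ} (hk : 0 ≤ k.im) {x y b : ℝ} (hx : 0 ≤ x) (hy : 0 ≤ y)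
    (hb : x ≤ b) : ‖green k x y‖ ≤ (1 + b) * Real.exp (k.im * b) * greenWeight k y := by
  have h1 : min x y ≤ (1 + b) * min 1 y := by
    rcases le_total 1 y with h | h
    · rw [min_eq_left h]; linarith [min_le_left x y]
    · rw [min_eq_right h]; nlinarith [min_le_right x y]
  calc _ ≤ min x y * Real.exp (-(k.im * |x - y|)) := norm_green_le hk hx hy
    _ ≤ ((1 + b) * min 1 y) * (Real.exp (k.im * b) * Real.exp (-(k.im * y))) := by
        gcongr
        · exact (le_min hx hy).trans h1
        · exact exp_abs_le hk hb
    _ = _ := by rw [greenWeight]; ring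

/-- For y > x the derivative has no factor min(1, y), but then y > a, so min(1, y) ≥ min(1, a). This
is the origin of the constant (min 1 a)⁻¹ and the reason to stay away from x = 0. -/
theorem norm_greenDeriv_le_weight {k : ℂ} (hk : 0 ≤ k.im) {x y a b : ℝ} (ha : 0 < a) (hy : 0 ≤ y)
    (hax : a ≤ x) (hb : x ≤ b) : ‖greenDeriv k x y‖ ≤
      (1 + ‖k‖ + (min 1 a)⁻¹) * Real.exp (k.im * b) * greenWeight k y := by
  have h0 : 0 ≤ min 1 y := le_min zero_le_one hy
  have ha' : 0 < min 1 a := lt_min one_pos ha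
  have hn := norm_nonneg k
  have key : ‖greenDeriv k x y‖ ≤
      ((1 + ‖k‖ + (min 1 a)⁻¹) * min 1 y) * Real.exp (-(k.im * |x - y|)) := by
    rcases le_or_gt y x with h | h
    · refine (norm_greenDeriv_le_of_ge hk hy h).trans ?_
      refine mul_le_mul_of_nonneg_right (mul_le_mul_of_nonneg_right ?_ h0) (Real.exp_pos _).le
      linarith [inv_pos.2 ha']
    · refine (norm_greenDeriv_le_of_lt hk (ha.le.trans hax) h).trans ?_
      refine le_mul_of_one_le_left (Real.exp_pos _).le ?_
      have h1 : min 1 a ≤ min 1 y := min_le_min le_rfl (hax.trans h.le)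
      calc (1 : ℝ) = (min 1 a)⁻¹ * min 1 a := (inv_mul_cancel₀ ha'.ne').symm
        _ ≤ (1 + ‖k‖ + (min 1 a)⁻¹) * min 1 y := by
            gcongr
            linarith
  calc _ ≤ _ := key
    _ ≤ ((1 + ‖k‖ + (min 1 a)⁻¹) * min 1 y) * (Real.exp (k.im * b) * Real.exp (-(k.im * y))) := by
        gcongr
        exact exp_abs_le hk hb
    _ = _ := by rw [greenWeight]; ring

/-- The functions to which the Green operator can be applied. -/
def GreenIntegrable (k : ℂ) (h : ℝ → ℂ) : Prop :=
  AEStronglyMeasurable h μ ∧ Integrable (fun y => greenWeight k y * ‖h y‖) μ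

/-- The integral operator with kernel `green k`. -/
noncomputable def greenOp (k : ℂ) (h : ℝ → ℂ) (x : ℝ) : ℂ := ∫ y, green k x y * h y ∂μ

theorem measurable_greenDeriv (k : ℂ) (x : ℝ) : Measurable (greenDeriv k x) := by
  unfold greenDeriv
  refine Measurable.ite measurableSet_Iic ?_ (by fun_prop)
  exact ((continuous_sinK.comp (f := fun y : ℝ => (k, y)) (by fun_prop)).measurable).const_mul _

theorem continuous_green_right (k : ℂ) (x : ℝ) : Continuous fun y => green k x y :=
  continuous_green.comp (f := fun y : ℝ => (k, x, y)) (by fun_prop)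

theorem continuous_green_left (k : ℂ) (y : ℝ) : Continuous fun x => green k x y :=
  continuous_green.comp (f := fun x : ℝ => (k, x, y)) (by fun_prop)

theorem continuous_green_uncurry (k : ℂ) : Continuous (Function.uncurry (green k)) :=
  continuous_green.comp (f := fun p : ℝ × ℝ => (k, p.1, p.2)) (by fun_prop)

theorem ae_mu_pos : ∀ᵐ y ∂μ, 0 < y := ae_restrict_mem measurableSet_Ioi

theorem GreenIntegrable.integrable {k : ℂ} {h : ℝ → ℂ} (hk : 0 ≤ k.im) (hh : GreenIntegrable k h)
    {x : ℝ} (hx : 0 ≤ x) : Integrable (fun y => green k x y * h y) μ := by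
  refine (hh.2.const_mul ((1 + x) * Real.exp (k.im * x))).mono'
    ((continuous_green_right k x).aestronglyMeasurable.mul hh.1) ?_
  filter_upwards [ae_mu_pos] with y hy
  rw [norm_mul, ← mul_assoc]
  gcongr
  exact norm_green_le_weight hk hx hy.le le_rfl

theorem GreenIntegrable.integrable_deriv {k : ℂ} {h : ℝ → ℂ} (hk : 0 ≤ k.im)
    (hh : GreenIntegrable k h) {x : ℝ} (hx : 0 < x) :
    Integrable (fun y => greenDeriv k x y * h y) μ := by
  refine (hh.2.const_mul ((1 + ‖k‖ + (min 1 x)⁻¹) * Real.exp (k.im * x))).mono'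
    ((measurable_greenDeriv k x).aestronglyMeasurable.mul hh.1) ?_
  filter_upwards [ae_mu_pos] with y hy
  rw [norm_mul, ← mul_assoc]
  gcongr
  exact norm_greenDeriv_le_weight hk hx hy.le le_rfl le_rfl

/-- The kernel has a kink at x = y. The mean value inequality needs only continuity and the right
derivative, so the kink does no harm. -/
theorem lipschitz_green {k : ℂ} (hk : 0 ≤ k.im) {a b y : ℝ} (ha : 0 < a) (hy : 0 ≤ y) {s t : ℝ}
    (hs : s ∈ Icc a b) (ht : t ∈ Icc a b) : ‖green k t y - green k s y‖ ≤
      (1 + ‖k‖ + (min 1 a)⁻¹) * Real.exp (k.im * b) * greenWeight k y * |t - s| := by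
  wlog hst : s ≤ t generalizing s t
  · rw [norm_sub_rev, abs_sub_comm]
    exact this ht hs (le_of_not_ge hst)
  rw [abs_of_nonneg (sub_nonneg.2 hst)]
  refine norm_image_sub_le_of_norm_deriv_right_le_segment (f := fun t => green k t y)
    (f' := fun t => greenDeriv k t y) (a := s) (b := t)
    (continuous_green_left k y).continuousOn
    (fun x _ => hasDerivWithinAt_green k x y) (fun x hx => ?_) t ⟨hst, le_rfl⟩
  exact norm_greenDeriv_le_weight hk ha hy (hs.1.trans hx.1) (hx.2.le.trans ht.2)

/-- Differentiation under the integral with a Lipschitz majorant: the derivative of the kernel fails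
to exist only at y = x, a null set. -/
theorem hasDerivAt_greenOp {k : ℂ} {h : ℝ → ℂ} (hk : 0 ≤ k.im) (hh : GreenIntegrable k h) {x : ℝ}
    (hx : 0 < x) : HasDerivAt (greenOp k h) (∫ y, greenDeriv k x y * h y ∂μ) x := by
  have hx2 : x / 2 < x := half_lt_self hx
  have hne : ∀ᵐ y ∂μ, x ≠ y := by
    have : ∀ᵐ y : ℝ, y ≠ x := by
      simp [ae_iff]
    filter_upwards [ae_restrict_of_ae this] with y hy using hy.symm
  refine (hasDerivAt_integral_of_dominated_loc_of_lip (μ := μ)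
    (F := fun t y => green k t y * h y) (F' := fun y => greenDeriv k x y * h y)
    (s := Icc (x / 2) (2 * x))
    (bound := fun y => ((1 + ‖k‖ + (min 1 (x / 2))⁻¹) * Real.exp (k.im * (2 * x))) *
      (greenWeight k y * ‖h y‖)) (Icc_mem_nhds hx2 (by linarith)) ?_
    (hh.integrable hk hx.le)
    ((measurable_greenDeriv k x).aestronglyMeasurable.mul hh.1) ?_ (hh.2.const_mul _) ?_).2
  · exact Eventually.of_forall fun t =>
      (continuous_green_right k t).aestronglyMeasurable.mul hh.1
  · filter_upwards [ae_mu_pos] with y hy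
    refine LipschitzOnWith.of_dist_le_mul fun t ht s hs => ?_
    have hw := greenWeight_nonneg k (le_of_lt hy)
    have hp : 0 < min 1 (x / 2) := lt_min one_pos (by positivity)
    rw [dist_eq_norm, dist_eq_norm, ← sub_mul, norm_mul, Real.coe_nnabs,
      abs_of_nonneg (by positivity)]
    calc _ ≤ ((1 + ‖k‖ + (min 1 (x / 2))⁻¹) * Real.exp (k.im * (2 * x)) * greenWeight k y *
          |t - s|) * ‖h y‖ := by
            gcongr
            exact lipschitz_green hk (by positivity) (le_of_lt hy) hs ht
      _ = _ := by rw [Real.norm_eq_abs]; ring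
  · filter_upwards [hne] with y hy
    exact (hasDerivAt_green hy).mul_const _

/-- The integrated form of ∂²G = -k²G - δ_y. The indicator records the jump -1 of the derivative
when the interval crosses y. -/
theorem greenDeriv_sub {k : ℂ} {a b y : ℝ} (hab : a ≤ b) :
    greenDeriv k b y - greenDeriv k a y =
      (-k ^ 2) * (∫ t in a..b, green k t y) - (Ioc a b).indicator (fun _ => 1) y := by
  have hc : ∀ c d, IntervalIntegrable (fun t => green k t y) volume c d := fun c d =>
    (continuous_green_left k y).intervalIntegrable c d
  have hge : ∀ c d, y ≤ c → c ≤ d → (-k ^ 2) * (∫ t in c..d, green k t y) =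
      Complex.I * k * (Complex.exp (Complex.I * k * d) - Complex.exp (Complex.I * k * c)) *
        sinK k y := by
    intro c d hc hd
    have e : ∫ t in c..d, green k t y =
        ∫ t in c..d, Complex.exp (Complex.I * k * t) * sinK k y := by
      refine intervalIntegral.integral_congr fun t ht => ?_
      rw [uIcc_of_le hd] at ht
      exact green_of_ge k (hc.trans ht.1)
    have := intervalIntegral.integral_eq_sub_of_hasDerivAt (a := c) (b := d)
      (fun t _ => hasDerivAt_cexp k t) (Continuous.intervalIntegrable (by fun_prop) _ _)
    rw [intervalIntegral.integral_const_mul] at this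
    rw [e, intervalIntegral.integral_mul_const, ← this]
    linear_combination ((∫ t in c..d, Complex.exp (Complex.I * k * t)) * (-k ^ 2) * sinK k y) *
      Complex.I_sq
  have hle : ∀ c d, d ≤ y → c ≤ d → (-k ^ 2) * (∫ t in c..d, green k t y) =
      Complex.exp (Complex.I * k * y) * (Complex.cos (k * d) - Complex.cos (k * c)) := by
    intro c d hc hd
    have e : ∫ t in c..d, green k t y =
        ∫ t in c..d, Complex.exp (Complex.I * k * y) * sinK k t := by
      refine intervalIntegral.integral_congr fun t ht => ?_
      rw [uIcc_of_le hd] at ht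
      exact green_of_le k (ht.2.trans hc)
    have hcos : ∀ t : ℝ, HasDerivAt (fun t : ℝ => Complex.cos (k * t)) (-k ^ 2 * sinK k t) t := by
      intro t
      have h1 : HasDerivAt (fun y : ℝ => k * (y : ℂ)) k t := by
        simpa using ((hasDerivAt_id t).ofReal_comp).const_mul k
      have := (Complex.hasDerivAt_cos _).comp t h1
      convert! this using 1
      rw [← mul_sinK]
      ring
    have := intervalIntegral.integral_eq_sub_of_hasDerivAt (a := c) (b := d)
      (fun t _ => hcos t) (Continuous.intervalIntegrable
        (continuous_const.mul (continuous_sinK.comp (f := fun y : ℝ => (k, y)) (by fun_prop))) _ _)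
    rw [intervalIntegral.integral_const_mul] at this
    rw [e, intervalIntegral.integral_const_mul, ← this]
    ring
  rcases le_or_gt y a with h | h
  · rw [greenDeriv, greenDeriv, if_pos h, if_pos (h.trans hab), hge a b h hab,
      indicator_of_notMem fun hy => not_lt.2 h hy.1]
    ring
  rcases le_or_gt y b with h' | h'
  · rw [greenDeriv, greenDeriv, if_pos h', if_neg (not_le.2 h),
      ← intervalIntegral.integral_add_adjacent_intervals (hc a y) (hc y b), mul_add,
      hge y b le_rfl h', hle a y le_rfl h.le, indicator_of_mem (show y ∈ Ioc a b from ⟨h, h'⟩)]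
    have e1 : Complex.I * k * (Complex.exp (Complex.I * k * b) - Complex.exp (Complex.I * k * y)) *
        sinK k y = Complex.I * k * Complex.exp (Complex.I * k * b) * sinK k y -
        Complex.exp (Complex.I * k * y) * (Complex.I * (k * sinK k y)) := by ring
    -- The size of the jump: the Wronskian of the sine solution and the exponential at y.
    have e2 : Complex.exp (Complex.I * k * y) *
        (Complex.cos (k * y) - Complex.sin (k * y) * Complex.I) = 1 := by
      have h3 : Complex.cos (k * y) - Complex.sin (k * y) * Complex.I =
          Complex.exp (-(Complex.I * k * y)) := by
        have := Complex.exp_mul_I (-(k * y))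
        rw [Complex.cos_neg, Complex.sin_neg] at this
        rw [show -(Complex.I * k * y) = -(k * y) * Complex.I by ring, this]
        ring
      rw [h3, ← Complex.exp_add, add_neg_cancel, Complex.exp_zero]
    rw [e1, mul_sinK]
    linear_combination -e2
  · rw [greenDeriv, greenDeriv, if_neg (not_le.2 h), if_neg (not_le.2 h'), hle a b h'.le hab,
      indicator_of_notMem fun hy => not_le.2 h' hy.2]
    ring

theorem GreenIntegrable.integrableOn {k : ℂ} {h : ℝ → ℂ} (hh : GreenIntegrable k h) (hk : 0 ≤ k.im)
    {a b : ℝ} (ha : 0 < a) : IntegrableOn h (Ioc a b) volume := by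
  have hsub : Ioc a b ⊆ Ioi 0 := fun x hx => ha.trans hx.1
  have hm : AEStronglyMeasurable h (volume.restrict (Ioc a b)) :=
    hh.1.mono_measure (Measure.restrict_mono hsub le_rfl)
  have hi : IntegrableOn (fun y => greenWeight k y * ‖h y‖) (Ioc a b) volume :=
    hh.2.mono_measure (Measure.restrict_mono hsub le_rfl)
  refine (hi.const_mul ((min 1 a)⁻¹ * Real.exp (k.im * b))).mono' hm ?_
  filter_upwards [ae_restrict_mem measurableSet_Ioc] with y hy
  have hp : 0 < min 1 a := lt_min one_pos ha
  have h1 : min 1 a ≤ min 1 y := min_le_min le_rfl hy.1.le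
  have h2 : (min 1 a) * Real.exp (-(k.im * b)) ≤ greenWeight k y := by
    rw [greenWeight]
    have : k.im * y ≤ k.im * b := mul_le_mul_of_nonneg_left hy.2 hk
    have h3 : 0 ≤ min 1 y := hp.le.trans h1
    gcongr
  calc ‖h y‖ = ((min 1 a)⁻¹ * Real.exp (k.im * b)) *
        (((min 1 a) * Real.exp (-(k.im * b))) * ‖h y‖) := by
          rw [Real.exp_neg]
          have := Real.exp_pos (k.im * b)
          field_simp
    _ ≤ _ := by gcongr

/-- Integrate `greenDeriv_sub` against h and exchange the integrals; on [a, b] the kernel is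
dominated by `greenWeight`, uniformly in x. -/
theorem hasSecondDeriv_greenOp {k : ℂ} {h : ℝ → ℂ} (hk : 0 ≤ k.im) (hh : GreenIntegrable k h) :
    HasSecondDeriv (greenOp k h) (fun x => -k ^ 2 * greenOp k h x - h x) := by
  refine ⟨fun x hx => (hasDerivAt_greenOp hk hh hx).differentiableAt, ?_⟩
  have main : ∀ a b, 0 < a → a ≤ b →
      IntervalIntegrable (fun x => -k ^ 2 * greenOp k h x - h x) volume a b ∧
      deriv (greenOp k h) b - deriv (greenOp k h) a =
        ∫ x in a..b, (-k ^ 2 * greenOp k h x - h x) := by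
    intro a b ha hab
    have hb : 0 < b := ha.trans_le hab
    have hsub : Ioc a b ⊆ Ioi 0 := fun x hx => ha.trans hx.1
    have hcont : ContinuousOn (greenOp k h) (uIcc a b) := by
      rw [uIcc_of_le hab]
      exact fun x hx => (hasDerivAt_greenOp hk hh
        (ha.trans_le hx.1)).continuousAt.continuousWithinAt
    have i1 : IntervalIntegrable (fun x => -k ^ 2 * greenOp k h x) volume a b :=
      (continuousOn_const.mul hcont).intervalIntegrable
    have i2 : IntervalIntegrable h volume a b :=
      (intervalIntegrable_iff_integrableOn_Ioc_of_le hab).2 (hh.integrableOn hk ha)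
    refine ⟨i1.sub i2, ?_⟩
    rw [(hasDerivAt_greenOp hk hh ha).deriv, (hasDerivAt_greenOp hk hh hb).deriv,
      intervalIntegral.integral_sub i1 i2, ← integral_sub (hh.integrable_deriv hk hb)
      (hh.integrable_deriv hk ha)]
    have hprod : Integrable (fun p : ℝ × ℝ => green k p.2 p.1 * h p.1)
        (μ.prod (volume.restrict (Ioc a b))) := by
      have hdom : Integrable (fun p : ℝ × ℝ => (greenWeight k p.1 * ‖h p.1‖) *
          ((1 + b) * Real.exp (k.im * b))) (μ.prod (volume.restrict (Ioc a b))) :=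
        hh.2.mul_prod (integrable_const _)
      refine hdom.mono' (((continuous_green_uncurry k).comp
        continuous_swap).aestronglyMeasurable.mul hh.1.comp_fst) ?_
      have hmem : ∀ᵐ p ∂(μ.prod (volume.restrict (Ioc a b))), p ∈ Ioi (0 : ℝ) ×ˢ Ioc a b := by
        rw [Measure.prod_restrict]
        exact ae_restrict_mem (measurableSet_Ioi.prod measurableSet_Ioc)
      filter_upwards [hmem] with p hp
      rw [norm_mul]
      have := norm_green_le_weight hk (hsub hp.2).le (le_of_lt hp.1) hp.2.2
      calc _ ≤ ((1 + b) * Real.exp (k.im * b) * greenWeight k p.1) * ‖h p.1‖ := by gcongr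
        _ = _ := by ring
    have j1 : Integrable (fun y => (∫ t in a..b, green k t y) * h y) μ := by
      have := hprod.integral_prod_left
      simp_rw [integral_mul_const] at this
      simpa only [intervalIntegral.integral_of_le hab] using this
    have j2 : Integrable (fun y => (Ioc a b).indicator h y) μ :=
      ((hh.integrableOn hk ha).integrable_indicator measurableSet_Ioc).mono_measure
        Measure.restrict_le_self
    have e1 : ∀ y, greenDeriv k b y * h y - greenDeriv k a y * h y =
        -k ^ 2 * ((∫ t in a..b, green k t y) * h y) - (Ioc a b).indicator h y := by
      intro y
      rw [← sub_mul, greenDeriv_sub hab]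
      by_cases hy : y ∈ Ioc a b
      · rw [indicator_of_mem hy, indicator_of_mem hy]; ring
      · rw [indicator_of_notMem hy, indicator_of_notMem hy]; ring
    simp_rw [e1]
    rw [integral_sub (j1.const_mul _) j2, integral_const_mul, intervalIntegral.integral_const_mul]
    congr 1
    · congr 1
      rw [intervalIntegral.integral_of_le hab]
      have := integral_integral_swap (f := fun y t => green k t y * h y) hprod
      simp only [greenOp]
      rw [← this]
      refine integral_congr_ae (Eventually.of_forall fun y => ?_)
      simp only
      rw [integral_mul_const, intervalIntegral.integral_of_le hab]
    · rw [integral_indicator measurableSet_Ioc, intervalIntegral.integral_of_le hab,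
        Measure.restrict_restrict measurableSet_Ioc, inter_eq_left.2 hsub]
  intro a b ha hb
  rcases le_total a b with h | h
  · exact main a b ha h
  · obtain ⟨h1, h2⟩ := main b a hb h
    refine ⟨h1.symm, ?_⟩
    rw [intervalIntegral.integral_symm, ← h2, neg_sub]

theorem greenOp_zero (k : ℂ) (h : ℝ → ℂ) : greenOp k h 0 = 0 := by
  rw [greenOp]
  refine integral_eq_zero_of_ae ?_
  filter_upwards [ae_mu_pos] with y hy
  rw [green_of_le k (le_of_lt hy), sinK_zero_right]
  simp

theorem tendsto_greenOp_zero {k : ℂ} {h : ℝ → ℂ} (hk : 0 ≤ k.im) (hh : GreenIntegrable k h) :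
    Tendsto (greenOp k h) (𝓝[>] 0) (𝓝 0) := by
  rw [← greenOp_zero k h]
  refine tendsto_integral_filter_of_dominated_convergence
    (fun y => ((1 + 1) * Real.exp (k.im * 1)) * (greenWeight k y * ‖h y‖)) ?_ ?_
    (hh.2.const_mul _) ?_
  · exact Eventually.of_forall fun t =>
      (continuous_green_right k t).aestronglyMeasurable.mul hh.1
  · filter_upwards [self_mem_nhdsWithin, mem_nhdsWithin_of_mem_nhds (Iio_mem_nhds one_pos)]
      with x hx hx1
    filter_upwards [ae_mu_pos] with y hy
    rw [norm_mul, ← mul_assoc]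
    gcongr
    exact norm_green_le_weight hk (le_of_lt hx) hy.le (le_of_lt hx1)
  · refine Eventually.of_forall fun y => ?_
    exact (((continuous_green_left k y).tendsto 0).mono_left nhdsWithin_le_nhds).mul_const _

end HalfLine

/-! ### Volterra uniqueness and the homogeneous Lippmann-Schwinger equation. -/

theorem tendsto_setIntegral_zero_of_eventually_notMem {α ι : Type*} [MeasurableSpace α]
    {μ : Measure α} {l : Filter ι} [l.IsCountablyGenerated] {B : ι → Set α} {m : α → ℝ}
    (hB : ∀ i, MeasurableSet (B i)) (hm : Integrable m μ) (h : ∀ᵐ y ∂μ, ∀ᶠ i in l, y ∉ B i) :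
    Tendsto (fun i => ∫ y in B i, m y ∂μ) l (𝓝 0) := by
  simp_rw [← integral_indicator (hB _)]
  rw [← integral_zero α ℝ (μ := μ)]
  refine tendsto_integral_filter_of_dominated_convergence (fun y => ‖m y‖) ?_ ?_ hm.norm ?_
  · exact Eventually.of_forall fun i => hm.1.indicator (hB i)
  · exact Eventually.of_forall fun i => Eventually.of_forall fun y => norm_indicator_le_norm_self _ _
  · filter_upwards [h] with y hy
    refine tendsto_const_nhds.congr' ?_
    filter_upwards [hy] with i hi
    rw [indicator_of_notMem hi]

namespace HalfLine

theorem exists_setIntegral_Ioi_le_half {m : ℝ → ℝ} (hm : Integrable m μ) :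
    ∃ X, 1 ≤ X ∧ ∫ y in Ioi X, m y ∂μ ≤ 1 / 2 := by
  have h := tendsto_setIntegral_zero_of_eventually_notMem (l := atTop) (B := fun X : ℝ => Ioi X)
    (fun _ => measurableSet_Ioi) hm (Eventually.of_forall fun y => by
      filter_upwards [eventually_ge_atTop y] with X hX using not_lt.2 hX)
  obtain ⟨X, h1, h2⟩ := ((h.eventually (ge_mem_nhds (by norm_num : (0 : ℝ) < 1 / 2))).and
    (eventually_ge_atTop 1)).exists
  exact ⟨X, h2, h1⟩

/-- A Gronwall type uniqueness statement for a Volterra inequality at infinity. -/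
theorem volterra_eq_zero {f m : ℝ → ℝ} {D : ℝ} (hm0 : ∀ x, 0 < x → 0 ≤ m x)
    (hm : Integrable m μ) (hf0 : ∀ x, 0 < x → 0 ≤ f x) (hfD : ∀ x, 0 < x → f x ≤ D)
    (h : ∀ x, 0 < x → f x ≤ ∫ y in Ioi x, m y * f y ∂μ) : ∀ x, 0 < x → f x = 0 := by
  -- If f can be nonzero beyond s only on a set of mass at most 1/2, each use of the inequality
  -- halves the bound: f ≤ D 2^(-n) for all n.
  have step : ∀ (s : ℝ) (B : Set ℝ), 0 ≤ s → MeasurableSet B →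
      (∀ x, s < x → x ∉ B → f x = 0) → ∫ y in B, m y ∂μ ≤ 1 / 2 → ∀ x, s < x → f x = 0 := by
    intro s B hs hB hfB hmB
    have hn : ∀ n : ℕ, ∀ x, s < x → f x ≤ D * (1 / 2) ^ n := by
      intro n
      induction n with
      | zero => intro x hx; simpa using hfD x (hs.trans_lt hx)
      | succ n ih =>
        intro x hx
        have hx0 : 0 < x := hs.trans_lt hx
        have hD : 0 ≤ D * (1 / 2) ^ n := (hf0 x hx0).trans (ih x hx)
        calc f x ≤ ∫ y in Ioi x, m y * f y ∂μ := h x hx0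
          _ ≤ ∫ y in Ioi x, B.indicator m y * (D * (1 / 2) ^ n) ∂μ := by
              refine integral_mono_of_nonneg ?_ ?_ ?_
              · filter_upwards [ae_restrict_mem measurableSet_Ioi] with y hy
                exact mul_nonneg (hm0 y (hx0.trans hy)) (hf0 y (hx0.trans hy))
              · exact ((hm.indicator hB).mul_const _).restrict
              · filter_upwards [ae_restrict_mem measurableSet_Ioi] with y hy
                by_cases hyB : y ∈ B
                · rw [indicator_of_mem hyB]
                  exact mul_le_mul_of_nonneg_left (ih y (hx.trans hy)) (hm0 y (hx0.trans hy))
                · rw [indicator_of_notMem hyB, hfB y (hx.trans hy) hyB]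
                  simp
          _ ≤ ∫ y, B.indicator m y * (D * (1 / 2) ^ n) ∂μ := by
              refine setIntegral_le_integral ((hm.indicator hB).mul_const _) ?_
              filter_upwards [ae_mu_pos] with y hy
              exact mul_nonneg (indicator_apply_nonneg fun _ => hm0 y hy) hD
          _ ≤ _ := by
              rw [integral_mul_const, integral_indicator hB, pow_succ]
              nlinarith
    intro x hx
    refine le_antisymm ?_ (hf0 x (hs.trans_lt hx))
    have ht : Tendsto (fun n : ℕ => D * (1 / 2 : ℝ) ^ n) atTop (𝓝 (D * 0)) :=
      (tendsto_pow_atTop_nhds_zero_of_lt_one (by norm_num) (by norm_num)).const_mul D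
    rw [mul_zero] at ht
    exact ge_of_tendsto' ht fun n => hn n x hx
  obtain ⟨X, hX1, hX⟩ := exists_setIntegral_Ioi_le_half hm
  -- Continuation from infinity towards 0: if the infimum of `A` were positive, a short interval to
  -- its left, of mass at most 1/2, would push it further.
  set A : Set ℝ := {t | 0 ≤ t ∧ ∀ x, t < x → f x = 0} with hA
  have hXA : X ∈ A := ⟨by linarith, step X (Ioi X) (by linarith) measurableSet_Ioi
    (fun x hx hx' => absurd hx hx') hX⟩
  have hbdd : BddBelow A := ⟨0, fun t ht => ht.1⟩
  have ht0 : 0 ≤ sInf A := le_csInf ⟨X, hXA⟩ fun t ht => ht.1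
  have hft : ∀ x, sInf A < x → f x = 0 := by
    intro x hx
    obtain ⟨t, ht, htx⟩ := exists_lt_of_csInf_lt ⟨X, hXA⟩ hx
    exact ht.2 x htx
  rcases ht0.eq_or_lt with h0 | hpos
  · intro x hx
    exact hft x (by rwa [← h0])
  · exfalso
    have hne : ∀ᵐ y ∂μ, y ≠ sInf A := by
      have : ∀ᵐ y : ℝ, y ≠ sInf A := by simp [ae_iff]
      exact ae_restrict_of_ae this
    have hlim := tendsto_setIntegral_zero_of_eventually_notMem (l := 𝓝[<] (sInf A))
      (B := fun s : ℝ => Ioc s (sInf A)) (fun _ => measurableSet_Ioc) hm (by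
        filter_upwards [hne] with y hy
        rcases lt_or_gt_of_ne hy with h | h
        · filter_upwards [mem_nhdsWithin_of_mem_nhds (Ioi_mem_nhds h)] with s hs hy'
          exact lt_asymm hs hy'.1
        · exact Eventually.of_forall fun s hy' => not_lt.2 hy'.2 h)
    obtain ⟨s, hs1, hs2, hs3⟩ := ((hlim.eventually
      (ge_mem_nhds (by norm_num : (0 : ℝ) < 1 / 2))).and
      ((show ∀ᶠ s in 𝓝[<] (sInf A), 0 < s from
        mem_nhdsWithin_of_mem_nhds (Ioi_mem_nhds hpos)).and self_mem_nhdsWithin)).exists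
    have : s ∈ A := ⟨le_of_lt hs2, step s _ (le_of_lt hs2) measurableSet_Ioc
      (fun x hx hx' => hft x (by
        by_contra hc
        exact hx' ⟨hx, not_lt.1 hc⟩)) hs1⟩
    exact not_le.2 hs3 (csInf_le hbdd this)

variable {V : ℝ → ℂ} {k : ℂ}

/-- Iteration improves the a priori bound to 2cρ + C 2^(-n) √x. Both ρ and √x satisfy |G(x, y)| ρ(y)
≤ y ρ(x), so one pass multiplies the old bound by the mass of S, at most 1/2, and c + 2c/2 = 2c is a
fixed point. It is used with ρ an exponential near infinity and with ρ(x) = x near 0. -/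
theorem green_bootstrap (hk : 0 ≤ k.im) (hV1 : Integrable (fun x : ℝ => x * ‖V x‖) μ) {S : Set ℝ}
    (hS : MeasurableSet S) (hS0 : S ⊆ Ioi 0) (hhalf : ∫ y in S, y * ‖V y‖ ∂μ ≤ 1 / 2)
    {u : ℝ → ℂ} {ρ : ℝ → ℝ} (hρ0 : ∀ x ∈ S, 0 ≤ ρ x)
    (hρ : ∀ x ∈ S, ∀ y ∈ S, ‖green k x y‖ * ρ y ≤ y * ρ x) {c C : ℝ} (hc : 0 ≤ c)
    (hu : ∀ x ∈ S, ‖u x‖ ≤ C * √x)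
    (h : ∀ x ∈ S, ‖u x‖ ≤ c * ρ x + ∫ y in S, ‖green k x y‖ * ‖V y * u y‖ ∂μ) :
    ∀ x ∈ S, ‖u x‖ ≤ 2 * c * ρ x := by
  have hn : ∀ n : ℕ, ∀ x ∈ S, ‖u x‖ ≤ 2 * c * ρ x + C * (1 / 2) ^ n * √x := by
    intro n
    induction n with
    | zero =>
      intro x hx
      have := mul_nonneg hc (hρ0 x hx)
      have := hu x hx
      simp
      linarith
    | succ n ih =>
      intro x hx
      have hx0 : 0 < x := hS0 hx
      have hC : 0 ≤ C := by
        have h1 := (norm_nonneg _).trans (hu x hx)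
        exact nonneg_of_mul_nonneg_left h1 (Real.sqrt_pos.2 hx0)
      have hρx := mul_nonneg hc (hρ0 x hx)
      have hI : ∫ y in S, ‖green k x y‖ * ‖V y * u y‖ ∂μ ≤
          ∫ y in S, (y * ‖V y‖) * (2 * c * ρ x + C * (1 / 2) ^ n * √x) ∂μ := by
        refine integral_mono_of_nonneg ?_ ?_ ?_
        · exact Eventually.of_forall fun y => by positivity
        · exact (hV1.mul_const _).restrict
        · filter_upwards [ae_restrict_mem hS] with y hy
          have hy0 : 0 < y := hS0 hy
          have h1 := hρ x hx y hy
          have h2 : ‖green k x y‖ * √y ≤ y * √x := by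
            calc _ ≤ √x * √y * √y := by
                  gcongr
                  exact norm_green_le_sqrt hk hx0.le hy0.le
              _ = y * √x := by rw [mul_assoc, Real.mul_self_sqrt hy0.le, mul_comm]
          rw [norm_mul]
          calc _ ≤ ‖green k x y‖ * (‖V y‖ * (2 * c * ρ y + C * (1 / 2) ^ n * √y)) := by
                gcongr
                exact ih y hy
            _ = ‖V y‖ * (2 * c * (‖green k x y‖ * ρ y) +
                C * (1 / 2) ^ n * (‖green k x y‖ * √y)) := by ring
            _ ≤ ‖V y‖ * (2 * c * (y * ρ x) + C * (1 / 2) ^ n * (y * √x)) := by gcongr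
            _ = _ := by ring
      rw [integral_mul_const] at hI
      have hE : 0 ≤ 2 * c * ρ x + C * (1 / 2) ^ n * √x := by
        have : 0 ≤ C * (1 / 2) ^ n * √x := by positivity
        linarith
      have hI2 := hI.trans (mul_le_mul_of_nonneg_right hhalf hE)
      have := h x hx
      rw [pow_succ]
      linarith
  intro x hx
  have ht : Tendsto (fun n : ℕ => 2 * c * ρ x + C * (1 / 2 : ℝ) ^ n * √x) atTop
      (𝓝 (2 * c * ρ x + C * 0 * √x)) :=
    (((tendsto_pow_atTop_nhds_zero_of_lt_one (by norm_num) (by norm_num)).const_mul C).mul_const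
      _).const_add _
  rw [mul_zero, zero_mul, add_zero] at ht
  exact ge_of_tendsto' ht fun n => hn n x hx

theorem greenIntegrable_of_sqrt (hk : 0 ≤ k.im) {h : ℝ → ℂ} (hm : AEStronglyMeasurable h μ)
    (hi : Integrable (fun y => √y * ‖h y‖) μ) : GreenIntegrable k h := by
  refine ⟨hm, hi.mono' ((continuous_greenWeight k).aestronglyMeasurable.mul hm.norm) ?_⟩
  filter_upwards [ae_mu_pos] with y hy
  rw [Real.norm_of_nonneg (mul_nonneg (greenWeight_nonneg k hy.le) (norm_nonneg _))]
  gcongr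
  have h1 : Real.exp (-(k.im * y)) ≤ 1 := by
    rw [Real.exp_le_one_iff]
    have := mul_nonneg hk hy.le
    linarith
  have h2 : min 1 y ≤ √y := by
    rcases le_total 1 y with h | h
    · rw [min_eq_left h]; exact Real.one_le_sqrt.2 h
    · rw [min_eq_right h]; exact Real.le_sqrt_of_sq_le (by nlinarith)
  exact (mul_le_of_le_one_right (le_min zero_le_one hy.le) h1).trans h2

theorem norm_greenOp_le_sqrt (hk : 0 ≤ k.im) {h : ℝ → ℂ}
    (hi : Integrable (fun y => √y * ‖h y‖) μ) {x : ℝ} (hx : 0 ≤ x) :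
    ‖greenOp k h x‖ ≤ (∫ y, √y * ‖h y‖ ∂μ) * √x := by
  rw [greenOp, ← integral_mul_const]
  refine norm_integral_le_of_norm_le (hi.mul_const _) ?_
  filter_upwards [ae_mu_pos] with y hy
  rw [norm_mul]
  calc _ ≤ √x * √y * ‖h y‖ := by
        gcongr
        exact norm_green_le_sqrt hk hx hy.le
    _ = _ := by ring

/-- A solution of the homogeneous Lippmann-Schwinger equation decays like `exp (- Im k x)`. -/
theorem exists_norm_le_exp (hk : 0 ≤ k.im) (hV1 : Integrable (fun x : ℝ => x * ‖V x‖) μ)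
    {u : ℝ → ℂ} (hu : ∀ x, u x = -greenOp k (fun y => V y * u y) x)
    (hG : GreenIntegrable k (fun y => V y * u y)) {C : ℝ} (hC0 : 0 ≤ C)
    (hC : ∀ x, 0 < x → ‖u x‖ ≤ C * √x) :
    ∃ D, ∀ x, 0 < x → ‖u x‖ ≤ D * Real.exp (-(k.im * x)) := by
  obtain ⟨X, hX1, hX⟩ := exists_setIntegral_Ioi_le_half hV1
  have hX0 : 0 < X := by linarith
  -- For x > X the part y ≤ X of the integral factors as exp(ikx) times a number of modulus at most
  -- `c`; only the part y > X, of small mass, needs the bootstrap.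
  set c : ℝ := ∫ y in Iic X, ‖sinK k y‖ * ‖V y * u y‖ ∂μ with hc
  have hc0 : 0 ≤ c := integral_nonneg fun y => by positivity
  have key := green_bootstrap (S := Ioi X) (u := u) (ρ := fun x => Real.exp (-(k.im * x)))
    (c := c) (C := C) hk hV1 measurableSet_Ioi (fun x hx => hX0.trans hx) hX
    (fun x _ => (Real.exp_pos _).le) ?_ hc0 (fun x hx => hC x (hX0.trans hx)) ?_
  · refine ⟨2 * c + C * √X * Real.exp (k.im * X), fun x hx => ?_⟩
    rcases le_or_gt x X with h | h
    · calc ‖u x‖ ≤ C * √x := hC x hx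
        _ ≤ C * √X * 1 := by rw [mul_one]; gcongr
        _ ≤ C * √X * Real.exp (k.im * X - k.im * x) := by
            gcongr
            rw [Real.one_le_exp_iff]
            nlinarith
        _ = C * √X * Real.exp (k.im * X) * Real.exp (-(k.im * x)) := by
            rw [sub_eq_add_neg, Real.exp_add]; ring
        _ ≤ _ := by gcongr; linarith
    · refine (key x h).trans ?_
      gcongr
      have : 0 ≤ C * √X * Real.exp (k.im * X) := by positivity
      linarith
  · intro x hx y hy
    have hx0 : 0 < x := hX0.trans hx
    have hy0 : 0 < y := hX0.trans hy
    calc _ ≤ min x y * Real.exp (-(k.im * |x - y|)) * Real.exp (-(k.im * y)) := by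
          gcongr
          exact norm_green_le hk hx0.le hy0.le
      _ = min x y * Real.exp (-(k.im * |x - y|) + -(k.im * y)) := by rw [mul_assoc, Real.exp_add]
      _ ≤ y * Real.exp (-(k.im * x)) := by
          gcongr
          · exact min_le_right _ _
          · have := mul_le_mul_of_nonneg_left (le_abs_self (x - y)) hk
            linarith
  · intro x hx
    have hx0 : 0 < x := hX0.trans hx
    have hint := hG.integrable hk hx0.le
    have hsplit : u x = -((∫ y in Iic X, green k x y * (V y * u y) ∂μ) +
        ∫ y in Ioi X, green k x y * (V y * u y) ∂μ) := by
      rw [hu x, greenOp]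
      congr 1
      have := integral_add_compl (measurableSet_Iic (a := X)) hint
      rw [compl_Iic] at this
      exact this.symm
    rw [hsplit, norm_neg]
    refine (norm_add_le _ _).trans (add_le_add ?_ ?_)
    · refine (norm_integral_le_integral_norm _).trans_eq ?_
      rw [hc, ← integral_mul_const]
      refine setIntegral_congr_fun measurableSet_Iic fun y hy => ?_
      rw [norm_mul, green_of_ge k (le_trans hy (le_of_lt hx)), norm_mul, norm_cexp]
      ring
    · refine (norm_integral_le_integral_norm _).trans_eq ?_
      simp_rw [norm_mul]

/-- The exponential decay of u gives dominated convergence of u(x) exp(-ikx) to c = -∫ `sinK` V u.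
If c ≠ 0, then u/c is a Jost solution with value 0 at 0, contrary to `hJost`. If c = 0, subtracting
c leaves an integral over y > x only, and Volterra uniqueness gives u = 0. -/
theorem lippmannSchwinger_eq_zero (hk : 0 ≤ k.im)
    (hV1 : Integrable (fun x : ℝ => x * ‖V x‖) μ)
    (hJost : ∀ e : ℝ → ℂ, IsJostSolution V k e → e 0 ≠ 0)
    {u : ℝ → ℂ} (hu : ∀ x, u x = -greenOp k (fun y => V y * u y) x)
    (hG : GreenIntegrable k (fun y => V y * u y)) {C : ℝ} (hC0 : 0 ≤ C)
    (hC : ∀ x, 0 < x → ‖u x‖ ≤ C * √x) : ∀ x, 0 < x → u x = 0 := by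
  obtain ⟨D, hD⟩ := exists_norm_le_exp hk hV1 hu hG hC0 hC
  have hbound : ∀ x y : ℝ, 0 < x → 0 < y →
      ‖Complex.exp (-(Complex.I * k * x)) * green k x y‖ ≤ y * Real.exp (k.im * y) := by
    intro x y hx hy
    rw [norm_mul, Complex.norm_exp]
    have e : (-(Complex.I * k * x)).re = k.im * x := by simp
    rw [e]
    calc _ ≤ Real.exp (k.im * x) * (min x y * Real.exp (-(k.im * |x - y|))) := by
          gcongr
          exact norm_green_le hk hx.le hy.le
      _ = min x y * Real.exp (k.im * x + -(k.im * |x - y|)) := by rw [Real.exp_add]; ring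
      _ ≤ _ := by
          gcongr
          · exact min_le_right _ _
          · have := mul_le_mul_of_nonneg_left (le_abs_self (x - y)) hk
            linarith
  have hD' : ∀ y, 0 < y → Real.exp (k.im * y) * ‖u y‖ ≤ D := by
    intro y hy
    calc _ ≤ Real.exp (k.im * y) * (D * Real.exp (-(k.im * y))) := by
          gcongr; exact hD y hy
      _ = D := by rw [Real.exp_neg]; field_simp
  have hdom : ∀ y, 0 < y → (y * Real.exp (k.im * y)) * ‖V y * u y‖ ≤ D * (y * ‖V y‖) := by
    intro y hy
    rw [norm_mul]
    calc _ = (y * ‖V y‖) * (Real.exp (k.im * y) * ‖u y‖) := by ring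
      _ ≤ (y * ‖V y‖) * D := by gcongr; exact hD' y hy
      _ = _ := by ring
  set c : ℂ := -∫ y, sinK k y * (V y * u y) ∂μ with hc
  have hh : ∀ x, u x * Complex.exp (-(Complex.I * k * x)) =
      -∫ y, Complex.exp (-(Complex.I * k * x)) * green k x y * (V y * u y) ∂μ := by
    intro x
    rw [hu x, greenOp, neg_mul, ← integral_mul_const]
    congr 1
    refine integral_congr_ae (Eventually.of_forall fun y => ?_)
    ring
  have hge : ∀ x y : ℝ, y ≤ x → Complex.exp (-(Complex.I * k * x)) * green k x y = sinK k y := by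
    intro x y h
    rw [green_of_ge k h, ← mul_assoc, ← Complex.exp_add, neg_add_cancel, Complex.exp_zero, one_mul]
  have hlim : Tendsto (fun x : ℝ => u x * Complex.exp (-(Complex.I * k * x))) atTop (𝓝 c) := by
    simp_rw [hh]
    refine Tendsto.neg (tendsto_integral_filter_of_dominated_convergence
      (fun y => D * (y * ‖V y‖)) ?_ ?_ (hV1.const_mul D) ?_)
    · exact Eventually.of_forall fun x =>
        ((continuous_green_right k x).aestronglyMeasurable.const_mul _).mul hG.1
    · filter_upwards [eventually_gt_atTop 0] with x hx
      filter_upwards [ae_mu_pos] with y hy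
      rw [norm_mul]
      exact (mul_le_mul_of_nonneg_right (hbound x y hx hy) (norm_nonneg _)).trans (hdom y hy)
    · refine Eventually.of_forall fun y => tendsto_const_nhds.congr' ?_
      filter_upwards [eventually_ge_atTop y] with x hx
      rw [hge x y hx]
  by_cases hc0 : c = 0
  · have hsin : Integrable (fun y => sinK k y * (V y * u y)) μ := by
      refine (hV1.const_mul D).mono' (AEStronglyMeasurable.mul (continuous_sinK.comp
        (f := fun y : ℝ => (k, y)) (by fun_prop)).aestronglyMeasurable hG.1) ?_
      filter_upwards [ae_mu_pos] with y hy
      rw [norm_mul]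
      exact (mul_le_mul_of_nonneg_right (norm_sinK_le hk hy.le) (norm_nonneg _)).trans (hdom y hy)
    have hnorm : ∀ x : ℝ, ‖u x * Complex.exp (-(Complex.I * k * x))‖ =
        Real.exp (k.im * x) * ‖u x‖ := by
      intro x
      rw [norm_mul, Complex.norm_exp, mul_comm]
      simp
    -- The factor 2 arises because the kernel on y > x is a difference of two terms, each at most y
    -- exp(Im k · y).
    have hvol := volterra_eq_zero (f := fun x => Real.exp (k.im * x) * ‖u x‖)
      (m := fun y => 2 * (y * ‖V y‖)) (D := D) (fun x hx => by positivity) (hV1.const_mul 2)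
      (fun x hx => by positivity) hD' ?_
    · intro x hx
      have := hvol x hx
      rcases mul_eq_zero.1 this with h | h
      · exact absurd h (Real.exp_pos _).ne'
      · exact norm_eq_zero.1 h
    · intro x hx
      have hint : Integrable (fun y => Complex.exp (-(Complex.I * k * x)) * green k x y *
          (V y * u y)) μ := by
        simp_rw [mul_assoc]
        exact (hG.integrable hk hx.le).const_mul _
      -- The vanishing integral of `sinK` V u is subtracted; for y ≤ x the two kernels coincide, so
      -- only y > x remains.
      have e1 : u x * Complex.exp (-(Complex.I * k * x)) = -∫ y in Ioi x,
          (Complex.exp (-(Complex.I * k * x)) * green k x y - sinK k y) * (V y * u y) ∂μ := by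
        have e2 : u x * Complex.exp (-(Complex.I * k * x)) = -∫ y,
            (Complex.exp (-(Complex.I * k * x)) * green k x y - sinK k y) * (V y * u y) ∂μ := by
          simp_rw [sub_mul]
          rw [integral_sub hint hsin, hh x]
          have : ∫ y, sinK k y * (V y * u y) ∂μ = 0 := by
            rw [hc, neg_eq_zero] at hc0; exact hc0
          rw [this, sub_zero]
        rw [e2, ← integral_indicator (μ := μ) (s := Ioi x) measurableSet_Ioi]
        refine congrArg Neg.neg (integral_congr_ae (Eventually.of_forall fun y => ?_))
        simp only [indicator_apply]
        split_ifs with hy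
        · rfl
        · rw [hge x y (not_lt.1 hy), sub_self, zero_mul]
      rw [← hnorm, e1, norm_neg]
      refine norm_integral_le_of_norm_le ?_ ?_
      · refine ((hV1.const_mul (2 * D)).mono' ?_ ?_).restrict
        · have hum : AEStronglyMeasurable u μ := by
            have : ContinuousOn u (Ioi 0) := by
              have : u = fun x => -greenOp k (fun y => V y * u y) x := funext hu
              rw [this]
              exact fun x hx =>
                (hasDerivAt_greenOp hk hG hx).continuousAt.neg.continuousWithinAt
            exact this.aestronglyMeasurable measurableSet_Ioi
          exact (hV1.const_mul 2).1.mul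
            ((by fun_prop : Continuous fun y : ℝ => Real.exp (k.im * y)).aestronglyMeasurable.mul
              hum.norm)
        · filter_upwards [ae_mu_pos] with y hy
          rw [Real.norm_of_nonneg (by positivity)]
          have h1 := hD' y hy
          have h2 : 0 ≤ y * ‖V y‖ := by positivity
          nlinarith
      · filter_upwards [ae_restrict_mem measurableSet_Ioi] with y hy
        have hy0 : 0 < y := hx.trans hy
        have h1 := (norm_sub_le (Complex.exp (-(Complex.I * k * x)) * green k x y)
          (sinK k y)).trans (add_le_add (hbound x y hx hy0) (norm_sinK_le hk hy0.le))
        rw [norm_mul, norm_mul]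
        calc _ ≤ (y * Real.exp (k.im * y) + y * Real.exp (k.im * y)) * (‖V y‖ * ‖u y‖) := by gcongr
          _ = _ := by ring
  · exfalso
    have hu' : u = (-1 : ℂ) • greenOp k (fun y => V y * u y) := by
      ext x
      rw [Pi.smul_apply, hu x]
      simp
    have hu0 : u 0 = 0 := by rw [hu 0, greenOp_zero, neg_zero]
    refine hJost (fun x => c⁻¹ * u x) ⟨?_, ?_, ?_⟩ (by simp [hu0])
    · simp only [hu0, mul_zero]
      have := ((tendsto_greenOp_zero hk hG).neg).const_mul c⁻¹
      simp only [neg_zero, mul_zero] at this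
      refine this.congr fun x => ?_
      rw [hu x]
    · have := (hasSecondDeriv_greenOp hk hG).const_smul (-c⁻¹)
      have e1 : (-c⁻¹) • greenOp k (fun y => V y * u y) = fun x => c⁻¹ * u x := by
        ext x
        rw [Pi.smul_apply, hu x, smul_eq_mul]
        ring
      rw [e1] at this
      convert this using 1
      ext x
      rw [Pi.smul_apply, smul_eq_mul]
      have := hu x
      linear_combination (-(c⁻¹ * k ^ 2)) * this
    · have := hlim.const_mul c⁻¹
      rw [inv_mul_cancel₀ hc0] at this
      refine this.congr fun x => ?_
      ring

end HalfLine

/-! ### The Birman-Schwinger operator and the uniform bound on its inverse. -/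

theorem exists_isIntegralOperator_of_sq_ne_top {α : Type*} [MeasurableSpace α] {μ : Measure α}
    [SFinite μ] {K : α → α → ℂ} (hK : AEStronglyMeasurable (Function.uncurry K) (μ.prod μ))
    (hC : ∫⁻ x, ∫⁻ y, ‖K x y‖ₑ ^ 2 ∂μ ∂μ ≠ ∞) : ∃ T, IsIntegralOperator μ K T := by
  obtain ⟨T, hT, -⟩ := exists_isIntegralOperator_of_sq hK
    (C := 1 + (∫⁻ x, ∫⁻ y, ‖K x y‖ₑ ^ 2 ∂μ ∂μ).toNNReal) (by
      rw [← ENNReal.coe_toNNReal hC, ← ENNReal.coe_pow, ENNReal.coe_le_coe, ENNReal.toNNReal_coe]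
      set t := (∫⁻ x, ∫⁻ y, ‖K x y‖ₑ ^ 2 ∂μ ∂μ).toNNReal
      have : (0 : ℝ≥0) ≤ t := zero_le
      nlinarith)
  exact ⟨T, hT⟩

section IntegralOperator

variable {α : Type*} [MeasurableSpace α]

open Classical in
/-- The integral operator with kernel `K`, if it exists (and `0` otherwise). -/
noncomputable def integralOperator (μ : Measure α) (K : α → α → ℂ) : Lp ℂ 2 μ →L[ℂ] Lp ℂ 2 μ :=
  if h : ∃ T, IsIntegralOperator μ K T then h.choose else 0

theorem isIntegralOperator_integralOperator {μ : Measure α} {K : α → α → ℂ}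
    (h : ∃ T, IsIntegralOperator μ K T) : IsIntegralOperator μ K (integralOperator μ K) := by
  rw [integralOperator, dif_pos h]
  exact h.choose_spec

end IntegralOperator

namespace HalfLine

/-- A factorization `V = b a` with `|a|² = |b|² = |V|` of a potential with finite first moment. -/
structure Factorization (V a b : ℝ → ℂ) : Prop where
  integrable : Integrable (fun x : ℝ => x * ‖V x‖) μ
  measurable_a : AEStronglyMeasurable a μ
  measurable_b : AEStronglyMeasurable b μ
  norm_a : ∀ᵐ x ∂μ, ‖a x‖ ^ 2 = ‖V x‖
  norm_b : ∀ᵐ x ∂μ, ‖b x‖ ^ 2 = ‖V x‖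
  mul_eq : ∀ᵐ x ∂μ, V x = b x * a x

/-- The choice b = V/a also works where a vanishes: V is 0 there and division by zero gives b = 0.
-/
theorem exists_factorization {V a : ℝ → ℂ} (hV : AEStronglyMeasurable V μ)
    (hV1 : Integrable (fun x : ℝ => x * ‖V x‖) μ) (ha : AEStronglyMeasurable a μ)
    (haV : ∀ᵐ x ∂μ, ‖a x‖ ^ 2 = ‖V x‖) : ∃ b, Factorization V a b := by
  have hb : AEStronglyMeasurable (fun x => V x / a x) μ :=
    (hV.aemeasurable.div ha.aemeasurable).aestronglyMeasurable
  refine ⟨fun x => V x / a x, hV1, ha, hb, haV, ?_, ?_⟩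
  · filter_upwards [haV] with x hx
    rw [norm_div, ← hx]
    rcases eq_or_ne ‖a x‖ 0 with h | h
    · simp [h]
    · field_simp
  · filter_upwards [haV] with x hx
    rcases eq_or_ne (a x) 0 with h | h
    · rw [h, mul_zero]
      rw [h, norm_zero] at hx
      exact norm_eq_zero.1 (by rw [← hx]; norm_num)
    · rw [div_mul_cancel₀ _ h]

/-- The Birman-Schwinger kernel. -/
noncomputable def bsKernel (a b : ℝ → ℂ) (k : ℂ) (x y : ℝ) : ℂ := a x * green k x y * b y

/-- The Birman-Schwinger operator. -/
noncomputable def bsOp (a b : ℝ → ℂ) (k : ℂ) : L2 →L[ℂ] L2 := integralOperator μ (bsKernel a b k)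

variable {V a b : ℝ → ℂ} {k : ℂ}

namespace Factorization

theorem sqrt_memLp {c : ℝ → ℂ} (hV1 : Integrable (fun x : ℝ => x * ‖V x‖) μ)
    (hc : AEStronglyMeasurable c μ) (hc2 : ∀ᵐ x ∂μ, ‖c x‖ ^ 2 = ‖V x‖) :
    MemLp (fun y => (√y : ℂ) * c y) 2 μ := by
  have hm : AEStronglyMeasurable (fun y : ℝ => (√y : ℂ) * c y) μ :=
    AEStronglyMeasurable.mul
      (Complex.continuous_ofReal.comp Real.continuous_sqrt).aestronglyMeasurable hc
  rw [memLp_two_iff_integrable_sq_norm hm]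
  refine hV1.congr ?_
  filter_upwards [hc2, ae_mu_pos] with y hy hy0
  rw [norm_mul, mul_pow, hy, Complex.norm_real, Real.norm_of_nonneg (Real.sqrt_nonneg _),
    Real.sq_sqrt hy0.le]

theorem integrable_sqrt (F : Factorization V a b) (v : L2) :
    Integrable (fun y => √y * ‖b y * v y‖) μ := by
  have h1 := MemLp.smul (𝕜 := ℂ) (r := 1) (Lp.memLp v)
    (sqrt_memLp F.integrable F.measurable_b F.norm_b)
  rw [memLp_one_iff_integrable] at h1
  refine h1.norm.congr (Eventually.of_forall fun y => ?_)
  simp [abs_of_nonneg (Real.sqrt_nonneg y), mul_assoc]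

theorem measurable_mul (F : Factorization V a b) (v : L2) :
    AEStronglyMeasurable (fun y => b y * v y) μ :=
  F.measurable_b.mul (Lp.aestronglyMeasurable v)

theorem greenIntegrable (F : Factorization V a b) (hk : 0 ≤ k.im) (v : L2) :
    GreenIntegrable k (fun y => b y * v y) :=
  greenIntegrable_of_sqrt hk (F.measurable_mul v) (F.integrable_sqrt v)

/-- The mass `∫ x |V(x)| dx` as an extended real number. -/
theorem lintegral_lt_top (F : Factorization V a b) :
    ∫⁻ x, ENNReal.ofReal (x * ‖V x‖) ∂μ < ∞ := by
  rw [← ofReal_integral_eq_lintegral_ofReal F.integrable]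
  · exact ENNReal.ofReal_lt_top
  · filter_upwards [ae_mu_pos] with x hx
    exact mul_nonneg hx.le (norm_nonneg _)

theorem ae_prod (F : Factorization V a b) : ∀ᵐ p ∂(μ.prod μ), 0 < p.1 ∧ 0 < p.2 ∧
    ‖a p.1‖ ^ 2 = ‖V p.1‖ ∧ ‖b p.2‖ ^ 2 = ‖V p.2‖ := by
  filter_upwards [Measure.quasiMeasurePreserving_fst.ae ae_mu_pos,
    Measure.quasiMeasurePreserving_snd.ae ae_mu_pos,
    Measure.quasiMeasurePreserving_fst.ae F.norm_a,
    Measure.quasiMeasurePreserving_snd.ae F.norm_b] with p h1 h2 h3 h4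
  exact ⟨h1, h2, h3, h4⟩

theorem measurable_kernel (F : Factorization V a b) {g : ℝ → ℝ → ℂ}
    (hg : AEStronglyMeasurable (Function.uncurry g) (μ.prod μ)) :
    AEStronglyMeasurable (Function.uncurry fun x y => a x * g x y * b y) (μ.prod μ) :=
  (F.measurable_a.comp_fst.mul hg).mul F.measurable_b.comp_snd

theorem enorm_sq_le (F : Factorization V a b) {g : ℝ → ℝ → ℂ} {C : ℝ} (hC : 0 ≤ C)
    (hg : ∀ x y, 0 < x → 0 < y → ‖g x y‖ ^ 2 ≤ C * (x * y)) :
    ∀ᵐ p ∂(μ.prod μ), ‖a p.1 * g p.1 p.2 * b p.2‖ₑ ^ 2 ≤ ENNReal.ofReal C *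
      (ENNReal.ofReal (p.1 * ‖V p.1‖) * ENNReal.ofReal (p.2 * ‖V p.2‖)) := by
  filter_upwards [F.ae_prod] with p hp
  obtain ⟨h1, h2, h3, h4⟩ := hp
  rw [← ofReal_norm, ← ENNReal.ofReal_pow (norm_nonneg _), ← ENNReal.ofReal_mul (by positivity),
    ← ENNReal.ofReal_mul hC]
  refine ENNReal.ofReal_le_ofReal ?_
  rw [norm_mul, norm_mul, mul_pow, mul_pow, h3, h4]
  calc _ ≤ ‖V p.1‖ * (C * (p.1 * p.2)) * ‖V p.2‖ := by
        gcongr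
        exact hg _ _ h1 h2
    _ = _ := by ring

theorem lintegral_bound (F : Factorization V a b) (C : ℝ) :
    ∫⁻ p, ENNReal.ofReal C * (ENNReal.ofReal (p.1 * ‖V p.1‖) * ENNReal.ofReal (p.2 * ‖V p.2‖))
      ∂(μ.prod μ) ≠ ∞ := by
  have hm : AEMeasurable (fun x : ℝ => ENNReal.ofReal (x * ‖V x‖)) μ :=
    F.integrable.1.aemeasurable.ennreal_ofReal
  rw [lintegral_const_mul' _ _ ENNReal.ofReal_ne_top,
    lintegral_prod_mul hm hm]
  exact ENNReal.mul_ne_top ENNReal.ofReal_ne_top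
    (ENNReal.mul_ne_top F.lintegral_lt_top.ne F.lintegral_lt_top.ne)

theorem lintegral_sq_ne_top (F : Factorization V a b) {g : ℝ → ℝ → ℂ}
    (hg : AEStronglyMeasurable (Function.uncurry g) (μ.prod μ))
    (hgb : ∀ x y, 0 < x → 0 < y → ‖g x y‖ ^ 2 ≤ x * y) :
    ∫⁻ x, ∫⁻ y, ‖a x * g x y * b y‖ₑ ^ 2 ∂μ ∂μ ≠ ∞ := by
  have hm := (F.measurable_kernel hg).enorm.pow_const 2
  have e := lintegral_prod _ hm
  simp only [Function.uncurry] at e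
  rw [← e]
  refine ne_top_of_le_ne_top (F.lintegral_bound 1) (lintegral_mono_ae ?_)
  exact F.enorm_sq_le zero_le_one fun x y hx hy => by rw [one_mul]; exact hgb x y hx hy

theorem measurable_green (k : ℂ) :
    AEStronglyMeasurable (Function.uncurry (green k)) (μ.prod μ) :=
  (continuous_green_uncurry k).aestronglyMeasurable

theorem isIntegralOperator_bsOp (F : Factorization V a b) (hk : 0 ≤ k.im) :
    IsIntegralOperator μ (bsKernel a b k) (bsOp a b k) := by
  exact isIntegralOperator_integralOperator (exists_isIntegralOperator_of_sq_ne_top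
    (F.measurable_kernel (measurable_green k)) (F.lintegral_sq_ne_top (measurable_green k)
      fun _ _ hx hy => norm_green_sq_le hk hx.le hy.le))

theorem bsOp_apply (F : Factorization V a b) (hk : 0 ≤ k.im) (v : L2) :
    bsOp a b k v =ᵐ[μ] fun x => a x * greenOp k (fun y => b y * v y) x := by
  filter_upwards [F.isIntegralOperator_bsOp hk v] with x hx
  rw [hx, greenOp, ← integral_const_mul]
  refine integral_congr_ae (Eventually.of_forall fun y => ?_)
  simp only [bsKernel]
  ring

theorem isCompactOperator_bsOp (F : Factorization V a b) (hk : 0 ≤ k.im) :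
    IsCompactOperator (bsOp a b k) :=
  (F.isIntegralOperator_bsOp hk).isCompactOperator (F.measurable_kernel (measurable_green k))
    (F.lintegral_sq_ne_top (measurable_green k)
      (fun _ _ hx hy => norm_green_sq_le hk hx.le hy.le))

/-- Dominated convergence in the Hilbert-Schmidt norm, with majorant 4 x|V(x)| y|V(y)|. Filter and
limiting kernel are left general so that one argument gives both continuity in k and decay at
infinity. -/
theorem tendsto_bsOp (F : Factorization V a b) {l : Filter ℂ} [l.IsCountablyGenerated]
    (hl : ∀ᶠ k in l, 0 ≤ k.im) {g : ℝ → ℝ → ℂ}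
    (hg : AEStronglyMeasurable (Function.uncurry g) (μ.prod μ))
    (hgb : ∀ x y, 0 < x → 0 < y → ‖g x y‖ ^ 2 ≤ x * y)
    (hlim : ∀ x y, 0 < x → 0 < y → Tendsto (fun k => green k x y) l (𝓝 (g x y)))
    {T : L2 →L[ℂ] L2} (hT : IsIntegralOperator μ (fun x y => a x * g x y * b y) T) :
    Tendsto (fun k => bsOp a b k) l (𝓝 T) := by
  have hd : ∀ k, AEStronglyMeasurable (Function.uncurry fun x y =>
      a x * (green k x y - g x y) * b y) (μ.prod μ) := fun k =>
    F.measurable_kernel ((measurable_green k).sub hg)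
  have h0 : Tendsto (fun k => ∫⁻ p, ‖a p.1 * (green k p.1 p.2 - g p.1 p.2) * b p.2‖ₑ ^ 2
      ∂(μ.prod μ)) l (𝓝 0) := by
    rw [← lintegral_zero (μ := μ.prod μ)]
    refine tendsto_lintegral_filter_of_dominated_convergence' _ ?_ ?_ (F.lintegral_bound 4) ?_
    · exact Eventually.of_forall fun k => (hd k).enorm.pow_const 2
    · filter_upwards [hl] with k hk
      refine F.enorm_sq_le (g := fun x y => green k x y - g x y) (by norm_num)
        fun x y hx hy => ?_
      have h1 := norm_green_sq_le hk hx.le hy.le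
      have h2 := hgb x y hx hy
      have h3 := norm_sub_le (green k x y) (g x y)
      calc _ ≤ (‖green k x y‖ + ‖g x y‖) ^ 2 := by gcongr
        _ ≤ _ := by nlinarith [sq_nonneg (‖green k x y‖ - ‖g x y‖)]
    · filter_upwards [F.ae_prod] with p hp
      have h1 : Tendsto (fun k => a p.1 * (green k p.1 p.2 - g p.1 p.2) * b p.2) l
          (𝓝 (a p.1 * (g p.1 p.2 - g p.1 p.2) * b p.2)) :=
        (((hlim _ _ hp.1 hp.2.1).sub_const _).const_mul _).mul_const _
      rw [sub_self, mul_zero, zero_mul] at h1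
      have h2 := (continuous_enorm.tendsto (0 : ℂ)).comp h1
      rw [enorm_zero] at h2
      have h3 := ((ENNReal.continuous_pow 2).tendsto 0).comp h2
      rw [zero_pow two_ne_zero] at h3
      exact h3
  rw [Metric.tendsto_nhds]
  intro ε hε
  have hε2 : 0 < ε / 2 := half_pos hε
  obtain ⟨c, hc⟩ : ∃ c : ℝ≥0, (c : ℝ) = ε / 2 := ⟨⟨ε / 2, hε2.le⟩, rfl⟩
  have hpos : (0 : ℝ≥0∞) < (c : ℝ≥0∞) ^ 2 := by
    refine ENNReal.pow_pos (ENNReal.coe_pos.2 ?_) 2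
    rwa [← NNReal.coe_pos, hc]
  filter_upwards [hl, h0.eventually (gt_mem_nhds hpos)] with k hk hk'
  rw [dist_eq_norm]
  refine lt_of_le_of_lt ?_ (half_lt_self hε)
  rw [← hc]
  refine (F.isIntegralOperator_bsOp hk).norm_sub_le hT (F.measurable_kernel (measurable_green k))
    (F.measurable_kernel hg) (F.lintegral_sq_ne_top (measurable_green k)
      (fun _ _ hx hy => norm_green_sq_le hk hx.le hy.le)) (F.lintegral_sq_ne_top hg hgb)
      (C := c) ?_
  have e := lintegral_prod _ ((hd k).enorm.pow_const 2)
  simp only [Function.uncurry] at e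
  rw [e] at hk'
  refine le_trans (le_of_eq ?_) hk'.le
  refine lintegral_congr fun x => lintegral_congr fun y => ?_
  rw [bsKernel, mul_sub, sub_mul]

theorem continuousOn_bsOp (F : Factorization V a b) :
    ContinuousOn (bsOp a b) {k | 0 ≤ k.im} := by
  intro k hk
  refine F.tendsto_bsOp self_mem_nhdsWithin (measurable_green k)
    (fun _ _ hx hy => norm_green_sq_le hk hx.le hy.le) (fun x y _ _ => ?_)
    (F.isIntegralOperator_bsOp hk)
  have : Continuous fun k => green k x y :=
    continuous_green.comp (f := fun k : ℂ => (k, x, y)) (by fun_prop)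
  exact (this.tendsto k).mono_left nhdsWithin_le_nhds

theorem tendsto_bsOp_cocompact (F : Factorization V a b) :
    Tendsto (bsOp a b) (comap norm atTop ⊓ 𝓟 {k : ℂ | 0 ≤ k.im}) (𝓝 0) := by
  have hmem : ∀ᶠ k in comap norm atTop ⊓ 𝓟 {k : ℂ | 0 ≤ k.im}, 0 ≤ k.im :=
    mem_inf_of_right (mem_principal_self _)
  have hn : Tendsto (fun k : ℂ => ‖k‖) (comap norm atTop ⊓ 𝓟 {k : ℂ | 0 ≤ k.im}) atTop :=
    tendsto_comap.mono_left inf_le_left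
  refine F.tendsto_bsOp hmem (g := fun _ _ => 0) aestronglyMeasurable_const
    (fun x y hx hy => by simp; positivity) (fun x y hx hy => ?_) ?_
  · refine squeeze_zero_norm' ?_ (tendsto_inv_atTop_zero.comp hn)
    filter_upwards [hmem, hn.eventually (eventually_gt_atTop 0)] with k hk hk0
    refine (norm_green_le_inv hk (norm_pos_iff.1 hk0) hx.le hy.le).trans ?_
    refine mul_le_of_le_one_right (by positivity) ?_
    rw [Real.exp_le_one_iff]
    have := mul_nonneg hk (abs_nonneg (x - y))
    linarith
  · intro f
    refine (Lp.coeFn_zero ℂ 2 μ).trans (Eventually.of_forall fun x => ?_)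
    simp

/-- By the Fredholm alternative it suffices to exclude the eigenvalue -1. If Q v = -v, set u =
-R₀(k²)(b v); then v = a u, hence b v = V u, and u solves the homogeneous Lippmann-Schwinger
equation. -/
theorem isUnit_one_add_bsOp (F : Factorization V a b) (hk : 0 ≤ k.im)
    (hJost : ∀ e : ℝ → ℂ, IsJostSolution V k e → e 0 ≠ 0) : IsUnit (1 + bsOp a b k) := by
  have hfr := (F.isCompactOperator_bsOp hk).hasEigenvalue_or_mem_resolventSet
    (neg_ne_zero.2 one_ne_zero : (-1 : ℂ) ≠ 0)
  rcases hfr with h | h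
  · exfalso
    obtain ⟨v, hv⟩ := h.exists_hasEigenvector
    have hv0 : v ≠ 0 := hv.2
    have hQv : bsOp a b k v = (-1 : ℂ) • v := hv.apply_eq_smul
    apply hv0
    set u : ℝ → ℂ := fun x => -greenOp k (fun y => b y * v y) x with hu
    have hva : v =ᵐ[μ] fun x => a x * u x := by
      have h1 := F.bsOp_apply hk v
      rw [hQv] at h1
      filter_upwards [h1, Lp.coeFn_smul (-1 : ℂ) v] with x hx hx'
      rw [hx', Pi.smul_apply, smul_eq_mul] at hx
      rw [hu]
      linear_combination -hx
    have hVu : (fun y => V y * u y) =ᵐ[μ] fun y => b y * v y := by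
      filter_upwards [hva, F.mul_eq] with y h1 h2
      rw [h1, h2]; ring
    have hG : GreenIntegrable k (fun y => V y * u y) := by
      have := F.greenIntegrable hk v
      refine ⟨this.1.congr hVu.symm, this.2.congr ?_⟩
      filter_upwards [hVu] with y hy
      rw [hy]
    have huu : ∀ x, u x = -greenOp k (fun y => V y * u y) x := by
      intro x
      rw [hu]
      refine congrArg Neg.neg (integral_congr_ae ?_)
      filter_upwards [hVu] with y hy
      rw [hy]
    have h0 := lippmannSchwinger_eq_zero hk F.integrable hJost huu hG
      (C := ∫ y, √y * ‖b y * v y‖ ∂μ) (integral_nonneg fun y => by positivity) (fun x hx => by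
        rw [hu, norm_neg]
        exact norm_greenOp_le_sqrt hk (F.integrable_sqrt v) hx.le)
    refine Lp.ext (hva.trans ?_)
    filter_upwards [ae_mu_pos, Lp.coeFn_zero ℂ 2 μ] with x hx hx'
    rw [h0 x hx, hx', mul_zero]
    rfl
  · rw [spectrum.mem_resolventSet_iff] at h
    have e : algebraMap ℂ (L2 →L[ℂ] L2) (-1) - bsOp a b k = -(1 + bsOp a b k) := by
      rw [map_neg, map_one, neg_add, sub_eq_add_neg]
    rw [e, IsUnit.neg_iff] at h
    exact h

/-- Inversion is continuous at units, so the norm is bounded on each compact half-disc; for large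
|k| the operator is close to 1. Invertibility on the real axis, including k = 0, is essential for
compactness. -/
theorem exists_norm_inverse_le (F : Factorization V a b)
    (hJost : ∀ k : ℂ, 0 ≤ k.im → ∀ e : ℝ → ℂ, IsJostSolution V k e → e 0 ≠ 0) :
    ∃ C, 0 ≤ C ∧ ∀ k : ℂ, 0 ≤ k.im → ‖Ring.inverse (1 + bsOp a b k)‖ ≤ C := by
  have hcont : ContinuousOn (fun k => ‖Ring.inverse (1 + bsOp a b k)‖) {k | 0 ≤ k.im} := by
    intro k hk
    obtain ⟨w, hw⟩ := F.isUnit_one_add_bsOp hk (hJost k hk)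
    have h1 : ContinuousAt Ring.inverse (1 + bsOp a b k) := by
      rw [← hw]; exact NormedRing.inverse_continuousAt w
    exact (h1.comp_continuousWithinAt (f := fun k => 1 + bsOp a b k)
      ((F.continuousOn_bsOp k hk).const_add 1)).norm
  have hinf : Tendsto (fun k => ‖Ring.inverse (1 + bsOp a b k)‖)
      (comap norm atTop ⊓ 𝓟 {k : ℂ | 0 ≤ k.im}) (𝓝 ‖(1 : L2 →L[ℂ] L2)‖) := by
    have h1 : Tendsto (fun k => 1 + bsOp a b k) (comap norm atTop ⊓ 𝓟 {k : ℂ | 0 ≤ k.im})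
        (𝓝 (1 + 0)) := F.tendsto_bsOp_cocompact.const_add 1
    have h2 := NormedRing.inverse_continuousAt (1 : (L2 →L[ℂ] L2)ˣ)
    rw [Units.val_one] at h2
    rw [add_zero] at h1
    have h3 := (h2.tendsto.comp h1).norm
    rwa [Ring.inverse_one] at h3
  have hev := hinf.eventually (gt_mem_nhds (lt_add_one ‖(1 : L2 →L[ℂ] L2)‖))
  rw [eventually_inf_principal, eventually_comap] at hev
  obtain ⟨R, hR⟩ := eventually_atTop.1 hev
  have hK : IsCompact ({k : ℂ | 0 ≤ k.im} ∩ Metric.closedBall 0 R) := by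
    refine (isCompact_closedBall 0 R).inter_left ?_
    exact isClosed_le continuous_const Complex.continuous_im
  obtain ⟨C, hC⟩ := hK.bddAbove_image (hcont.mono inter_subset_left)
  refine ⟨max C (‖(1 : L2 →L[ℂ] L2)‖ + 1), by positivity, fun k hk => ?_⟩
  rcases le_total R ‖k‖ with h | h
  · exact (hR ‖k‖ h k rfl hk).le.trans (le_max_right _ _)
  · refine le_trans (hC ⟨k, ⟨hk, ?_⟩, rfl⟩) (le_max_left _ _)
    simpa using h

end Factorization

end HalfLine

/-! ### The perturbed resolvent built from the free one. -/

theorem integrable_real_exp_neg_mul_abs {η : ℝ} (hη : 0 < η) :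
    Integrable fun t : ℝ => Real.exp (-(η * |t|)) := by
  refine (integrable_exp_neg_mul_abs (c := η) (by simpa using hη) 0).norm.congr
    (Eventually.of_forall fun t => ?_)
  simp [Complex.norm_exp]

theorem integral_real_exp_neg_mul_abs {η : ℝ} (hη : 0 < η) :
    ∫ t : ℝ, Real.exp (-(η * |t|)) = 2 / η := by
  have h := integral_exp_neg_mul_abs (c := η) (by simpa using hη) 0
  have e : ∀ t : ℝ, Complex.exp (Complex.I * (0 : ℝ) * t - η * |t|) =
      ((Real.exp (-(η * |t|)) : ℝ) : ℂ) := fun t => by push_cast; congr 1; ring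
  simp_rw [e] at h
  rw [integral_complex_ofReal] at h
  have hη' : (η : ℂ) ≠ 0 := by exact_mod_cast hη.ne'
  have e2 : (2 * η / (η ^ 2 + (0 : ℝ) ^ 2) : ℂ) = ((2 / η : ℝ) : ℂ) := by
    push_cast; field_simp; ring
  rw [e2] at h
  exact_mod_cast h

namespace HalfLine

theorem integrable_exp_sub {η : ℝ} (hη : 0 < η) (x : ℝ) :
    Integrable (fun y : ℝ => Real.exp (-(η * |x - y|))) μ :=
  ((integrable_real_exp_neg_mul_abs hη).comp_sub_left x).integrableOn

theorem integral_exp_sub_le {η : ℝ} (hη : 0 < η) (x : ℝ) :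
    ∫ y, Real.exp (-(η * |x - y|)) ∂μ ≤ 2 / η := by
  rw [← integral_real_exp_neg_mul_abs hη,
    ← integral_sub_left_eq_self (fun t : ℝ => Real.exp (-(η * |t|))) volume x]
  exact setIntegral_le_integral ((integrable_real_exp_neg_mul_abs hη).comp_sub_left x)
    (Eventually.of_forall fun y => (Real.exp_pos _).le)

theorem lintegral_exp_sub_le {η : ℝ} (hη : 0 < η) (x : ℝ) :
    ∫⁻ y, ENNReal.ofReal (Real.exp (-(η * |x - y|))) ∂μ ≤ ENNReal.ofReal (2 / η) := by
  rw [← ofReal_integral_eq_lintegral_ofReal (integrable_exp_sub hη x)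
    (Eventually.of_forall fun y => (Real.exp_pos _).le)]
  exact ENNReal.ofReal_le_ofReal (integral_exp_sub_le hη x)

theorem integrable_norm_sq (f : L2) : Integrable (fun y => ‖f y‖ ^ 2) μ :=
  (memLp_two_iff_integrable_sq_norm (Lp.aestronglyMeasurable f)).1 (Lp.memLp f)

/-- With e denoting the exponential, e t ≤ t² + e² and e² ≤ e. This yields an integrable majorant
for an L² function against the kernel. -/
theorem exp_mul_norm_le {η : ℝ} (hη : 0 < η) (x y t : ℝ) :
    Real.exp (-(η * |x - y|)) * t ≤ t ^ 2 + Real.exp (-(η * |x - y|)) := by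
  have h0 := Real.exp_pos (-(η * |x - y|))
  have h1 : Real.exp (-(η * |x - y|)) ≤ 1 := by
    rw [Real.exp_le_one_iff]
    have := mul_nonneg hη.le (abs_nonneg (x - y))
    linarith
  nlinarith [sq_nonneg (t - Real.exp (-(η * |x - y|))), sq_nonneg t]

theorem integrable_exp_mul_norm {η : ℝ} (hη : 0 < η) (f : L2) (x : ℝ) :
    Integrable (fun y => Real.exp (-(η * |x - y|)) * ‖f y‖) μ := by
  refine ((integrable_norm_sq f).add (integrable_exp_sub hη x)).mono' ?_
    (Eventually.of_forall fun y => ?_)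
  · exact (integrable_exp_sub hη x).1.mul (Lp.aestronglyMeasurable f).norm
  · rw [Real.norm_of_nonneg (by positivity)]
    exact exp_mul_norm_le hη x y _

theorem integral_exp_mul_norm_le {η : ℝ} (hη : 0 < η) (f : L2) (x : ℝ) :
    ∫ y, Real.exp (-(η * |x - y|)) * ‖f y‖ ∂μ ≤ (∫ y, ‖f y‖ ^ 2 ∂μ) + 2 / η := by
  refine le_trans (integral_mono (integrable_exp_mul_norm hη f x)
    ((integrable_norm_sq f).add (integrable_exp_sub hη x)) fun y => exp_mul_norm_le hη x y _) ?_
  rw [integral_add' (integrable_norm_sq f) (integrable_exp_sub hη x)]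
  exact add_le_add le_rfl (integral_exp_sub_le hη x)

variable {k : ℂ} {V a b : ℝ → ℂ}

theorem greenIntegrable_Lp (hk : 0 < k.im) (f : L2) : GreenIntegrable k f := by
  refine ⟨Lp.aestronglyMeasurable f, (integrable_exp_mul_norm hk f 0).mono'
    ((continuous_greenWeight k).aestronglyMeasurable.mul (Lp.aestronglyMeasurable f).norm) ?_⟩
  filter_upwards [ae_mu_pos] with y hy
  rw [Real.norm_of_nonneg (mul_nonneg (greenWeight_nonneg k hy.le) (norm_nonneg _)), greenWeight,
    zero_sub, abs_neg, abs_of_pos hy]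
  refine mul_le_mul_of_nonneg_right ?_ (norm_nonneg _)
  exact mul_le_of_le_one_left (Real.exp_pos _).le (min_le_left _ _)

theorem GreenIntegrable.sub {h h' : ℝ → ℂ} (hh : GreenIntegrable k h) (hh' : GreenIntegrable k h') :
    GreenIntegrable k (fun y => h y - h' y) := by
  refine ⟨hh.1.sub hh'.1, (hh.2.add hh'.2).mono'
    ((continuous_greenWeight k).aestronglyMeasurable.mul (hh.1.sub hh'.1).norm) ?_⟩
  filter_upwards [ae_mu_pos] with y hy
  have h0 := greenWeight_nonneg k hy.le
  rw [Real.norm_of_nonneg (mul_nonneg h0 (norm_nonneg _)), Pi.add_apply, ← mul_add]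
  exact mul_le_mul_of_nonneg_left (norm_sub_le _ _) h0

theorem greenOp_sub (hk : 0 ≤ k.im) {h h' : ℝ → ℂ} (hh : GreenIntegrable k h)
    (hh' : GreenIntegrable k h') {x : ℝ} (hx : 0 ≤ x) :
    greenOp k (fun y => h y - h' y) x = greenOp k h x - greenOp k h' x := by
  rw [greenOp, greenOp, greenOp, ← integral_sub (hh.integrable hk hx) (hh'.integrable hk hx)]
  refine integral_congr_ae (Eventually.of_forall fun y => ?_)
  simp only [mul_sub]

theorem ne_zero_of_im_pos (hk : 0 < k.im) : k ≠ 0 := by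
  rintro rfl; simp at hk

/-- The resolvent of the Dirichlet Laplacian at `k ^ 2`. -/
noncomputable def freeResolvent (k : ℂ) : L2 →L[ℂ] L2 := integralOperator μ (green k)

/-- The free resolvent multiplied by `a` from the left. -/
noncomputable def mulFreeResolvent (a : ℝ → ℂ) (k : ℂ) : L2 →L[ℂ] L2 :=
  integralOperator μ fun x y => a x * green k x y

/-- The free resolvent multiplied by `b` from the right. -/
noncomputable def freeResolventMul (b : ℝ → ℂ) (k : ℂ) : L2 →L[ℂ] L2 :=
  integralOperator μ fun x y => green k x y * b y

theorem freeResolvent_apply (hk : 0 < k.im) (f : L2) : freeResolvent k f =ᵐ[μ] greenOp k f := by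
  refine isIntegralOperator_integralOperator ?_ f
  have key : ∀ x, 0 < x → ∫⁻ y, ‖green k x y‖ₑ ∂μ ≤ (‖k‖⁻¹ * (2 / k.im)).toNNReal := by
    intro x hx
    calc ∫⁻ y, ‖green k x y‖ₑ ∂μ
        ≤ ∫⁻ y, ENNReal.ofReal ‖k‖⁻¹ * ENNReal.ofReal (Real.exp (-(k.im * |x - y|))) ∂μ := by
          refine lintegral_mono_ae ?_
          filter_upwards [ae_mu_pos] with y hy
          rw [← ofReal_norm, ← ENNReal.ofReal_mul (by positivity)]
          exact ENNReal.ofReal_le_ofReal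
            (norm_green_le_inv hk.le (ne_zero_of_im_pos hk) hx.le hy.le)
      _ ≤ ENNReal.ofReal ‖k‖⁻¹ * ENNReal.ofReal (2 / k.im) := by
          rw [lintegral_const_mul' _ _ ENNReal.ofReal_ne_top]
          exact mul_le_mul_right (lintegral_exp_sub_le hk x) _
      _ = _ := by rw [← ENNReal.ofReal_mul (by positivity)]; rfl
  obtain ⟨T, hT, -⟩ := exists_isIntegralOperator_of_schur
    (continuous_green_uncurry k).aestronglyMeasurable
    (by filter_upwards [ae_mu_pos] with x hx using key x hx)
    (by filter_upwards [ae_mu_pos] with y hy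
        simp_rw [green_comm k _ y]
        exact key y hy)
  exact ⟨T, hT⟩

/-- One factor of |G|² is bounded by x, which pairs with |V(x)|; the other by |k|⁻¹ exp(-Im k |x -
y|), which is integrable in y. -/
theorem lintegral_mul_green_sq_ne_top (hk : 0 < k.im) {c : ℝ → ℂ}
    (hV1 : Integrable (fun x : ℝ => x * ‖V x‖) μ) (hc : ∀ᵐ x ∂μ, ‖c x‖ ^ 2 = ‖V x‖) :
    ∫⁻ x, ∫⁻ y, ‖c x * green k x y‖ₑ ^ 2 ∂μ ∂μ ≠ ∞ := by
  have hfin : ∫⁻ x, ENNReal.ofReal (x * ‖V x‖) ∂μ ≠ ∞ := hV1.lintegral_lt_top.ne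
  refine ne_top_of_le_ne_top (ENNReal.mul_ne_top (ENNReal.ofReal_ne_top (r := ‖k‖⁻¹ * (2 / k.im)))
    hfin) ?_
  rw [← lintegral_const_mul' _ _ ENNReal.ofReal_ne_top]
  refine lintegral_mono_ae ?_
  filter_upwards [ae_mu_pos, hc] with x hx hcx
  calc ∫⁻ y, ‖c x * green k x y‖ₑ ^ 2 ∂μ
      ≤ ∫⁻ y, ENNReal.ofReal (‖k‖⁻¹ * (x * ‖V x‖)) *
          ENNReal.ofReal (Real.exp (-(k.im * |x - y|))) ∂μ := by
        refine lintegral_mono_ae ?_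
        filter_upwards [ae_mu_pos] with y hy
        rw [← ofReal_norm, ← ENNReal.ofReal_pow (norm_nonneg _),
          ← ENNReal.ofReal_mul (by positivity)]
        refine ENNReal.ofReal_le_ofReal ?_
        have h1 := norm_green_le_inv hk.le (ne_zero_of_im_pos hk) hx.le hy.le
        have h2 : ‖green k x y‖ ≤ x := (norm_green_le_min hk.le hx.le hy.le).trans (min_le_left _ _)
        rw [norm_mul, mul_pow, hcx, sq ‖green k x y‖]
        calc _ ≤ ‖V x‖ * (x * (‖k‖⁻¹ * Real.exp (-(k.im * |x - y|)))) := by gcongr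
          _ = _ := by ring
    _ ≤ ENNReal.ofReal (‖k‖⁻¹ * (x * ‖V x‖)) * ENNReal.ofReal (2 / k.im) := by
        rw [lintegral_const_mul' _ _ ENNReal.ofReal_ne_top]
        exact mul_le_mul_right (lintegral_exp_sub_le hk x) _
    _ = _ := by
        rw [← ENNReal.ofReal_mul (by positivity), ← ENNReal.ofReal_mul (by positivity)]
        congr 1; ring

namespace Factorization

theorem mulFreeResolvent_apply (F : Factorization V a b) (hk : 0 < k.im) (f : L2) :
    mulFreeResolvent a k f =ᵐ[μ] fun x => a x * greenOp k f x := by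
  have hm : AEStronglyMeasurable (Function.uncurry fun x y => a x * green k x y) (μ.prod μ) :=
    F.measurable_a.comp_fst.mul (measurable_green k)
  have h := isIntegralOperator_integralOperator (exists_isIntegralOperator_of_sq_ne_top hm
    (lintegral_mul_green_sq_ne_top hk F.integrable F.norm_a)) f
  filter_upwards [h] with x hx
  rw [mulFreeResolvent, hx, greenOp, ← integral_const_mul]
  simp only [mul_assoc]

theorem freeResolventMul_apply (F : Factorization V a b) (hk : 0 < k.im) (v : L2) :
    freeResolventMul b k v =ᵐ[μ] greenOp k fun y => b y * v y := by
  have hm : AEStronglyMeasurable (Function.uncurry fun x y => green k x y * b y) (μ.prod μ) :=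
    (measurable_green k).mul F.measurable_b.comp_snd
  have hfin : ∫⁻ x, ∫⁻ y, ‖green k x y * b y‖ₑ ^ 2 ∂μ ∂μ ≠ ∞ := by
    rw [lintegral_lintegral_swap (hm.enorm.pow_const 2)]
    refine ne_of_eq_of_ne ?_ (lintegral_mul_green_sq_ne_top hk F.integrable F.norm_b)
    refine lintegral_congr fun x => lintegral_congr fun y => ?_
    rw [green_comm, mul_comm]
  have h := isIntegralOperator_integralOperator (exists_isIntegralOperator_of_sq_ne_top hm hfin) v
  filter_upwards [h] with x hx
  rw [freeResolventMul, hx, greenOp]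
  simp only [mul_assoc]

end Factorization

/-- The vector `A (L_V - k²)⁻¹ f`, as given by the Birman-Schwinger principle. -/
noncomputable def weightedResolvent (a b : ℝ → ℂ) (k : ℂ) : L2 →L[ℂ] L2 :=
  (Ring.inverse (1 + bsOp a b k)).comp (mulFreeResolvent a k)

/-- The pointwise representative of `(L_V - k²)⁻¹ f`. -/
noncomputable def resolventFun (a b : ℝ → ℂ) (k : ℂ) (f : L2) : ℝ → ℂ :=
  greenOp k fun y => f y - b y * weightedResolvent a b k f y

/-- The resolvent of the Schrödinger operator at `k ^ 2`. -/
noncomputable def perturbedResolvent (a b : ℝ → ℂ) (k : ℂ) : L2 →L[ℂ] L2 :=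
  freeResolvent k - (freeResolventMul b k).comp (weightedResolvent a b k)

namespace Factorization

theorem perturbedResolvent_apply (F : Factorization V a b) (hk : 0 < k.im) (f : L2) :
    perturbedResolvent a b k f =ᵐ[μ] resolventFun a b k f := by
  set v := weightedResolvent a b k f
  have e : perturbedResolvent a b k f = freeResolvent k f - freeResolventMul b k v := rfl
  rw [e]
  filter_upwards [Lp.coeFn_sub (freeResolvent k f) (freeResolventMul b k v),
    freeResolvent_apply hk f, F.freeResolventMul_apply hk v, ae_mu_pos] with x h1 h2 h3 hx
  rw [h1, Pi.sub_apply, h2, h3, resolventFun,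
    greenOp_sub hk.le (greenIntegrable_Lp hk f) (F.greenIntegrable hk.le v) hx.le]

/-- With v = (1 + Q)⁻¹ a R₀ f, the equation v + Q v = a R₀ f reads v = a (R₀ f - R₀ b v). -/
theorem weightedResolvent_apply (F : Factorization V a b) (hk : 0 < k.im)
    (hu : IsUnit (1 + bsOp a b k)) (f : L2) :
    weightedResolvent a b k f =ᵐ[μ] fun x => a x * resolventFun a b k f x := by
  set v := weightedResolvent a b k f with hv
  have h0 : v + bsOp a b k v = mulFreeResolvent a k f := by
    have h1 := Ring.mul_inverse_cancel _ hu
    have h2 := congrArg (fun T : L2 →L[ℂ] L2 => T (mulFreeResolvent a k f)) h1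
    exact h2
  have h1 := Lp.coeFn_add v (bsOp a b k v)
  rw [h0] at h1
  filter_upwards [h1, F.bsOp_apply hk.le v, F.mulFreeResolvent_apply hk f, ae_mu_pos]
    with x h1 h2 h3 hx
  rw [resolventFun, greenOp_sub hk.le (greenIntegrable_Lp hk f) (F.greenIntegrable hk.le v) hx.le]
  rw [h3, Pi.add_apply, h2] at h1
  linear_combination -h1

theorem mul_resolventFun (F : Factorization V a b) (hk : 0 < k.im)
    (hu : IsUnit (1 + bsOp a b k)) (f : L2) :
    (fun x => V x * resolventFun a b k f x) =ᵐ[μ] fun x => b x * weightedResolvent a b k f x := by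
  filter_upwards [F.weightedResolvent_apply hk hu f, F.mul_eq] with x h1 h2
  rw [h1, h2, mul_assoc]

theorem greenIntegrable_sub (F : Factorization V a b) (hk : 0 < k.im) (f v : L2) :
    GreenIntegrable k fun y => f y - b y * v y :=
  (greenIntegrable_Lp hk f).sub (F.greenIntegrable hk.le v)

theorem hasSecondDeriv_resolventFun (F : Factorization V a b) (hk : 0 < k.im)
    (hu : IsUnit (1 + bsOp a b k)) (f : L2) :
    HasSecondDeriv (resolventFun a b k f)
      fun x => (V x - k ^ 2) * resolventFun a b k f x - f x := by
  refine (hasSecondDeriv_greenOp hk.le (F.greenIntegrable_sub hk f _)).congr ?_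
  filter_upwards [F.mul_resolventFun hk hu f] with x hx
  rw [sub_mul, hx]
  simp only [resolventFun]
  ring

theorem schrodingerRel_perturbedResolvent (F : Factorization V a b) (hk : 0 < k.im)
    (hu : IsUnit (1 + bsOp a b k)) (f : L2) :
    SchrodingerRel V (perturbedResolvent a b k f) (f + k ^ 2 • perturbedResolvent a b k f) := by
  refine ⟨resolventFun a b k f, F.perturbedResolvent_apply hk f,
    tendsto_greenOp_zero hk.le (F.greenIntegrable_sub hk f _),
    (F.hasSecondDeriv_resolventFun hk hu f).congr ?_⟩
  filter_upwards [F.perturbedResolvent_apply hk f,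
    Lp.coeFn_add f (k ^ 2 • perturbedResolvent a b k f),
    Lp.coeFn_smul (k ^ 2) (perturbedResolvent a b k f)] with x h1 h2 h3
  rw [h2, Pi.add_apply, h3, Pi.smul_apply, h1, smul_eq_mul]
  ring

end Factorization

end HalfLine

/-! ### Wronskians and uniqueness of square integrable solutions. -/

/-- Integration by parts against the primitive of an integrable function. -/
theorem integral_mul_eq_of_primitive {p P q q' : ℝ → ℂ} {a b : ℝ} (hab : a ≤ b)
    (hp : IntervalIntegrable p volume a b)
    (hP : ∀ x ∈ Icc a b, P x = P a + ∫ t in a..x, p t)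
    (hq : ∀ x ∈ Icc a b, HasDerivAt q (q' x) x) (hq' : ContinuousOn q' (Icc a b)) :
    ∫ x in a..b, p x * q x = P b * q b - P a * q a - ∫ x in a..b, P x * q' x := by
  set ν := volume.restrict (Ioc a b) with hν
  have hpi : Integrable p ν := (intervalIntegrable_iff_integrableOn_Ioc_of_le hab).1 hp
  have hqI : ∀ c ∈ Icc a b, ∀ d ∈ Icc a b, IntervalIntegrable q' volume c d := fun c hc d hd =>
    (hq'.mono (uIcc_subset_Icc hc hd)).intervalIntegrable
  have hqi : Integrable q' ν := (intervalIntegrable_iff_integrableOn_Ioc_of_le hab).1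
    (hqI a (left_mem_Icc.2 hab) b (right_mem_Icc.2 hab))
  have hftc : ∀ x ∈ Icc a b, ∫ s in x..b, q' s = q b - q x := fun x hx =>
    intervalIntegral.integral_eq_sub_of_hasDerivAt
      (fun t ht => hq t (uIcc_subset_Icc hx (right_mem_Icc.2 hab) ht))
      (hqI x hx b (right_mem_Icc.2 hab))
  -- The identity is Fubini for p(t) q'(s) on the triangle t < s.
  set f : ℝ → ℝ → ℂ := fun t s => {z : ℝ × ℝ | z.1 < z.2}.indicator (fun z => p z.1 * q' z.2) (t, s)
    with hf
  have hfi : Integrable (Function.uncurry f) (ν.prod ν) :=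
    (hpi.mul_prod hqi).indicator (measurableSet_lt measurable_fst measurable_snd)
  have h1 : ∀ t ∈ Ioc a b, ∫ s, f t s ∂ν = p t * (q b - q t) := by
    intro t ht
    have e : f t = (Ioi t).indicator fun s => p t * q' s := by
      funext s
      simp only [hf, indicator, mem_ofPred_eq, mem_Ioi]
    rw [e, integral_indicator measurableSet_Ioi, hν, Measure.restrict_restrict measurableSet_Ioi,
      inter_comm, Ioc_inter_Ioi, max_eq_right ht.1.le, integral_const_mul,
      ← intervalIntegral.integral_of_le ht.2, hftc t (Ioc_subset_Icc_self ht)]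
  have h2 : ∀ s ∈ Ioc a b, ∫ t, f t s ∂ν = (P s - P a) * q' s := by
    intro s hs
    have e : (fun t => f t s) = (Iio s).indicator fun t => p t * q' s := by
      funext t
      simp only [hf, indicator, mem_ofPred_eq, mem_Iio]
    rw [e, integral_indicator measurableSet_Iio, hν, Measure.restrict_restrict measurableSet_Iio,
      integral_mul_const, hP s (Ioc_subset_Icc_self hs), add_sub_cancel_left,
      intervalIntegral.integral_of_le hs.1.le, integral_Ioc_eq_integral_Ioo]
    have : Iio s ∩ Ioc a b = Ioo a s := by
      ext t
      simp only [mem_inter_iff, mem_Iio, mem_Ioc, mem_Ioo]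
      constructor
      · rintro ⟨h, h', -⟩; exact ⟨h', h⟩
      · rintro ⟨h', h⟩; exact ⟨h, h', h.le.trans hs.2⟩
    rw [this]
  have hsw := integral_integral_swap hfi
  rw [setIntegral_congr_fun measurableSet_Ioc h1, setIntegral_congr_fun measurableSet_Ioc h2,
    ← intervalIntegral.integral_of_le hab, ← intervalIntegral.integral_of_le hab] at hsw
  have hqc : ContinuousOn q (uIcc a b) := by
    rw [uIcc_of_le hab]
    exact fun x hx => (hq x hx).continuousAt.continuousWithinAt
  have hPc : ContinuousOn P (uIcc a b) := by
    rw [uIcc_of_le hab]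
    have := intervalIntegral.continuousOn_primitive_interval
      (show IntegrableOn p (uIcc a b) volume by
        rw [uIcc_of_le hab, integrableOn_Icc_iff_integrableOn_Ioc]; exact hpi)
    rw [uIcc_of_le hab] at this
    exact (this.const_add (P a)).congr hP
  have i1 : IntervalIntegrable (fun x => p x * q b) volume a b := hp.mul_const _
  have i2 : IntervalIntegrable (fun x => p x * q x) volume a b := hp.mul_continuousOn hqc
  have hq'' := hqI a (left_mem_Icc.2 hab) b (right_mem_Icc.2 hab)
  have i3 : IntervalIntegrable (fun x => P x * q' x) volume a b := hq''.continuousOn_mul hPc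
  have i4 : IntervalIntegrable (fun x => P a * q' x) volume a b := hq''.const_mul _
  simp only [mul_sub, sub_mul] at hsw
  rw [intervalIntegral.integral_sub i1 i2, intervalIntegral.integral_sub i3 i4,
    intervalIntegral.integral_mul_const, intervalIntegral.integral_const_mul,
    hftc a (left_mem_Icc.2 hab)] at hsw
  have hPb := hP b (right_mem_Icc.2 hab)
  linear_combination -hsw - q b * hPb

namespace HalfLine

variable {y w g h : ℝ → ℂ}

theorem HasSecondDeriv.continuousOn_deriv (hy : HasSecondDeriv y g) :
    ContinuousOn (deriv y) (Ioi 0) := by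
  intro x hx
  have hx0 : 0 < x := hx
  have h1 : (0 : ℝ) < x / 2 := half_pos hx0
  have h2 : x / 2 ≤ 2 * x := by linarith
  have hi := (hy.2 (x / 2) (2 * x) h1 (by linarith)).1
  have hc := intervalIntegral.continuousOn_primitive_interval
    (show IntegrableOn g (uIcc (x / 2) (2 * x)) volume by
      rw [uIcc_of_le h2, integrableOn_Icc_iff_integrableOn_Ioc]
      exact (intervalIntegrable_iff_integrableOn_Ioc_of_le h2).1 hi)
  rw [uIcc_of_le h2] at hc
  have hc' : ContinuousOn (deriv y) (Icc (x / 2) (2 * x)) := by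
    refine (hc.const_add (deriv y (x / 2))).congr fun t ht => ?_
    simp only [← (hy.2 (x / 2) t h1 (h1.trans_le ht.1)).2]
    ring
  exact (hc'.continuousAt (Icc_mem_nhds (by linarith) (by linarith))).continuousWithinAt

theorem HasSecondDeriv.integral_mul (hy : HasSecondDeriv y g) (hw : HasSecondDeriv w h) {a b : ℝ}
    (ha : 0 < a) (hab : a ≤ b) : ∫ x in a..b, g x * w x =
      deriv y b * w b - deriv y a * w a - ∫ x in a..b, deriv y x * deriv w x := by
  have hsub : Icc a b ⊆ Ioi 0 := fun x hx => ha.trans_le hx.1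
  refine integral_mul_eq_of_primitive hab (hy.2 a b ha (ha.trans_le hab)).1 (fun x hx => ?_)
    (fun x hx => (hw.1 x (hsub hx)).hasDerivAt) (hw.continuousOn_deriv.mono hsub)
  rw [← (hy.2 a x ha (hsub hx)).2]
  ring

theorem HasSecondDeriv.continuousOn (hy : HasSecondDeriv y g) : ContinuousOn y (Ioi 0) :=
  fun x hx => (hy.1 x hx).continuousAt.continuousWithinAt

/-- Lagrange's identity. -/
theorem HasSecondDeriv.lagrange (hy : HasSecondDeriv y g) (hw : HasSecondDeriv w h) {a b : ℝ}
    (ha : 0 < a) (hab : a ≤ b) : ∫ x in a..b, (g x * w x - h x * y x) =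
      (deriv y b * w b - deriv w b * y b) - (deriv y a * w a - deriv w a * y a) := by
  have hsub : uIcc a b ⊆ Ioi 0 := by
    rw [uIcc_of_le hab]; exact fun x hx => ha.trans_le hx.1
  have hb := ha.trans_le hab
  rw [intervalIntegral.integral_sub
    ((hy.2 a b ha hb).1.mul_continuousOn (hw.continuousOn.mono hsub))
    ((hw.2 a b ha hb).1.mul_continuousOn (hy.continuousOn.mono hsub)),
    hy.integral_mul hw ha hab, hw.integral_mul hy ha hab]
  simp only [mul_comm (deriv w _) (deriv y _)]
  ring

/-- On every interval `[N, 2N]` the Wronskian of `y` and `w` is somewhere controlled by the `L¹` norm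
of `y` alone. -/
theorem HasSecondDeriv.exists_re_wronskian_le (hy : HasSecondDeriv y g) (hw : HasSecondDeriv w h)
    {N c₀ c₁ : ℝ} (hN : 0 < N) (h0 : ∀ x ∈ Icc N (2 * N), ‖w x‖ ≤ c₀)
    (h1 : ∀ x ∈ Icc N (2 * N), ‖deriv w x‖ ≤ c₁) :
    ∃ X ∈ Icc N (2 * N), (deriv y X * w X - deriv w X * y X).re ≤
      (6 * c₀ / N ^ 2 + 12 * c₁ / N) * ∫ x in N..2 * N, ‖y x‖ := by
  have hle : N ≤ 2 * N := by linarith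
  have hsub : uIcc N (2 * N) ⊆ Ioi 0 := by
    rw [uIcc_of_le hle]; exact fun x hx => hN.trans_le hx.1
  -- A weight vanishing at both ends, so that averaging the Wronskian against it allows an
  -- integration by parts without boundary terms. The constants come from |κ'| ≤ N, |κ| ≤ N² and ∫ κ
  -- = N³/6.
  set κ : ℝ → ℝ := fun x => (x - N) * (2 * N - x) with hκ
  set κ' : ℝ → ℝ := fun x => 3 * N - 2 * x with hκ'
  have hd : ∀ x, HasDerivAt κ (κ' x) x := fun x => by
    have := ((hasDerivAt_id x).sub_const N).mul ((hasDerivAt_id x).const_sub (2 * N))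
    refine this.congr_deriv ?_
    simp [hκ']; ring
  have hκc : Continuous κ := by fun_prop
  have hκc' : Continuous κ' := by fun_prop
  have hyc := hy.continuousOn.mono hsub
  have hwc := hw.continuousOn.mono hsub
  have hyc' := hy.continuousOn_deriv.mono hsub
  have hwc' := hw.continuousOn_deriv.mono hsub
  set W : ℝ → ℂ := fun x => deriv y x * w x - deriv w x * y x with hW
  have hWc : ContinuousOn W (uIcc N (2 * N)) := (hyc'.mul hwc).sub (hwc'.mul hyc)
  have cof : ∀ {u : ℝ → ℝ}, Continuous u → Continuous fun x => (u x : ℂ) := fun hu =>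
    Complex.continuous_ofReal.comp hu
  -- integrating by parts the derivative of `y` away
  have hibp : ∫ x in N..2 * N, (κ x : ℂ) * W x =
      -∫ x in N..2 * N, y x * ((κ' x : ℂ) * w x + 2 * κ x * deriv w x) := by
    have hder : ∀ x ∈ uIcc N (2 * N), HasDerivAt (fun x => y x * ((κ x : ℂ) * w x))
        (deriv y x * ((κ x : ℂ) * w x) + y x * ((κ' x : ℂ) * w x + κ x * deriv w x)) x := fun x hx =>
      (hy.1 x (hsub hx)).hasDerivAt.mul ((hd x).ofReal_comp.mul (hw.1 x (hsub hx)).hasDerivAt)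
    have hci : IntervalIntegrable (fun x => deriv y x * ((κ x : ℂ) * w x) +
        y x * ((κ' x : ℂ) * w x + κ x * deriv w x)) volume N (2 * N) := by
      refine ContinuousOn.intervalIntegrable ?_
      have := (cof hκc).continuousOn (s := uIcc N (2 * N))
      have := (cof hκc').continuousOn (s := uIcc N (2 * N))
      fun_prop
    have h := intervalIntegral.integral_eq_sub_of_hasDerivAt hder hci
    have e : κ N = 0 := by simp [hκ]
    have e' : κ (2 * N) = 0 := by simp [hκ]
    rw [e, e'] at h
    have i1 : IntervalIntegrable (fun x => (κ x : ℂ) * W x) volume N (2 * N) :=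
      ((cof hκc).continuousOn.mul hWc).intervalIntegrable
    have i2 : IntervalIntegrable (fun x => y x * ((κ' x : ℂ) * w x + 2 * κ x * deriv w x))
        volume N (2 * N) := by
      refine ContinuousOn.intervalIntegrable ?_
      have := (cof hκc).continuousOn (s := uIcc N (2 * N))
      have := (cof hκc').continuousOn (s := uIcc N (2 * N))
      fun_prop
    have hsum := intervalIntegral.integral_add i1 i2
    have : ∀ x, (κ x : ℂ) * W x + y x * ((κ' x : ℂ) * w x + 2 * κ x * deriv w x) =
        deriv y x * ((κ x : ℂ) * w x) + y x * ((κ' x : ℂ) * w x + κ x * deriv w x) := fun x => by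
      simp only [hW]; ring
    simp_rw [this] at hsum
    rw [h] at hsum
    simp only [Complex.ofReal_zero, zero_mul, mul_zero, sub_zero] at hsum
    linear_combination -hsum
  have hbound : ‖∫ x in N..2 * N, (κ x : ℂ) * W x‖ ≤
      (N * c₀ + 2 * N ^ 2 * c₁) * ∫ x in N..2 * N, ‖y x‖ := by
    rw [hibp, norm_neg, ← intervalIntegral.integral_const_mul]
    refine intervalIntegral.norm_integral_le_of_norm_le hle (Eventually.of_forall fun x hx => ?_)
      ((hyc.norm.intervalIntegrable).const_mul _)
    have hx' := Ioc_subset_Icc_self hx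
    rw [norm_mul, mul_comm]
    refine mul_le_mul_of_nonneg_right ?_ (norm_nonneg _)
    have b0 := h0 x hx'
    have b1 := h1 x hx'
    have n0 : ‖(κ' x : ℂ)‖ ≤ N := by
      rw [Complex.norm_real, Real.norm_eq_abs, abs_le]
      constructor <;> simp only [hκ'] <;> linarith [hx'.1, hx'.2]
    have n1 : ‖(κ x : ℂ)‖ ≤ N ^ 2 := by
      rw [Complex.norm_real, Real.norm_of_nonneg (mul_nonneg (by linarith [hx'.1])
        (by linarith [hx'.2]))]
      nlinarith [hx'.1, hx'.2]
    refine (norm_add_le _ _).trans (add_le_add ?_ ?_)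
    · rw [norm_mul]
      exact mul_le_mul n0 b0 (norm_nonneg _) hN.le
    · rw [norm_mul, norm_mul, Complex.norm_ofNat]
      have := norm_nonneg (deriv w x)
      gcongr
  by_contra! hcon
  set c := (6 * c₀ / N ^ 2 + 12 * c₁ / N) * ∫ x in N..2 * N, ‖y x‖ with hc
  have hint : ∫ x in N..2 * N, κ x = N ^ 3 / 6 := by
    have hF : ∀ x ∈ uIcc N (2 * N), HasDerivAt
        (fun x => 3 * N / 2 * x ^ 2 - 2 * N ^ 2 * x - x ^ 3 / 3) (κ x) x := fun x _ => by
      have := ((((hasDerivAt_id x).pow 2).const_mul (3 * N / 2)).sub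
        ((hasDerivAt_id x).const_mul (2 * N ^ 2))).sub (((hasDerivAt_id x).pow 3).div_const 3)
      refine this.congr_deriv ?_
      simp [hκ]; ring
    rw [intervalIntegral.integral_eq_sub_of_hasDerivAt hF (hκc.intervalIntegrable _ _)]
    ring
  have hlt : ∫ x in N..2 * N, κ x * c < ∫ x in N..2 * N, κ x * (W x).re := by
    refine intervalIntegral.integral_lt_integral_of_continuousOn_of_le_of_exists_lt (by linarith)
      (by fun_prop) ?_ (fun x hx => ?_) ⟨3 * N / 2, ⟨by linarith, by linarith⟩, ?_⟩
    · rw [← uIcc_of_le hle]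
      exact hκc.continuousOn.mul (Complex.continuous_re.comp_continuousOn hWc)
    · exact mul_le_mul_of_nonneg_left (hcon x (Ioc_subset_Icc_self hx)).le
        (mul_nonneg (by linarith [hx.1]) (by linarith [hx.2]))
    · refine mul_lt_mul_of_pos_left (hcon _ ⟨by linarith, by linarith⟩) ?_
      simp only [hκ]
      exact mul_pos (by linarith) (by linarith)
  rw [intervalIntegral.integral_mul_const, hint] at hlt
  have hre : ∫ x in N..2 * N, κ x * (W x).re = (∫ x in N..2 * N, (κ x : ℂ) * W x).re := by
    have i1 : IntervalIntegrable (fun x => (κ x : ℂ) * W x) volume N (2 * N) :=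
      ((cof hκc).continuousOn.mul hWc).intervalIntegrable
    have := Complex.reCLM.intervalIntegral_comp_comm i1
    simp only [Complex.reCLM_apply, Complex.re_ofReal_mul] at this
    exact this
  rw [hre] at hlt
  have := (Complex.re_le_norm _).trans hbound
  have e : N ^ 3 / 6 * c = (N * c₀ + 2 * N ^ 2 * c₁) * ∫ x in N..2 * N, ‖y x‖ := by
    rw [hc]; field_simp; ring
  linarith

end HalfLine

namespace HalfLine

variable {k : ℂ} {V a b : ℝ → ℂ}

/-- The source is a sum of an L² part, for which the exponential decay of the kernel is needed, and
an L¹ part, for which its boundedness suffices. -/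
theorem norm_integral_kernel_mul_le {η : ℝ} (hη : 0 < η) (f : L2) {g G : ℝ → ℂ}
    (hg : Integrable g μ) {x A : ℝ} (hA : 0 ≤ A)
    (hG : ∀ y, 0 < y → ‖G y‖ ≤ A * Real.exp (-(η * |x - y|))) :
    ‖∫ y, G y * (f y - g y) ∂μ‖ ≤ A * ((∫ y, ‖f y‖ ^ 2 ∂μ) + 2 / η + ∫ y, ‖g y‖ ∂μ) := by
  have hi := (integrable_exp_mul_norm hη f x).add hg.norm
  refine (norm_integral_le_of_norm_le (hi.const_mul A) ?_).trans ?_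
  · filter_upwards [ae_mu_pos] with y hy
    have h1 : Real.exp (-(η * |x - y|)) ≤ 1 := by
      rw [Real.exp_le_one_iff]
      have := mul_nonneg hη.le (abs_nonneg (x - y))
      linarith
    rw [norm_mul, Pi.add_apply]
    calc _ ≤ A * Real.exp (-(η * |x - y|)) * (‖f y‖ + ‖g y‖) :=
          mul_le_mul (hG y hy) (norm_sub_le _ _) (norm_nonneg _) (by positivity)
      _ = A * (Real.exp (-(η * |x - y|)) * ‖f y‖ + Real.exp (-(η * |x - y|)) * ‖g y‖) := by ring
      _ ≤ _ := by
          gcongr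
          exact mul_le_of_le_one_left (norm_nonneg _) h1
  · rw [integral_const_mul, integral_add' (integrable_exp_mul_norm hη f x) hg.norm]
    have := integral_exp_mul_norm_le hη f x
    gcongr

namespace Factorization

/-- A priori only √y b v is integrable, which suffices away from 0. Near 0, `green_bootstrap` with
ρ(x) = x improves the bound on w = R_V f to a multiple of x, so b v = V w is dominated by a multiple
of y|V(y)|. -/
theorem integrable_mul_weightedResolvent (F : Factorization V a b) (hk : 0 < k.im)
    (hu : IsUnit (1 + bsOp a b k)) (f : L2) :
    Integrable (fun y => b y * weightedResolvent a b k f y) μ := by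
  set v := weightedResolvent a b k f with hv
  set w := resolventFun a b k f with hw
  obtain ⟨δ, hδ0, hδ⟩ : ∃ δ : ℝ, 0 < δ ∧ ∫ y in Ioo 0 δ, y * ‖V y‖ ∂μ ≤ 1 / 2 := by
    have h := tendsto_setIntegral_zero_of_eventually_notMem (l := 𝓝[>] (0 : ℝ))
      (B := fun δ : ℝ => Ioo 0 δ) (fun _ => measurableSet_Ioo) F.integrable (by
        filter_upwards [ae_mu_pos] with y hy
        filter_upwards [Ioo_mem_nhdsGT hy] with δ hδ h'
        exact lt_asymm h'.2 hδ.2)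
    obtain ⟨δ, h1, h2⟩ := ((h.eventually (ge_mem_nhds (by norm_num : (0 : ℝ) < 1 / 2))).and
      self_mem_nhdsWithin).exists
    exact ⟨δ, h2, h1⟩
  have hbv := F.integrable_sqrt v
  have hm := F.measurable_mul v
  have hout : IntegrableOn (fun y => b y * v y) (Ioo 0 δ)ᶜ μ := by
    refine (hbv.const_mul (√δ)⁻¹).integrableOn.mono' hm.restrict ?_
    filter_upwards [ae_restrict_mem measurableSet_Ioo.compl, ae_restrict_of_ae ae_mu_pos]
      with y hy hy0
    have hδy : δ ≤ y := by
      by_contra hlt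
      exact hy ⟨hy0, not_le.1 hlt⟩
    have h1 : √δ ≤ √y := Real.sqrt_le_sqrt hδy
    have h2 : 0 < √δ := Real.sqrt_pos.2 hδ0
    rw [← mul_assoc]
    refine le_mul_of_one_le_left (norm_nonneg _) ?_
    rw [inv_mul_eq_div, le_div_iff₀ h2]
    linarith
  set Mf := (∫ y, ‖f y‖ ^ 2 ∂μ) + 2 / k.im with hMf
  have hMf0 : 0 ≤ Mf := by positivity
  have hfree : ∀ x, 0 < x → ‖greenOp k f x‖ ≤ x * Mf := by
    intro x hx
    have h := norm_integral_kernel_mul_le hk f (g := fun _ => 0) (G := green k x)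
      (integrable_zero _ _ _) (A := x) (x := x) hx.le (fun y hy =>
        (norm_green_le hk.le hx.le hy.le).trans
          (mul_le_mul_of_nonneg_right (min_le_left _ _) (Real.exp_pos _).le))
    simpa [greenOp] using h
  have hwx : ∀ x, 0 < x → ‖w x‖ ≤ ‖greenOp k f x‖ + ‖greenOp k (fun y => b y * v y) x‖ := by
    intro x hx
    rw [hw, resolventFun, greenOp_sub hk.le (greenIntegrable_Lp hk f)
      (F.greenIntegrable hk.le v) hx.le]
    exact norm_sub_le _ _
  have hVw := F.mul_resolventFun hk hu f
  set c := Mf + ∫ y in (Ioo 0 δ)ᶜ, ‖b y * v y‖ ∂μ with hc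
  have hc0 : 0 ≤ c := by positivity
  have key := green_bootstrap (S := Ioo 0 δ) (u := w) (ρ := fun x => x) hk.le F.integrable
    measurableSet_Ioo (fun x hx => hx.1) hδ (fun x hx => hx.1.le)
    (fun x hx y hy => by
      have := (norm_green_le_min hk.le hx.1.le hy.1.le).trans (min_le_left _ _)
      rw [mul_comm]
      exact mul_le_mul_of_nonneg_left this hy.1.le)
    (c := c) (C := √δ * Mf + ∫ y, √y * ‖b y * v y‖ ∂μ) hc0
    (fun x hx => by
      refine (hwx x hx.1).trans ?_
      rw [add_mul]
      refine add_le_add ((hfree x hx.1).trans ?_) (norm_greenOp_le_sqrt hk.le hbv hx.1.le)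
      have h1 : √x ≤ √δ := Real.sqrt_le_sqrt hx.2.le
      have h2 := Real.mul_self_sqrt hx.1.le
      have h3 := Real.sqrt_nonneg x
      calc x * Mf = √x * Mf * √x := by linear_combination -Mf * h2
        _ ≤ _ := by gcongr)
    (fun x hx => by
      refine (hwx x hx.1).trans ?_
      rw [hc, add_mul, add_assoc, mul_comm Mf]
      refine add_le_add (hfree x hx.1) ?_
      have hgi : Integrable (fun y => ‖green k x y‖ * ‖b y * v y‖) μ := by
        refine ((F.greenIntegrable hk.le v).integrable hk.le hx.1.le).norm.congr
          (Eventually.of_forall fun y => ?_)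
        simp only [norm_mul]
      have e1 : ‖greenOp k (fun y => b y * v y) x‖ ≤ ∫ y, ‖green k x y‖ * ‖b y * v y‖ ∂μ := by
        refine norm_integral_le_of_norm_le hgi (Eventually.of_forall fun y => ?_)
        rw [norm_mul]
      rw [← integral_add_compl (μ := μ) (measurableSet_Ioo (a := 0) (b := δ)) hgi, add_comm] at e1
      refine e1.trans (add_le_add ?_ ?_)
      · rw [← integral_mul_const]
        refine integral_mono_ae hgi.integrableOn (hout.norm.mul_const x) ?_
        filter_upwards [ae_restrict_of_ae ae_mu_pos] with y hy
        rw [mul_comm]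
        exact mul_le_mul_of_nonneg_left
          ((norm_green_le_min hk.le hx.1.le hy.le).trans (min_le_left _ _)) (norm_nonneg _)
      · refine le_of_eq (integral_congr_ae ?_)
        filter_upwards [ae_restrict_of_ae hVw] with y hy
        rw [hy])
  have hin : IntegrableOn (fun y => b y * v y) (Ioo 0 δ) μ := by
    refine (F.integrable.const_mul (2 * c)).integrableOn.mono' hm.restrict ?_
    filter_upwards [ae_restrict_of_ae hVw, ae_restrict_mem measurableSet_Ioo] with y hy hyS
    rw [← hy, norm_mul]
    calc _ ≤ ‖V y‖ * (2 * c * y) := by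
          gcongr
          exact key y hyS
      _ = _ := by ring
  rw [← integrableOn_univ, ← union_compl_self (Ioo 0 δ)]
  exact hin.union hout

/-- Once the source is known to lie in L² + L¹, the three bounds follow from the kernel bounds with
prefactors x, |k|⁻¹ and 1 + |k|. -/
theorem exists_norm_resolventFun_le (F : Factorization V a b) (hk : 0 < k.im)
    (hu : IsUnit (1 + bsOp a b k)) (f : L2) :
    ∃ M, 0 ≤ M ∧ ∀ x, 0 < x → ‖resolventFun a b k f x‖ ≤ M * x ∧ ‖resolventFun a b k f x‖ ≤ M ∧
      ‖deriv (resolventFun a b k f) x‖ ≤ M := by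
  have hg := F.integrable_mul_weightedResolvent hk hu f
  set M₀ := (∫ y, ‖f y‖ ^ 2 ∂μ) + 2 / k.im + ∫ y, ‖b y * weightedResolvent a b k f y‖ ∂μ with hM₀
  have h0 : 0 ≤ M₀ := by positivity
  refine ⟨(1 + ‖k‖⁻¹ + (1 + ‖k‖)) * M₀, by positivity, fun x hx => ⟨?_, ?_, ?_⟩⟩
  · refine (norm_integral_kernel_mul_le hk f hg (G := green k x) (x := x) hx.le (fun y hy =>
      (norm_green_le hk.le hx.le hy.le).trans
        (mul_le_mul_of_nonneg_right (min_le_left _ _) (Real.exp_pos _).le))).trans ?_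
    rw [← hM₀, mul_comm x]
    refine mul_le_mul_of_nonneg_right ?_ hx.le
    refine le_mul_of_one_le_left h0 ?_
    have := norm_nonneg k
    have : 0 ≤ ‖k‖⁻¹ := by positivity
    linarith
  · refine (norm_integral_kernel_mul_le hk f hg (G := green k x) (x := x) (A := ‖k‖⁻¹)
      (by positivity) (fun y hy =>
        norm_green_le_inv hk.le (ne_zero_of_im_pos hk) hx.le hy.le)).trans ?_
    refine mul_le_mul_of_nonneg_right ?_ h0
    have := norm_nonneg k
    linarith
  · rw [resolventFun, (hasDerivAt_greenOp hk.le (F.greenIntegrable_sub hk f _) hx).deriv]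
    refine (norm_integral_kernel_mul_le hk f hg (G := greenDeriv k x) (x := x) (A := 1 + ‖k‖)
      (by positivity) (fun y hy => norm_greenDeriv_le hk.le hx.le hy.le)).trans ?_
    refine mul_le_mul_of_nonneg_right ?_ h0
    have : 0 ≤ ‖k‖⁻¹ := by positivity
    linarith

/-- A square integrable solution of `-y'' + V y = k² y` vanishing at `0` is zero. -/
theorem eq_zero_of_schrodingerRel (F : Factorization V a b) (hk : 0 < k.im)
    (hu : IsUnit (1 + bsOp a b k)) {d : L2} (hd : SchrodingerRel V d (k ^ 2 • d)) : d = 0 := by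
  obtain ⟨y, hdy, hy0, hy⟩ := hd
  have hcd := Lp.coeFn_star d
  -- Duality replaces self-adjointness: with w the resolvent solution for the source conj y, the
  -- potential terms cancel in y'' w - w'' y, leaving |y|².
  set f : L2 := star d with hf
  obtain ⟨M, hM0, hM⟩ := F.exists_norm_resolventFun_le hk hu f
  have hw := F.hasSecondDeriv_resolventFun hk hu f
  set w := resolventFun a b k f with hwdef
  have hy2 : MemLp y 2 μ := (Lp.memLp d).ae_eq hdy
  have hyi : Integrable (fun x => ‖y x‖ ^ 2) μ := (memLp_two_iff_integrable_sq_norm hy2.1).1 hy2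
  have hyc : ContinuousOn y (Ioi 0) := hy.continuousOn
  have hyI : ∀ s t : ℝ, 0 < s → 0 < t → ContinuousOn y (uIcc s t) := fun s t hs ht =>
    hyc.mono fun x hx => (lt_min hs ht).trans_le hx.1
  -- the Wronskian identity
  have hLag : ∀ s t, 0 < s → s ≤ t → ((∫ x in s..t, ‖y x‖ ^ 2 : ℝ) : ℂ) =
      (deriv y t * w t - deriv w t * y t) - (deriv y s * w s - deriv w s * y s) := by
    intro s t hs hst
    rw [← hy.lagrange hw hs hst, ← intervalIntegral.integral_ofReal]
    have hsub : Ι s t ⊆ Ioi (0 : ℝ) := fun x hx => by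
      rw [uIoc_of_le hst] at hx; exact hs.trans hx.1
    refine intervalIntegral.integral_congr_ae_restrict
      (ae_restrict_of_ae_restrict_of_subset hsub ?_)
    filter_upwards [hdy, hcd, Lp.coeFn_smul (k ^ 2) d] with x h1 h2 h3
    rw [h3, Pi.smul_apply, h2, Pi.star_apply, h1, smul_eq_mul]
    have : (starRingEnd ℂ) (y x) * y x = ((‖y x‖ ^ 2 : ℝ) : ℂ) := by
      rw [mul_comm, Complex.mul_conj, Complex.normSq_eq_norm_sq]
    rw [← this]
    change _ = _ - ((V x - k ^ 2) * w x - (starRingEnd ℂ) (y x)) * y x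
    ring
  have hwneg : HasSecondDeriv (-w) (-fun x => (V x - k ^ 2) * w x - f x) := by
    have := hw.const_smul (-1)
    simpa only [neg_smul, one_smul] using this
  have hdn : ∀ x, deriv (-w) x = -deriv w x := fun x => by
    rw [← deriv.fun_neg]; rfl
  -- At infinity y is only square integrable, so ∫ |y| over [N, 2N] is O(√N); the prefactor 18M/N
  -- makes the Wronskian O(N^(-1/2)) at some point.
  have habove : ∀ N, 1 ≤ N → ∃ X ∈ Icc N (2 * N), (deriv y X * w X - deriv w X * y X).re ≤
      (9 * M) * ((∫ x, ‖y x‖ ^ 2 ∂μ) * (√N)⁻¹ + (√N)⁻¹) * 2 := by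
    intro N hN
    have hN0 : 0 < N := by linarith
    obtain ⟨X, hX, hX2⟩ := hy.exists_re_wronskian_le hw hN0
      (fun x hx => (hM x (hN0.trans_le hx.1)).2.1) (fun x hx => (hM x (hN0.trans_le hx.1)).2.2)
    refine ⟨X, hX, hX2.trans ?_⟩
    have hle : N ≤ 2 * N := by linarith
    have hs0 : 0 < √N := Real.sqrt_pos.2 hN0
    have hss : √N * √N = N := Real.mul_self_sqrt hN0.le
    have hI : ∫ x in N..2 * N, ‖y x‖ ≤ √N * (∫ x, ‖y x‖ ^ 2 ∂μ) + √N := by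
      have i1 : IntervalIntegrable (fun x => ‖y x‖ ^ 2) volume N (2 * N) :=
        ((hyI N (2 * N) hN0 (by linarith)).norm.pow 2).intervalIntegrable
      calc ∫ x in N..2 * N, ‖y x‖ ≤ ∫ x in N..2 * N, (√N * ‖y x‖ ^ 2 + (√N)⁻¹) := by
            refine intervalIntegral.integral_mono_on hle
              (hyI N (2 * N) hN0 (by linarith)).norm.intervalIntegrable
              ((i1.const_mul _).add intervalIntegrable_const) fun x _ => ?_
            rw [← sub_nonneg]
            have : √N * ‖y x‖ ^ 2 + (√N)⁻¹ - ‖y x‖ =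
                (√N)⁻¹ * ((√N * ‖y x‖ - 1 / 2) ^ 2 + 3 / 4) := by
              field_simp; ring
            rw [this]
            positivity
        _ = √N * (∫ x in N..2 * N, ‖y x‖ ^ 2) + N * (√N)⁻¹ := by
            rw [intervalIntegral.integral_add (i1.const_mul _) intervalIntegrable_const,
              intervalIntegral.integral_const_mul, intervalIntegral.integral_const, smul_eq_mul]
            ring
        _ ≤ _ := by
            refine add_le_add (mul_le_mul_of_nonneg_left ?_ hs0.le) ?_
            · rw [intervalIntegral.integral_of_le hle]
              refine setIntegral_mono_set hyi (Eventually.of_forall fun x => by positivity) ?_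
              exact Eventually.of_forall fun x hx => hN0.trans hx.1
            · rw [← div_eq_mul_inv, div_le_iff₀ hs0, hss]
    have hy2i : 0 ≤ ∫ x, ‖y x‖ ^ 2 ∂μ := integral_nonneg fun x => by positivity
    have hc1 : 6 * M / N ^ 2 + 12 * M / N ≤ 18 * M / N := by
      have : 6 * M / N ^ 2 ≤ 6 * M / N := by
        gcongr
        nlinarith
      calc _ ≤ 6 * M / N + 12 * M / N := by linarith
        _ = _ := by ring
    calc _ ≤ 18 * M / N * (√N * (∫ x, ‖y x‖ ^ 2 ∂μ) + √N) := by
          refine mul_le_mul hc1 hI ?_ (by positivity)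
          exact intervalIntegral.integral_nonneg hle fun x _ => norm_nonneg _
      _ = _ := by
          have : √N / N = (√N)⁻¹ := by
            rw [div_eq_iff hN0.ne', eq_comm, inv_mul_eq_div, div_eq_iff hs0.ne', hss]
          rw [← this]; ring
  -- Near 0 the same averaging is applied to -w. The bound |w| ≤ 2MN on [N, 2N] cancels the singular
  -- prefactors, and the smallness comes from y(0+) = 0.
  have hbelow : ∀ N m, 0 < N → (∀ x ∈ Icc N (2 * N), ‖y x‖ ≤ m) → ∃ X ∈ Icc N (2 * N),
      -(deriv y X * w X - deriv w X * y X).re ≤ 24 * M * m := by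
    intro N m hN hm
    have hle : N ≤ 2 * N := by linarith
    obtain ⟨X, hX, hX2⟩ := hy.exists_re_wronskian_le hwneg hN (c₀ := M * (2 * N)) (c₁ := M)
      (fun x hx => by
        rw [Pi.neg_apply, norm_neg]
        exact (hM x (hN.trans_le hx.1)).1.trans (mul_le_mul_of_nonneg_left hx.2 hM0))
      (fun x hx => by
        rw [hdn, norm_neg]
        exact (hM x (hN.trans_le hx.1)).2.2)
    refine ⟨X, hX, ?_⟩
    have e : (deriv y X * (-w) X - deriv (-w) X * y X) =
        -(deriv y X * w X - deriv w X * y X) := by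
      rw [hdn, Pi.neg_apply]; ring
    rw [e, Complex.neg_re] at hX2
    refine hX2.trans ?_
    have hI : ∫ x in N..2 * N, ‖y x‖ ≤ N * m := by
      have := intervalIntegral.integral_mono_on (μ := volume) (g := fun _ => m) hle
        (hyI N (2 * N) hN (by linarith)).norm.intervalIntegrable intervalIntegrable_const hm
      rw [intervalIntegral.integral_const, smul_eq_mul] at this
      linarith
    calc _ ≤ (6 * (M * (2 * N)) / N ^ 2 + 12 * M / N) * (N * m) :=
          mul_le_mul_of_nonneg_left hI (by positivity)
      _ = _ := by field_simp; ring
  have hzero : ∀ s t, 0 < s → s ≤ t → ∫ x in s..t, ‖y x‖ ^ 2 ≤ 0 := by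
    intro s t hs hst
    refine le_of_forall_pos_le_add fun ε hε => ?_
    rw [zero_add]
    -- Chosen so that 24 M times this number is at most ε/2; the other ε/2 comes from the point near
    -- infinity.
    have hε' : 0 < ε / (48 * (M + 1)) := by positivity
    have hnear : ∀ᶠ x in 𝓝[>] (0 : ℝ), ‖y x‖ < ε / (48 * (M + 1)) := by
      have := hy0.norm
      rw [norm_zero] at this
      exact this.eventually (gt_mem_nhds hε')
    obtain ⟨ρ, hρ0, hρ⟩ := mem_nhdsGT_iff_exists_Ioo_subset.1 hnear
    have hρ0' : 0 < ρ := hρ0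
    set n := min (ρ / 4) (s / 2) with hn
    have hn0 : 0 < n := lt_min (by linarith) (by linarith)
    obtain ⟨X, hX, hXb⟩ := hbelow n _ hn0 fun x hx =>
      le_of_lt (hρ ⟨hn0.trans_le hx.1, hx.2.trans_lt (by
        have := min_le_left (ρ / 4) (s / 2); linarith)⟩)
    have hlim : Tendsto (fun N : ℝ => (9 * M) * ((∫ x, ‖y x‖ ^ 2 ∂μ) * (√N)⁻¹ + (√N)⁻¹) * 2)
        atTop (𝓝 ((9 * M) * ((∫ x, ‖y x‖ ^ 2 ∂μ) * 0 + 0) * 2)) := by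
      have h1 : Tendsto (fun N : ℝ => (√N)⁻¹) atTop (𝓝 0) :=
        tendsto_inv_atTop_zero.comp Real.tendsto_sqrt_atTop
      exact (((h1.const_mul _).add h1).const_mul _).mul_const _
    simp only [mul_zero, add_zero, zero_mul] at hlim
    obtain ⟨N, hN1, hN2, hN3⟩ := ((hlim.eventually (gt_mem_nhds (half_pos hε))).and
      ((eventually_ge_atTop 1).and (eventually_ge_atTop t))).exists
    obtain ⟨Z, hZ, hZb⟩ := habove N hN2
    have hX0 : 0 < X := hn0.trans_le hX.1
    have hXs : X ≤ s := by
      have := min_le_right (ρ / 4) (s / 2)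
      linarith [hX.2]
    have htZ : t ≤ Z := hN3.trans hZ.1
    have h := congrArg Complex.re (hLag X Z hX0 (hXs.trans (hst.trans htZ)))
    rw [Complex.ofReal_re, Complex.sub_re] at h
    have hi : IntervalIntegrable (fun x => ‖y x‖ ^ 2) volume X Z :=
      ((hyI X Z hX0 (by linarith)).norm.pow 2).intervalIntegrable
    have hmono : ∫ x in s..t, ‖y x‖ ^ 2 ≤ ∫ x in X..Z, ‖y x‖ ^ 2 :=
      intervalIntegral.integral_mono_interval hXs hst htZ
        (Eventually.of_forall fun x => by positivity) hi
    have h24 : 24 * M * (ε / (48 * (M + 1))) ≤ ε / 2 := by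
      rw [← mul_div_assoc, div_le_div_iff₀ (by positivity) (by positivity)]
      nlinarith
    linarith
  have hyz : ∀ x, 0 < x → y x = 0 := by
    intro x hx
    by_contra hne
    have hpos := intervalIntegral.integral_pos (f := fun t => ‖y t‖ ^ 2) (a := x) (b := x + 1)
      (by linarith)
      (by
        have := (hyI x (x + 1) hx (by linarith)).norm.pow 2
        rwa [uIcc_of_le (by linarith)] at this)
      (fun t _ => by positivity)
      ⟨x, ⟨le_rfl, by linarith⟩, by have := norm_pos_iff.2 hne; positivity⟩
    exact absurd (hzero x (x + 1) hx (by linarith)) (not_le.2 hpos)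
  refine Lp.ext (hdy.trans ?_)
  filter_upwards [ae_mu_pos, Lp.coeFn_zero ℂ 2 μ] with x hx hx'
  rw [hx', hyz x hx]
  rfl

end Factorization

end HalfLine

/-! ### Resolvent identities and analyticity. -/

section UnboundedOperators

variable {H : Type*} [NormedAddCommGroup H] [InnerProductSpace ℂ H]

/-- The first resolvent identity. -/
theorem LinearPMap.IsResolventAt.apply_eq {L : H →ₗ.[ℂ] H} {z w : ℂ} {R S : H →L[ℂ] H}
    (hR : L.IsResolventAt z R) (hS : L.IsResolventAt w S) (φ : H) :
    R φ = S (φ + (z - w) • R φ) := by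
  obtain ⟨h, hf⟩ := hR.1 φ
  have h2 := hS.2 ⟨R φ, h⟩
  rw [sub_eq_iff_eq_add] at hf
  rw [hf] at h2
  refine h2.symm.trans (congrArg S ?_)
  module

/-- When |z - w| ‖(L - w)⁻¹‖ ≤ 1/2, the first resolvent identity bounds ‖(L - z)⁻¹φ‖ by 2‖(L -
w)⁻¹φ‖, and then bounds the difference by a multiple of |z - w|. -/
theorem LinearPMap.tendsto_resolvent {L : H →ₗ.[ℂ] H} {w : ℂ}
    (h : ∀ᶠ z in 𝓝 w, z ∈ L.resolventSet) (φ : H) :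
    Tendsto (fun z => L.resolvent z φ) (𝓝 w) (𝓝 (L.resolvent w φ)) := by
  have hS := LinearPMap.isResolventAt_resolvent h.self_of_nhds
  set S := L.resolvent w
  have hz : Tendsto (fun z => ‖z - w‖) (𝓝 w) (𝓝 0) := by
    have : Continuous fun z : ℂ => ‖z - w‖ := by fun_prop
    simpa using this.tendsto w
  have hsmall : ∀ᶠ z in 𝓝 w, ‖z - w‖ < 1 / (2 * (‖S‖ + 1)) :=
    hz.eventually (gt_mem_nhds (by positivity))
  rw [tendsto_iff_norm_sub_tendsto_zero]
  refine squeeze_zero' (Eventually.of_forall fun _ => norm_nonneg _) ?_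
    (g := fun z => ‖z - w‖ * (‖S‖ * (2 * ‖S φ‖))) (by simpa using hz.mul_const (‖S‖ * (2 * ‖S φ‖)))
  filter_upwards [h, hsmall] with z hz1 hz2
  have hR := LinearPMap.isResolventAt_resolvent hz1
  set R := L.resolvent z
  have e := hR.apply_eq hS φ
  rw [S.map_add, S.map_smul] at e
  have h1 : ‖R φ - S φ‖ ≤ ‖z - w‖ * (‖S‖ * ‖R φ‖) := by
    nth_rw 1 [e]
    rw [add_sub_cancel_left, norm_smul]
    exact mul_le_mul_of_nonneg_left (S.le_opNorm _) (norm_nonneg _)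
  have h2 : ‖R φ‖ ≤ ‖S φ‖ + ‖R φ - S φ‖ := norm_le_norm_add_norm_sub' _ _
  have h3 : ‖z - w‖ * ‖S‖ ≤ 1 / 2 := by
    rw [lt_div_iff₀ (by positivity)] at hz2
    nlinarith [norm_nonneg (z - w)]
  have h4 : ‖R φ‖ ≤ 2 * ‖S φ‖ := by
    have := mul_le_mul_of_nonneg_right h3 (norm_nonneg (R φ))
    nlinarith
  refine h1.trans ?_
  gcongr

/-- If `A (L - w)⁻¹` is bounded then `A (L - z)⁻¹ φ` is differentiable at `w`. -/
theorem LinearPMap.differentiableAt_compResolvent {A L : H →ₗ.[ℂ] H} {w : ℂ} {T : H →L[ℂ] H}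
    (h : ∀ᶠ z in 𝓝 w, z ∈ L.resolventSet) (hd : ∀ φ, L.resolvent w φ ∈ A.domain)
    (hT : ∀ φ, A.compResolvent L φ w = T φ) (φ : H) :
    DifferentiableAt ℂ (A.compResolvent L φ) w := by
  have hS := LinearPMap.isResolventAt_resolvent h.self_of_nhds
  -- All dependence on z is moved inside the fixed bounded operator T, so the difference quotient is
  -- T(L - z)⁻¹φ and strong continuity of the resolvent is enough.
  have key : ∀ᶠ z in 𝓝 w, A.compResolvent L φ z = T (φ + (z - w) • L.resolvent z φ) := by
    filter_upwards [h] with z hz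
    have e := (LinearPMap.isResolventAt_resolvent hz).apply_eq hS φ
    have hdz : L.resolvent z φ ∈ A.domain := by rw [e]; exact hd _
    rw [← hT, LinearPMap.compResolvent, LinearPMap.compResolvent, dif_pos hdz, dif_pos (hd _)]
    congr 1
    exact Subtype.ext e
  have hlim : Tendsto (fun z => T (L.resolvent z φ)) (𝓝[≠] w) (𝓝 (T (L.resolvent w φ))) :=
    ((T.continuous.tendsto _).comp (LinearPMap.tendsto_resolvent h φ)).mono_left
      nhdsWithin_le_nhds
  refine (hasDerivAt_iff_tendsto_slope.2 (hlim.congr' ?_)).differentiableAt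
  filter_upwards [self_mem_nhdsWithin, key.filter_mono nhdsWithin_le_nhds] with z hz hz'
  have hne : z - w ≠ 0 := sub_ne_zero.2 hz
  rw [slope_def_module, hz', hT, T.map_add, T.map_smul, add_sub_cancel_left, smul_smul,
    inv_mul_cancel₀ hne, one_smul]

end UnboundedOperators

/-! ### Identification of the resolvent of the Schrödinger operator. -/

namespace HalfLine

namespace Factorization

variable {k : ℂ} {V a b : ℝ → ℂ}

/-- The right inverse property is the differential equation for `resolventFun`. For the left
inverse, u - R(L - k²)u is a square integrable homogeneous solution vanishing at 0, hence zero. -/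
theorem isResolventAt_perturbedResolvent (F : Factorization V a b) (hk : 0 < k.im)
    (hu : IsUnit (1 + bsOp a b k)) :
    (schrodingerOp V).IsResolventAt (k ^ 2) (perturbedResolvent a b k) := by
  set R := perturbedResolvent a b k
  have hmem : ∀ f, (R f, f + k ^ 2 • R f) ∈ schrodingerGraph V := fun f =>
    F.schrodingerRel_perturbedResolvent hk hu f
  refine ⟨fun f => ?_, fun u => ?_⟩
  · have h := hmem f
    rw [← schrodingerOp_graph, LinearPMap.mem_graph_iff] at h
    obtain ⟨y, hy1, hy2⟩ := h
    simp only at hy1 hy2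
    refine ⟨hy1 ▸ y.2, ?_⟩
    have : (⟨R f, hy1 ▸ y.2⟩ : (schrodingerOp V).domain) = y := Subtype.ext hy1.symm
    rw [this, hy2, add_sub_cancel_right]
  · set h := schrodingerOp V u - k ^ 2 • (u : L2) with hh
    have h1 : ((u : L2), schrodingerOp V u) ∈ schrodingerGraph V := by
      rw [← schrodingerOp_graph]
      exact LinearPMap.mem_graph _ u
    have h2 := Submodule.sub_mem _ h1 (hmem h)
    have h3 : ((u : L2), schrodingerOp V u) - (R h, h + k ^ 2 • R h) =
        ((u : L2) - R h, k ^ 2 • ((u : L2) - R h)) := by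
      refine Prod.ext rfl ?_
      simp only [Prod.mk_sub_mk, hh]
      module
    rw [h3] at h2
    exact (sub_eq_zero.1 (F.eq_zero_of_schrodingerRel hk hu h2)).symm

theorem resolvent_mem_domain (F : Factorization V a b) (hk : 0 < k.im)
    (hu : IsUnit (1 + bsOp a b k)) (φ : L2) :
    (schrodingerOp V).resolvent (k ^ 2) φ ∈ (mulOp a).domain ∧
      (mulOp a).compResolvent (schrodingerOp V) φ (k ^ 2) = weightedResolvent a b k φ := by
  have hR := F.isResolventAt_perturbedResolvent hk hu
  have e : (schrodingerOp V).resolvent (k ^ 2) = perturbedResolvent a b k :=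
    (LinearPMap.isResolventAt_resolvent ⟨_, hR⟩).unique hR
  have hae : (weightedResolvent a b k φ : ℝ → ℂ) =ᵐ[μ]
      fun x => a x * perturbedResolvent a b k φ x := by
    filter_upwards [F.weightedResolvent_apply hk hu φ, F.perturbedResolvent_apply hk φ]
      with x h1 h2
    rw [h1, h2]
  have hd : perturbedResolvent a b k φ ∈ (mulOp a).domain :=
    (Lp.memLp (weightedResolvent a b k φ)).ae_eq hae
  refine ⟨by rw [e]; exact hd, ?_⟩
  rw [← e] at hd
  rw [LinearPMap.compResolvent, dif_pos hd]
  refine Lp.ext ?_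
  rw [← e] at hae
  exact (MemLp.coeFn_toLp (show MemLp (fun x => a x * (schrodingerOp V).resolvent (k ^ 2) φ x) 2 μ
    from hd)).trans hae.symm

end Factorization

end HalfLine

/-! ### The free resolvent in the frequency variable. -/

namespace HalfLine

open FourierTransform

/-- The resolvent of the free Laplacian on the line in the frequency variable. -/
noncomputable def freqKernel (z : ℂ) (ξ : ℝ) : ℂ := (((4 * Real.pi ^ 2 * ξ ^ 2 : ℝ) : ℂ) - z)⁻¹

theorem continuous_freqKernel {z : ℂ} (hz : z.im ≠ 0) : Continuous (freqKernel z) :=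
  (continuous_ofReal_sub_inv hz).comp (by fun_prop : Continuous fun ξ : ℝ => 4 * Real.pi ^ 2 * ξ ^ 2)

theorem freqKernel_neg (z : ℂ) (ξ : ℝ) : freqKernel z (-ξ) = freqKernel z ξ := by
  rw [freqKernel, neg_sq, freqKernel]

theorem exists_norm_freqKernel_le {z : ℂ} (hz : z.im ≠ 0) :
    ∃ C, 0 ≤ C ∧ ∀ ξ, ‖freqKernel z ξ‖ ≤ C * (1 + ξ ^ 2)⁻¹ := by
  have hz' : 0 < |z.im| := abs_pos.2 hz
  refine ⟨1 + (1 + ‖z‖) / |z.im|, by positivity, fun ξ => ?_⟩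
  set l : ℝ := 4 * Real.pi ^ 2 * ξ ^ 2 with hl
  have hpi : 1 ≤ 4 * Real.pi ^ 2 := by nlinarith [Real.pi_gt_three]
  have h1 : ξ ^ 2 ≤ l := le_mul_of_one_le_left (sq_nonneg ξ) hpi
  have h2 : |z.im| ≤ ‖(l : ℂ) - z‖ := by
    have := Complex.abs_im_le_norm ((l : ℂ) - z)
    simpa using this
  have h3 : l ≤ ‖(l : ℂ) - z‖ + ‖z‖ := by
    have := norm_le_norm_add_norm_sub' (l : ℂ) z
    rw [Complex.norm_real] at this
    have := le_abs_self l
    rw [Real.norm_eq_abs] at *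
    linarith
  have h4 : (1 + ‖z‖) ≤ (1 + ‖z‖) / |z.im| * ‖(l : ℂ) - z‖ := by
    rw [div_mul_eq_mul_div, le_div_iff₀ hz']
    exact mul_le_mul_of_nonneg_left h2 (by positivity)
  rw [freqKernel, ← hl, norm_inv, ← div_eq_mul_inv, le_div_iff₀ (by positivity),
    inv_mul_le_iff₀ (hz'.trans_le h2)]
  linarith

theorem integrable_freqKernel {z : ℂ} (hz : z.im ≠ 0) : Integrable (freqKernel z) := by
  obtain ⟨C, -, hC⟩ := exists_norm_freqKernel_le hz
  exact (integrable_inv_one_add_sq.const_mul C).mono'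
    (continuous_freqKernel hz).aestronglyMeasurable (Eventually.of_forall hC)

theorem exists_norm_freqKernel_le_const {z : ℂ} (hz : z.im ≠ 0) :
    ∃ C, ∀ ξ, ‖freqKernel z ξ‖ ≤ C := by
  obtain ⟨C, hC0, hC⟩ := exists_norm_freqKernel_le hz
  refine ⟨C, fun ξ => (hC ξ).trans (mul_le_of_le_one_right hC0 (inv_le_one_of_one_le₀ ?_))⟩
  nlinarith [sq_nonneg ξ]

theorem memLp_sqrt_mul_freqKernel {z : ℂ} (hz : z.im ≠ 0) :
    MemLp (fun ξ : ℝ => √|ξ| * ‖freqKernel z ξ‖) 2 := by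
  have hm : AEStronglyMeasurable (fun ξ : ℝ => √|ξ| * ‖freqKernel z ξ‖) volume :=
    ((Real.continuous_sqrt.comp continuous_abs).mul
      (continuous_freqKernel hz).norm).aestronglyMeasurable
  rw [memLp_two_iff_integrable_sq_norm hm]
  obtain ⟨C, hC0, hC⟩ := exists_norm_freqKernel_le hz
  refine (integrable_inv_one_add_sq.const_mul (C ^ 2)).mono' (hm.norm.pow 2)
    (Eventually.of_forall fun ξ => ?_)
  rw [norm_mul, norm_norm, Real.norm_of_nonneg (Real.sqrt_nonneg _),
    Real.norm_of_nonneg (by positivity), mul_pow, Real.sq_sqrt (abs_nonneg ξ)]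
  have h1 : |ξ| ≤ 1 + ξ ^ 2 := by
    rw [← sq_abs]; nlinarith [sq_nonneg (|ξ| - 1), abs_nonneg ξ]
  calc |ξ| * ‖freqKernel z ξ‖ ^ 2 ≤ (1 + ξ ^ 2) * (C * (1 + ξ ^ 2)⁻¹) ^ 2 := by
        gcongr
        exact hC ξ
    _ = _ := by field_simp

/-- The extension of a square integrable function on the half-line by zero. -/
noncomputable def zeroExtend (φ : L2) : Lp ℂ 2 (volume : Measure ℝ) :=
  ((memLp_indicator_iff_restrict measurableSet_Ioi).2 (Lp.memLp φ)).toLp ((Ioi 0).indicator φ)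

theorem zeroExtend_apply (φ : L2) : zeroExtend φ =ᵐ[volume] (Ioi 0).indicator φ :=
  MemLp.coeFn_toLp _

theorem norm_zeroExtend (φ : L2) : ‖zeroExtend φ‖ = ‖φ‖ := by
  have h : ∫⁻ x, ‖zeroExtend φ x‖ₑ ^ 2 = ∫⁻ x, ‖φ x‖ₑ ^ 2 ∂μ := by
    rw [← lintegral_indicator measurableSet_Ioi]
    refine lintegral_congr_ae ?_
    filter_upwards [zeroExtend_apply φ] with x hx
    rw [hx]
    by_cases h : x ∈ Ioi (0 : ℝ)
    · simp [indicator_of_mem h]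
    · simp [indicator_of_notMem h]
  rw [lintegral_enorm_sq_eq, lintegral_enorm_sq_eq,
    ENNReal.ofReal_eq_ofReal_iff (by positivity) (by positivity)] at h
  exact (sq_eq_sq₀ (norm_nonneg _) (norm_nonneg _)).1 h

/-- The inverse Fourier transform of a function on the half-line. -/
noncomputable def halfLineFourier (φ : L2) : Lp ℂ 2 (volume : Measure ℝ) := 𝓕⁻ (zeroExtend φ)

theorem norm_halfLineFourier (φ : L2) : ‖halfLineFourier φ‖ = ‖φ‖ := by
  rw [← norm_zeroExtend φ, halfLineFourier, ← Lp.norm_fourier_eq, FourierTransform.fourier_fourierInv_eq]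

variable {k : ℂ}

theorem integrable_exp_abs_sub (hk : 0 < k.im) (x : ℝ) :
    Integrable fun y : ℝ => Complex.exp (Complex.I * k * |y - x|) := by
  have h := (integrable_exp_neg_mul_abs (c := -(Complex.I * k)) (by simpa using hk) 0).comp_sub_right x
  refine h.congr (Eventually.of_forall fun y => ?_)
  simp

theorem norm_exp_abs_sub_le (hk : 0 < k.im) (x y : ℝ) :
    ‖Complex.exp (Complex.I * k * |y - x|)‖ ≤ 1 := by
  have h := norm_cexp k |y - x|
  rw [h, Real.exp_le_one_iff]
  have := mul_nonneg hk.le (abs_nonneg (y - x))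
  linarith

theorem fourier_exp_abs_sub (hk : 0 < k.im) (x ξ : ℝ) :
    𝓕 (fun y : ℝ => Complex.exp (Complex.I * k * |y - x|)) ξ =
      -(2 * Complex.I * k) * (Complex.exp (-(2 * Real.pi * x * ξ * Complex.I)) *
        freqKernel (k ^ 2) ξ) := by
  have h := integral_exp_neg_mul_abs (c := -(Complex.I * k)) (by simpa using hk) (-(2 * Real.pi * ξ))
  rw [Real.fourier_real_eq_integral_exp_smul, ← integral_add_right_eq_self _ x]
  have e : ∀ y : ℝ, Complex.exp (↑(-2 * Real.pi * (y + x) * ξ) * Complex.I) •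
      Complex.exp (Complex.I * k * |y + x - x|) = Complex.exp (-(2 * Real.pi * x * ξ * Complex.I)) *
        Complex.exp (Complex.I * ↑(-(2 * Real.pi * ξ)) * y - -(Complex.I * k) * |y|) := by
    intro y
    rw [add_sub_cancel_right, smul_eq_mul, ← Complex.exp_add, ← Complex.exp_add]
    congr 1
    push_cast
    ring
  simp_rw [e]
  rw [integral_const_mul, h, freqKernel]
  have e2 : (-(Complex.I * k)) ^ 2 + ((-(2 * Real.pi * ξ) : ℝ) : ℂ) ^ 2 =
      ((4 * Real.pi ^ 2 * ξ ^ 2 : ℝ) : ℂ) - k ^ 2 := by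
    push_cast
    linear_combination k ^ 2 * Complex.I_sq
  rw [e2]
  ring

/-- The method of images: the whole-line kernel minus its reflection in the origin. -/
theorem green_eq_exp (hk : k ≠ 0) {x y : ℝ} (hx : 0 < x) (hy : 0 < y) :
    green k x y = (Complex.I / (2 * k)) * (Complex.exp (Complex.I * k * |y - x|) -
      Complex.exp (Complex.I * k * |y - -x|)) := by
  wlog h : x ≤ y generalizing x y
  · rw [green_comm, this hy hx (le_of_not_ge h), abs_sub_comm]
    congr 5
    ring_nf
  rw [green_of_le k h, sinK_of_ne_zero hk, abs_of_nonneg (sub_nonneg.2 h), abs_of_pos (by linarith),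
    Complex.sin]
  have e1 : Complex.exp (Complex.I * k * (y - x : ℝ)) =
      Complex.exp (Complex.I * k * y) * Complex.exp (-(k * x) * Complex.I) := by
    rw [← Complex.exp_add]; congr 1; push_cast; ring
  have e2 : Complex.exp (Complex.I * k * (y - -x : ℝ)) =
      Complex.exp (Complex.I * k * y) * Complex.exp (k * x * Complex.I) := by
    rw [← Complex.exp_add]; congr 1; push_cast; ring
  rw [e1, e2]
  field_simp

/-- The free resolvent as a superposition of sines. -/
theorem greenOp_eq_integral_sin (hk : 0 < k.im) (hz : (k ^ 2).im ≠ 0) (φ : L2) {x : ℝ}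
    (hx : 0 < x) : greenOp k φ x = ∫ ξ : ℝ, (Real.sin (2 * Real.pi * x * ξ) : ℂ) *
      (freqKernel (k ^ 2) ξ * (-(2 * Complex.I) * halfLineFourier φ ξ)) := by
  have hk0 := ne_zero_of_im_pos hk
  -- The image formula extended to all real y. The two shifts ±x combine on the Fourier side into
  -- sin(2πxξ).
  set p : ℝ → ℂ := fun y => (Complex.I / (2 * k)) * (Complex.exp (Complex.I * k * |y - x|) -
    Complex.exp (Complex.I * k * |y - -x|)) with hp
  have hpi : Integrable p :=
    ((integrable_exp_abs_sub hk x).sub (integrable_exp_abs_sub hk (-x))).const_mul _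
  have hp2 : MemLp p 2 := by
    refine hpi.memLp_two_of_bound (C := ‖Complex.I / (2 * k)‖ * (1 + 1)) fun y => ?_
    rw [hp, norm_mul]
    refine mul_le_mul_of_nonneg_left ((norm_sub_le _ _).trans ?_) (norm_nonneg _)
    exact add_le_add (norm_exp_abs_sub_le hk x y) (norm_exp_abs_sub_le hk (-x) y)
  have hq : ∀ ξ, 𝓕 p ξ = -(2 * Complex.I) * Real.sin (2 * Real.pi * x * ξ) *
      freqKernel (k ^ 2) ξ := by
    intro ξ
    have e : 𝓕 p ξ = (Complex.I / (2 * k)) *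
        (𝓕 (fun y : ℝ => Complex.exp (Complex.I * k * |y - x|)) ξ -
          𝓕 (fun y : ℝ => Complex.exp (Complex.I * k * |y - -x|)) ξ) := by
      have i1 := (Real.fourierIntegral_convergent_iff ξ).2 (integrable_exp_abs_sub hk x)
      have i2 := (Real.fourierIntegral_convergent_iff ξ).2 (integrable_exp_abs_sub hk (-x))
      rw [Real.fourier_eq, Real.fourier_eq, Real.fourier_eq, ← integral_sub i1 i2,
        ← integral_const_mul]
      refine integral_congr_ae (Eventually.of_forall fun y => ?_)
      simp only [hp, Circle.smul_def, smul_eq_mul]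
      ring
    rw [e, fourier_exp_abs_sub hk, fourier_exp_abs_sub hk, Complex.ofReal_sin, Complex.sin]
    have e1 : Complex.exp (-(2 * Real.pi * x * ξ * Complex.I)) =
        Complex.exp (-((2 * Real.pi * x * ξ : ℝ) : ℂ) * Complex.I) := by
      congr 1; push_cast; ring
    have e2 : Complex.exp (-(2 * Real.pi * ((-x : ℝ) : ℂ) * ξ * Complex.I)) =
        Complex.exp (((2 * Real.pi * x * ξ : ℝ) : ℂ) * Complex.I) := by
      congr 1; push_cast; ring
    rw [e1, e2]
    field_simp
    ring
  have hq2 : MemLp (𝓕 p) 2 := by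
    obtain ⟨C, hC⟩ := exists_norm_freqKernel_le_const hz
    have hbase : MemLp (freqKernel (k ^ 2)) 2 := (integrable_freqKernel hz).memLp_two_of_bound hC
    have hcs : Continuous fun ξ : ℝ => -(2 * Complex.I) * (Real.sin (2 * Real.pi * x * ξ) : ℂ) := by
      fun_prop
    have e : 𝓕 p = fun ξ : ℝ => -(2 * Complex.I) * (Real.sin (2 * Real.pi * x * ξ) : ℂ) *
      freqKernel (k ^ 2) ξ := funext hq
    rw [e]
    refine hbase.of_le_mul (c := 2) (hcs.mul (continuous_freqKernel hz)).aestronglyMeasurable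
      (Eventually.of_forall fun ξ => ?_)
    rw [norm_mul, norm_mul, norm_neg, norm_mul, Complex.norm_ofNat, Complex.norm_I, mul_one,
      Complex.norm_real]
    refine mul_le_mul_of_nonneg_right ?_ (norm_nonneg _)
    have := Real.abs_sin_le_one (2 * Real.pi * x * ξ)
    rw [Real.norm_eq_abs]
    linarith
  have key := integral_fourier_smul_eq_of_memLp hpi hp2 hq2 (halfLineFourier φ)
  have hF : 𝓕 (halfLineFourier φ) = zeroExtend φ := FourierTransform.fourier_fourierInv_eq _
  rw [hF] at key
  have hl : ∫ ξ, 𝓕 p ξ • halfLineFourier φ ξ = ∫ ξ : ℝ, (Real.sin (2 * Real.pi * x * ξ) : ℂ) *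
      (freqKernel (k ^ 2) ξ * (-(2 * Complex.I) * halfLineFourier φ ξ)) := by
    refine integral_congr_ae (Eventually.of_forall fun ξ => ?_)
    simp only [hq, smul_eq_mul]
    ring
  rw [← hl, key, greenOp, ← integral_indicator (μ := volume) measurableSet_Ioi]
  refine integral_congr_ae ?_
  filter_upwards [zeroExtend_apply φ] with y hy
  rw [hy, smul_eq_mul]
  by_cases h : y ∈ Ioi (0 : ℝ)
  · rw [indicator_of_mem h, indicator_of_mem h, green_eq_exp hk0 hx h]
  · rw [indicator_of_notMem h, indicator_of_notMem h, mul_zero]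

end HalfLine

/-! ### The free weighted resolvent as a Cauchy transform of an L² density. -/

/-- The product of the bounds 2 and |α - β| on |sin α - sin β|. Having the square linear in the
difference is what lets the first moment of |V| control `sinVec`. -/
theorem Real.sq_sin_sub_sin_le (α β : ℝ) : (Real.sin α - Real.sin β) ^ 2 ≤ 2 * |α - β| := by
  have h1 : |Real.sin α - Real.sin β| ≤ |α - β| := by
    rw [Real.sin_sub_sin, abs_mul, abs_mul, abs_two]
    have h2 := Real.abs_sin_le_abs (x := (α - β) / 2)
    have h3 := Real.abs_cos_le_one ((α + β) / 2)
    rw [abs_div, abs_two] at h2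
    have := mul_le_mul h2 h3 (abs_nonneg _) (by positivity)
    linarith
  have h2 : |Real.sin α - Real.sin β| ≤ 2 := by
    rw [abs_le]
    constructor <;> linarith [Real.sin_le_one α, Real.sin_le_one β, Real.neg_one_le_sin α,
      Real.neg_one_le_sin β]
  rw [← sq_abs, sq]
  exact mul_le_mul h2 h1 (abs_nonneg _) (by norm_num)

namespace HalfLine

namespace Factorization

variable {V a b : ℝ → ℂ}

theorem norm_sq_mul_sin_sub_le (F : Factorization V a b) (ξ η : ℝ) : ∀ᵐ x ∂μ,
    ‖a x * ((Real.sin (2 * Real.pi * x * ξ) - Real.sin (2 * Real.pi * x * η) : ℝ) : ℂ)‖ ^ 2 ≤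
      4 * Real.pi * |ξ - η| * (x * ‖V x‖) := by
  filter_upwards [F.norm_a, ae_mu_pos] with x hx hx0
  rw [norm_mul, mul_pow, hx, Complex.norm_real, Real.norm_eq_abs, sq_abs]
  have h := Real.sq_sin_sub_sin_le (2 * Real.pi * x * ξ) (2 * Real.pi * x * η)
  rw [← mul_sub, abs_mul, abs_of_pos (by positivity : 0 < 2 * Real.pi * x)] at h
  calc _ ≤ ‖V x‖ * (2 * (2 * Real.pi * x * |ξ - η|)) := by gcongr
    _ = _ := by ring

theorem memLp_mul_sin (F : Factorization V a b) (ξ : ℝ) :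
    MemLp (fun x => a x * (Real.sin (2 * Real.pi * x * ξ) : ℂ)) 2 μ := by
  have hc : Continuous fun x : ℝ => (Real.sin (2 * Real.pi * x * ξ) : ℂ) := by fun_prop
  have hm : AEStronglyMeasurable (fun x => a x * (Real.sin (2 * Real.pi * x * ξ) : ℂ)) μ :=
    F.measurable_a.mul hc.aestronglyMeasurable
  rw [memLp_two_iff_integrable_sq_norm hm]
  refine (F.integrable.const_mul (4 * Real.pi * |ξ - 0|)).mono' (hm.norm.pow 2) ?_
  filter_upwards [F.norm_sq_mul_sin_sub_le ξ 0] with x hx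
  rw [Real.norm_of_nonneg (by positivity)]
  simpa using hx

/-- The vector `x ↦ a(x) sin (2πxξ)`. -/
noncomputable def sinVec (F : Factorization V a b) (ξ : ℝ) : L2 := (F.memLp_mul_sin ξ).toLp _

theorem sinVec_apply (F : Factorization V a b) (ξ : ℝ) :
    F.sinVec ξ =ᵐ[μ] fun x => a x * (Real.sin (2 * Real.pi * x * ξ) : ℂ) :=
  MemLp.coeFn_toLp _

theorem sinVec_zero (F : Factorization V a b) : F.sinVec 0 = 0 := by
  refine Lp.ext ?_
  filter_upwards [F.sinVec_apply 0, Lp.coeFn_zero ℂ 2 μ] with x h1 h2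
  rw [h1, h2]
  simp

theorem sinVec_neg (F : Factorization V a b) (ξ : ℝ) : F.sinVec (-ξ) = -F.sinVec ξ := by
  refine Lp.ext ?_
  filter_upwards [F.sinVec_apply ξ, F.sinVec_apply (-ξ), Lp.coeFn_neg (F.sinVec ξ)] with x h1 h2 h3
  rw [h3, Pi.neg_apply, h1, h2, mul_neg, Real.sin_neg, Complex.ofReal_neg, mul_neg]

theorem norm_sinVec_sub_sq_le (F : Factorization V a b) (ξ η : ℝ) :
    ‖F.sinVec ξ - F.sinVec η‖ ^ 2 ≤ 4 * Real.pi * |ξ - η| * ∫ x, x * ‖V x‖ ∂μ := by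
  have h0 : 0 ≤ ∫ x, x * ‖V x‖ ∂μ := by
    refine integral_nonneg_of_ae ?_
    filter_upwards [ae_mu_pos] with x hx using mul_nonneg hx.le (norm_nonneg _)
  rw [← ENNReal.ofReal_le_ofReal_iff (by positivity), ← lintegral_enorm_sq_eq,
    ← integral_const_mul, ofReal_integral_eq_lintegral_ofReal (F.integrable.const_mul _) (by
      filter_upwards [ae_mu_pos] with x hx
      have := norm_nonneg (V x)
      simp only [Pi.zero_apply]
      positivity)]
  refine lintegral_mono_ae ?_
  filter_upwards [F.sinVec_apply ξ, F.sinVec_apply η, Lp.coeFn_sub (F.sinVec ξ) (F.sinVec η),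
    F.norm_sq_mul_sin_sub_le ξ η] with x h1 h2 h3 h4
  rw [h3, Pi.sub_apply, h1, h2, ← mul_sub, ← Complex.ofReal_sub, ← ofReal_norm,
    ← ENNReal.ofReal_pow (norm_nonneg _)]
  exact ENNReal.ofReal_le_ofReal h4

theorem norm_sinVec_sq_le (F : Factorization V a b) (ξ : ℝ) :
    ‖F.sinVec ξ‖ ^ 2 ≤ 4 * Real.pi * |ξ| * ∫ x, x * ‖V x‖ ∂μ := by
  simpa [F.sinVec_zero] using F.norm_sinVec_sub_sq_le ξ 0

theorem continuous_sinVec (F : Factorization V a b) : Continuous F.sinVec := by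
  rw [continuous_iff_continuousAt]
  intro η
  rw [ContinuousAt, tendsto_iff_norm_sub_tendsto_zero]
  have hc : Continuous fun ξ : ℝ => √(4 * Real.pi * |ξ - η| * ∫ x, x * ‖V x‖ ∂μ) := by fun_prop
  have h := hc.tendsto η
  simp only [sub_self, abs_zero, mul_zero, zero_mul, Real.sqrt_zero] at h
  exact squeeze_zero (fun _ => norm_nonneg _)
    (fun ξ => Real.le_sqrt_of_sq_le (F.norm_sinVec_sub_sq_le ξ η)) h

variable {k z : ℂ}

theorem integrable_freq (hz : z.im ≠ 0) (ψ : Lp ℂ 2 (volume : Measure ℝ)) :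
    Integrable fun ξ : ℝ => √|ξ| * ‖freqKernel z ξ * (-(2 * Complex.I) * ψ ξ)‖ := by
  have h1 := MemLp.smul (𝕜 := ℝ) (r := 1) (Lp.memLp ψ).norm (memLp_sqrt_mul_freqKernel hz)
  rw [memLp_one_iff_integrable] at h1
  refine (h1.const_mul 2).congr (Eventually.of_forall fun ξ => ?_)
  simp only [Pi.smul_apply', smul_eq_mul, norm_mul, norm_neg, Complex.norm_ofNat, Complex.norm_I]
  ring

theorem measurable_freq (hz : z.im ≠ 0) (ψ : Lp ℂ 2 (volume : Measure ℝ)) :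
    AEStronglyMeasurable (fun ξ : ℝ => freqKernel z ξ * (-(2 * Complex.I) * ψ ξ)) :=
  (continuous_freqKernel hz).aestronglyMeasurable.mul
    ((Lp.aestronglyMeasurable ψ).const_mul _)

theorem integrable_freq_smul_sinVec (F : Factorization V a b) (hz : z.im ≠ 0)
    (ψ : Lp ℂ 2 (volume : Measure ℝ)) :
    Integrable fun ξ : ℝ => (freqKernel z ξ * (-(2 * Complex.I) * ψ ξ)) • F.sinVec ξ := by
  refine ((integrable_freq hz ψ).const_mul √(4 * Real.pi * ∫ x, x * ‖V x‖ ∂μ)).mono'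
    ((measurable_freq hz ψ).smul F.continuous_sinVec.aestronglyMeasurable)
    (Eventually.of_forall fun ξ => ?_)
  have hs : ‖F.sinVec ξ‖ ≤ √(4 * Real.pi * ∫ x, x * ‖V x‖ ∂μ) * √|ξ| := by
    rw [← Real.sqrt_mul' _ (abs_nonneg ξ)]
    refine Real.le_sqrt_of_sq_le ((F.norm_sinVec_sq_le ξ).trans_eq ?_)
    ring
  calc _ = ‖F.sinVec ξ‖ * ‖freqKernel z ξ * (-(2 * Complex.I) * ψ ξ)‖ := by
        rw [norm_smul, mul_comm]
    _ ≤ √(4 * Real.pi * ∫ x, x * ‖V x‖ ∂μ) * √|ξ| *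
          ‖freqKernel z ξ * (-(2 * Complex.I) * ψ ξ)‖ :=
        mul_le_mul_of_nonneg_right hs (norm_nonneg _)
    _ = _ := mul_assoc _ _ _

/-- Both sides are tested against g ∈ L² and the integrals are exchanged. -/
theorem mulFreeResolvent_eq_integral (F : Factorization V a b) (hk : 0 < k.im)
    (hz : (k ^ 2).im ≠ 0) (φ : L2) : mulFreeResolvent a k φ = ∫ ξ : ℝ,
      (freqKernel (k ^ 2) ξ * (-(2 * Complex.I) * halfLineFourier φ ξ)) • F.sinVec ξ := by
  set c : ℝ → ℂ := fun ξ => freqKernel (k ^ 2) ξ * (-(2 * Complex.I) * halfLineFourier φ ξ) with hc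
  refine ext_inner_left ℂ fun g => ?_
  rw [← integral_inner (F.integrable_freq_smul_sinVec hz _)]
  set f : ℝ → ℝ → ℂ := fun ξ x =>
    c ξ * ((starRingEnd ℂ) (g x) * (a x * (Real.sin (2 * Real.pi * x * ξ) : ℂ))) with hf
  have hr : ∀ ξ, inner ℂ g (c ξ • F.sinVec ξ) = ∫ x, f ξ x ∂μ := by
    intro ξ
    rw [inner_smul_right, L2.inner_def, ← integral_const_mul]
    refine integral_congr_ae ?_
    filter_upwards [F.sinVec_apply ξ] with x hx
    rw [RCLike.inner_apply, hx]
    simp only [hf]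
    ring
  have hl : inner ℂ g (mulFreeResolvent a k φ) = ∫ x, (∫ ξ, f ξ x) ∂μ := by
    rw [L2.inner_def]
    refine integral_congr_ae ?_
    filter_upwards [F.mulFreeResolvent_apply hk φ, ae_mu_pos] with x hx hx0
    rw [RCLike.inner_apply, hx, greenOp_eq_integral_sin hk hz φ hx0, mul_assoc, mul_comm,
      mul_assoc, mul_comm, ← integral_const_mul]
    refine integral_congr_ae (Eventually.of_forall fun ξ => ?_)
    simp only [hf, hc]
    ring
  have hfi : Integrable (Function.uncurry f) ((volume : Measure ℝ).prod μ) := by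
    have h1 := MemLp.smul (𝕜 := ℂ) (r := 1) (Lp.memLp g)
      (sqrt_memLp F.integrable F.measurable_a F.norm_a)
    rw [memLp_one_iff_integrable] at h1
    have h2 := ((integrable_freq hz (halfLineFourier φ)).mul_prod h1.norm).const_mul
      √(4 * Real.pi)
    have hm : AEStronglyMeasurable (Function.uncurry f) ((volume : Measure ℝ).prod μ) := by
      have hs : Continuous fun p : ℝ × ℝ => (Real.sin (2 * Real.pi * p.2 * p.1) : ℂ) := by fun_prop
      exact (measurable_freq hz _).comp_fst.mul
        ((Complex.continuous_conj.comp_aestronglyMeasurable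
          (Lp.aestronglyMeasurable g)).comp_snd.mul
            (F.measurable_a.comp_snd.mul hs.aestronglyMeasurable))
    refine h2.mono' hm ?_
    filter_upwards [Measure.quasiMeasurePreserving_snd.ae ae_mu_pos] with p hp
    -- This bound separates the variables: √|ξ| is absorbed by the decay of `freqKernel`, and √x by
    -- √x a ∈ L².
    have hs : |Real.sin (2 * Real.pi * p.2 * p.1)| ≤ √(4 * Real.pi) * (√|p.1| * √p.2) := by
      have h := Real.sq_sin_sub_sin_le (2 * Real.pi * p.2 * p.1) 0
      rw [← Real.sqrt_mul (abs_nonneg _), ← Real.sqrt_mul (by positivity)]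
      refine Real.le_sqrt_of_sq_le ?_
      rw [sq_abs]
      simp only [Real.sin_zero, sub_zero, abs_mul, abs_two, abs_of_pos Real.pi_pos,
        abs_of_pos hp] at h
      linarith
    simp only [Function.uncurry, hf, norm_mul, Complex.norm_real, RCLike.norm_conj,
      Real.norm_eq_abs, Pi.smul_apply', smul_eq_mul, abs_of_nonneg (Real.sqrt_nonneg _)]
    calc _ ≤ ‖c p.1‖ * (‖g p.2‖ * (‖a p.2‖ * (√(4 * Real.pi) * (√|p.1| * √p.2)))) := by gcongr
      _ = _ := by
          simp only [hc, norm_mul]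
          ring
  rw [hl, ← integral_integral_swap hfi]
  exact integral_congr_ae (Eventually.of_forall fun ξ => (hr ξ).symm)

/-- The density whose Cauchy transform is the free resolvent multiplied by `a`. -/
noncomputable def density (F : Factorization V a b) (φ : L2) : ℝ → L2 :=
  (Ioi 0).indicator fun l => ((8 * Real.pi ^ 2 * (√l / (2 * Real.pi)) : ℝ) : ℂ)⁻¹ •
    (-(2 * Complex.I) * (halfLineFourier φ (√l / (2 * Real.pi)) -
      halfLineFourier φ (-(√l / (2 * Real.pi))))) • F.sinVec (√l / (2 * Real.pi))

theorem stronglyMeasurable_density (F : Factorization V a b) (φ : L2) :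
    AEStronglyMeasurable (F.density φ) volume := by
  have hr : Continuous fun l : ℝ => √l / (2 * Real.pi) := by fun_prop
  have hψ := (Lp.stronglyMeasurable (halfLineFourier φ)).measurable
  have h1 : Measurable fun l : ℝ => ((8 * Real.pi ^ 2 * (√l / (2 * Real.pi)) : ℝ) : ℂ)⁻¹ :=
    (Complex.measurable_ofReal.comp (hr.measurable.const_mul (8 * Real.pi ^ 2))).inv
  have h2 : Measurable fun l : ℝ => -(2 * Complex.I) * (halfLineFourier φ (√l / (2 * Real.pi)) -
      halfLineFourier φ (-(√l / (2 * Real.pi)))) :=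
    ((hψ.comp hr.measurable).sub (hψ.comp hr.neg.measurable)).const_mul _
  have h3 : Continuous fun l : ℝ => F.sinVec (√l / (2 * Real.pi)) := F.continuous_sinVec.comp hr
  exact (h1.aestronglyMeasurable.smul
    (h2.aestronglyMeasurable.smul h3.aestronglyMeasurable)).indicator measurableSet_Ioi

theorem density_sq (F : Factorization V a b) (φ : L2) {ξ : ℝ} (hξ : 0 < ξ) :
    F.density φ (4 * Real.pi ^ 2 * ξ ^ 2) = ((8 * Real.pi ^ 2 * ξ : ℝ) : ℂ)⁻¹ •
      (-(2 * Complex.I) * (halfLineFourier φ ξ - halfLineFourier φ (-ξ))) • F.sinVec ξ := by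
  have hpi := Real.pi_pos
  have h : √(4 * Real.pi ^ 2 * ξ ^ 2) / (2 * Real.pi) = ξ := by
    have : 4 * Real.pi ^ 2 * ξ ^ 2 = (2 * Real.pi * ξ) ^ 2 := by ring
    rw [this, Real.sqrt_sq (by positivity)]
    field_simp
  rw [density, indicator_of_mem (show 4 * Real.pi ^ 2 * ξ ^ 2 ∈ Ioi (0 : ℝ) from
    mem_Ioi.2 (by positivity)), h]

theorem image_sq_Ioi : (fun ξ : ℝ => 4 * Real.pi ^ 2 * ξ ^ 2) '' Ioi 0 = Ioi 0 := by
  have hpi := Real.pi_pos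
  ext l
  constructor
  · rintro ⟨ξ, hξ, rfl⟩
    have hξ' : (0 : ℝ) < ξ := hξ
    exact mem_Ioi.2 (by positivity)
  · intro hl
    have hl' : (0 : ℝ) < l := hl
    refine ⟨√l / (2 * Real.pi), mem_Ioi.2 (by positivity), ?_⟩
    simp only [div_pow, Real.sq_sqrt hl'.le]
    field_simp
    ring

theorem injOn_sq_Ioi : InjOn (fun ξ : ℝ => 4 * Real.pi ^ 2 * ξ ^ 2) (Ioi 0) := by
  intro x hx y hy h
  have hpi := Real.pi_pos
  have h' : x ^ 2 = y ^ 2 := mul_left_cancel₀ (by positivity : 4 * Real.pi ^ 2 ≠ 0) h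
  exact (sq_eq_sq₀ (le_of_lt hx) (le_of_lt hy)).1 h'

theorem hasDerivWithinAt_sq (ξ : ℝ) (s : Set ℝ) :
    HasDerivWithinAt (fun ξ : ℝ => 4 * Real.pi ^ 2 * ξ ^ 2) (8 * Real.pi ^ 2 * ξ) s ξ := by
  refine (((hasDerivAt_id ξ).pow 2).const_mul (4 * Real.pi ^ 2)).hasDerivWithinAt.congr_deriv ?_
  simp
  ring

/-- After l = 4π²ξ² the Jacobian cancels one of the two factors (8π²ξ)⁻¹, and ‖`sinVec` ξ‖² ≤ 4πξM
cancels the other. This leaves (4M/π)(|ψ(ξ)|² + |ψ(-ξ)|²), and Plancherel bounds each half by ‖φ‖².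
-/
theorem lintegral_density_le (F : Factorization V a b) (φ : L2) :
    ∫⁻ l, ‖F.density φ l‖ₑ ^ 2 ≤
      ENNReal.ofReal (8 * (∫ x, x * ‖V x‖ ∂μ) / Real.pi * ‖φ‖ ^ 2) := by
  have hpi := Real.pi_pos
  have h0 : 0 ≤ ∫ x, x * ‖V x‖ ∂μ := by
    refine integral_nonneg_of_ae ?_
    filter_upwards [ae_mu_pos] with x hx using mul_nonneg hx.le (norm_nonneg _)
  set M := ∫ x, x * ‖V x‖ ∂μ with hM
  set ψ := halfLineFourier φ with hψ
  have e1 : ∫⁻ l, ‖F.density φ l‖ₑ ^ 2 = ∫⁻ l in Ioi (0 : ℝ), ‖F.density φ l‖ₑ ^ 2 := by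
    rw [← lintegral_indicator measurableSet_Ioi]
    refine lintegral_congr fun l => ?_
    by_cases h : l ∈ Ioi (0 : ℝ)
    · rw [indicator_of_mem h]
    · rw [indicator_of_notMem h, density, indicator_of_notMem h]
      simp
  have hψ2 : ∫⁻ ξ, ‖ψ ξ‖ₑ ^ 2 = ENNReal.ofReal (‖φ‖ ^ 2) := by
    rw [lintegral_enorm_sq_eq, norm_halfLineFourier]
  have hmeas : Measurable fun ξ => ‖ψ ξ‖ₑ ^ 2 :=
    (Lp.stronglyMeasurable ψ).measurable.enorm.pow_const 2
  have hψm : ∫⁻ ξ, ‖ψ (-ξ)‖ₑ ^ 2 = ENNReal.ofReal (‖φ‖ ^ 2) := by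
    rw [← hψ2]
    exact (Measure.measurePreserving_neg volume).lintegral_comp hmeas
  rw [e1, ← image_sq_Ioi, lintegral_image_eq_lintegral_abs_deriv_mul measurableSet_Ioi
    (fun ξ _ => hasDerivWithinAt_sq ξ _) injOn_sq_Ioi]
  calc ∫⁻ ξ in Ioi (0 : ℝ), ENNReal.ofReal |8 * Real.pi ^ 2 * ξ| *
        ‖F.density φ (4 * Real.pi ^ 2 * ξ ^ 2)‖ₑ ^ 2
      ≤ ∫⁻ ξ in Ioi (0 : ℝ), ENNReal.ofReal (4 * M / Real.pi) *
          (‖ψ ξ‖ₑ ^ 2 + ‖ψ (-ξ)‖ₑ ^ 2) := by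
        refine setLIntegral_mono' measurableSet_Ioi fun ξ hξ => ?_
        have hξ' : (0 : ℝ) < ξ := hξ
        rw [F.density_sq φ hξ', ← ofReal_norm, ← ofReal_norm, ← ofReal_norm,
          ← ENNReal.ofReal_pow (norm_nonneg _), ← ENNReal.ofReal_pow (norm_nonneg _),
          ← ENNReal.ofReal_pow (norm_nonneg _), ← ENNReal.ofReal_add (by positivity) (by positivity),
          ← ENNReal.ofReal_mul (by positivity), ← ENNReal.ofReal_mul (by positivity)]
        refine ENNReal.ofReal_le_ofReal ?_
        have hs := F.norm_sinVec_sq_le ξ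
        rw [abs_of_pos hξ'] at hs
        have hd : ‖ψ ξ - ψ (-ξ)‖ ^ 2 ≤ 2 * (‖ψ ξ‖ ^ 2 + ‖ψ (-ξ)‖ ^ 2) := by
          have h1 := norm_sub_le (ψ ξ) (ψ (-ξ))
          calc _ ≤ (‖ψ ξ‖ + ‖ψ (-ξ)‖) ^ 2 := by gcongr
            _ ≤ _ := by nlinarith [sq_nonneg (‖ψ ξ‖ - ‖ψ (-ξ)‖)]
        rw [norm_smul, norm_smul, norm_mul, norm_neg, norm_mul, Complex.norm_ofNat, Complex.norm_I,
          norm_inv, Complex.norm_real, Real.norm_eq_abs,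
          abs_of_pos (by positivity : 0 < 8 * Real.pi ^ 2 * ξ)]
        calc 8 * Real.pi ^ 2 * ξ * ((8 * Real.pi ^ 2 * ξ)⁻¹ *
              (2 * 1 * ‖ψ ξ - ψ (-ξ)‖ * ‖F.sinVec ξ‖)) ^ 2
            = (8 * Real.pi ^ 2 * ξ)⁻¹ * (4 * (‖ψ ξ - ψ (-ξ)‖ ^ 2 * ‖F.sinVec ξ‖ ^ 2)) := by
              field_simp; ring
          _ ≤ (8 * Real.pi ^ 2 * ξ)⁻¹ * (4 * (2 * (‖ψ ξ‖ ^ 2 + ‖ψ (-ξ)‖ ^ 2) *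
                (4 * Real.pi * ξ * M))) := by gcongr
          _ = _ := by field_simp; ring
    _ ≤ ENNReal.ofReal (4 * M / Real.pi) * (∫⁻ ξ, (‖ψ ξ‖ₑ ^ 2 + ‖ψ (-ξ)‖ₑ ^ 2)) := by
        rw [lintegral_const_mul' _ _ ENNReal.ofReal_ne_top]
        exact mul_le_mul_right (setLIntegral_le_lintegral _ _) _
    _ = _ := by
        rw [lintegral_add_left hmeas, hψ2, hψm, ← ENNReal.ofReal_add (by positivity)
          (by positivity), ← ENNReal.ofReal_mul (by positivity)]
        congr 1
        ring

theorem memLp_density (F : Factorization V a b) (φ : L2) : MemLp (F.density φ) 2 := by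
  refine ⟨F.stronglyMeasurable_density φ, ?_⟩
  rw [eLpNorm_lt_top_iff_lintegral_rpow_enorm_lt_top (by norm_num) (by norm_num)]
  simp only [ENNReal.toReal_ofNat, ENNReal.rpow_ofNat]
  exact (F.lintegral_density_le φ).trans_lt ENNReal.ofReal_lt_top

/-- `freqKernel` is even and `sinVec` odd in ξ, so the frequency integral folds onto ξ > 0 with the
difference ψ(ξ) - ψ(-ξ); then l = 4π²ξ². -/
theorem mulFreeResolvent_eq_cauchy (F : Factorization V a b) (hk : 0 < k.im)
    (hz : (k ^ 2).im ≠ 0) (φ : L2) :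
    mulFreeResolvent a k φ = ∫ l : ℝ, ((l : ℂ) - k ^ 2)⁻¹ • F.density φ l := by
  have hpi := Real.pi_pos
  set G : ℝ → L2 := fun ξ =>
    (freqKernel (k ^ 2) ξ * (-(2 * Complex.I) * halfLineFourier φ ξ)) • F.sinVec ξ with hG
  have hGi : Integrable G := F.integrable_freq_smul_sinVec hz _
  have e1 : ∫ l : ℝ, ((l : ℂ) - k ^ 2)⁻¹ • F.density φ l =
      ∫ l in Ioi (0 : ℝ), ((l : ℂ) - k ^ 2)⁻¹ • F.density φ l := by
    rw [← integral_indicator (μ := volume) measurableSet_Ioi]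
    refine integral_congr_ae (Eventually.of_forall fun l => ?_)
    by_cases h : l ∈ Ioi (0 : ℝ)
    · simp only [indicator_of_mem h]
    · simp only [indicator_of_notMem h, density, smul_zero]
  have hneg : ∫ ξ in Iic (0 : ℝ), G ξ = ∫ ξ in Ioi (0 : ℝ), G (-ξ) := by
    rw [integral_comp_neg_Ioi, neg_zero]
  rw [F.mulFreeResolvent_eq_integral hk hz, e1, ← image_sq_Ioi,
    integral_image_eq_integral_abs_deriv_smul measurableSet_Ioi
      (fun ξ _ => hasDerivWithinAt_sq ξ _) injOn_sq_Ioi,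
    ← intervalIntegral.integral_Iic_add_Ioi (b := 0) hGi.integrableOn hGi.integrableOn, hneg,
    ← integral_add (hGi.comp_neg.integrableOn) hGi.integrableOn]
  refine setIntegral_congr_fun measurableSet_Ioi fun ξ hξ => ?_
  have hξ' : (0 : ℝ) < ξ := hξ
  have hc : ((8 * Real.pi ^ 2 * ξ : ℝ) : ℂ) ≠ 0 := by
    exact_mod_cast (by positivity : (8 * Real.pi ^ 2 * ξ) ≠ 0)
  simp only [hG]
  rw [F.density_sq φ hξ', F.sinVec_neg, freqKernel_neg, abs_of_pos (by positivity), freqKernel,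
    RCLike.real_smul_eq_coe_smul (K := ℂ), smul_neg, ← neg_smul, ← add_smul, smul_smul, smul_smul,
    smul_smul]
  congr 1
  have cancel : ∀ c K D : ℂ, c ≠ 0 → c * K * c⁻¹ * D = K * D := fun c K D h => by
    field_simp
  refine Eq.trans ?_ (cancel _ _ _ hc).symm
  ring

end Factorization

end HalfLine

/-! ### Passage to the boundary of the half-planes. -/

/-- For `s = ±1`, the square root of `z` in the closed upper half-plane whose real part has
sign `s`. -/
noncomputable def upperSqrt (s : ℝ) (z : ℂ) : ℂ :=
  ⟨s * √((‖z‖ + z.re) / 2), √((‖z‖ - z.re) / 2)⟩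

theorem upperSqrt_im_nonneg (s : ℝ) (z : ℂ) : 0 ≤ (upperSqrt s z).im := Real.sqrt_nonneg _

/-- The explicit real and imaginary parts are continuous on all of ℂ, in particular up to the real
axis, although the result squares to z only where s · Im z ≥ 0. -/
theorem continuous_upperSqrt (s : ℝ) : Continuous (upperSqrt s) := by
  have h1 : Continuous fun z : ℂ => s * √((‖z‖ + z.re) / 2) := by fun_prop
  have h2 : Continuous fun z : ℂ => √((‖z‖ - z.re) / 2) := by fun_prop
  exact Complex.equivRealProdCLM.symm.continuous.comp (h1.prodMk h2)

theorem upperSqrt_sq {s : ℝ} (hs : s = 1 ∨ s = -1) {z : ℂ} (hz : 0 ≤ s * z.im) :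
    upperSqrt s z ^ 2 = z := by
  have hs2 : s * s = 1 := by rcases hs with rfl | rfl <;> norm_num
  have h1 : 0 ≤ (‖z‖ + z.re) / 2 := by
    have := (abs_le.1 (Complex.abs_re_le_norm z)).1; linarith
  have h2 : 0 ≤ (‖z‖ - z.re) / 2 := by
    have := (abs_le.1 (Complex.abs_re_le_norm z)).2; linarith
  have e1 := Real.mul_self_sqrt h1
  have e2 := Real.mul_self_sqrt h2
  have hn : ‖z‖ * ‖z‖ = z.re * z.re + z.im * z.im := by
    rw [← sq, ← Complex.normSq_eq_norm_sq, Complex.normSq_apply]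
  have e3 : √((‖z‖ + z.re) / 2) * √((‖z‖ - z.re) / 2) = s * z.im / 2 := by
    rw [← Real.sqrt_mul h1]
    have : (‖z‖ + z.re) / 2 * ((‖z‖ - z.re) / 2) = (s * z.im / 2) ^ 2 := by
      linear_combination hn / 4 - z.im * z.im / 4 * hs2
    rw [this, Real.sqrt_sq (by linarith)]
  rw [sq]
  apply Complex.ext
  · simp only [upperSqrt, Complex.mul_re]
    linear_combination s * s * e1 - e2 + (‖z‖ + z.re) / 2 * hs2
  · simp only [upperSqrt, Complex.mul_im]
    linear_combination 2 * s * e3 + z.im * hs2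

theorem upperSqrt_im_pos {s : ℝ} (hs : s = 1 ∨ s = -1) {z : ℂ} (hz : 0 < s * z.im) :
    0 < (upperSqrt s z).im := by
  refine lt_of_le_of_ne (upperSqrt_im_nonneg s z) fun h => ?_
  have h2 := congrArg Complex.im (upperSqrt_sq hs hz.le)
  rw [sq, Complex.mul_im, ← h, mul_zero, zero_mul, add_zero] at h2
  rw [← h2, mul_zero] at hz
  exact lt_irrefl _ hz

theorem exists_sign_mul_pos {t : ℝ} (ht : t ≠ 0) : ∃ s : ℝ, (s = 1 ∨ s = -1) ∧ 0 < s * t := by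
  rcases lt_or_gt_of_ne ht with h | h
  · exact ⟨-1, Or.inr rfl, by linarith⟩
  · exact ⟨1, Or.inl rfl, by linarith⟩

namespace HalfLine

namespace Factorization

variable {V a b : ℝ → ℂ}

/-- Every nonreal z is k² with Im k > 0, the branch being given by the sign s of Im z. The branch
stays visible in the third clause because the boundary limits depend on it. -/
theorem differentiableOn_compResolvent (F : Factorization V a b)
    (hJost : ∀ k : ℂ, 0 ≤ k.im → ∀ e : ℝ → ℂ, IsJostSolution V k e → e 0 ≠ 0) :
    (∀ z : ℂ, z.im ≠ 0 → z ∈ (schrodingerOp V).resolventSet) ∧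
    (∀ z : ℂ, z.im ≠ 0 → ∀ φ : L2, (schrodingerOp V).resolvent z φ ∈ (mulOp a).domain) ∧
    (∀ s : ℝ, s = 1 ∨ s = -1 → ∀ z : ℂ, 0 < s * z.im → ∀ φ : L2,
      (mulOp a).compResolvent (schrodingerOp V) φ z = weightedResolvent a b (upperSqrt s z) φ) ∧
    ∀ φ : L2, DifferentiableOn ℂ ((mulOp a).compResolvent (schrodingerOp V) φ)
      {z : ℂ | z.im ≠ 0} := by
  have hunit : ∀ k : ℂ, 0 ≤ k.im → IsUnit (1 + bsOp a b k) := fun k hk =>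
    F.isUnit_one_add_bsOp hk (hJost k hk)
  have key : ∀ s : ℝ, s = 1 ∨ s = -1 → ∀ z : ℂ, 0 < s * z.im →
      z ∈ (schrodingerOp V).resolventSet ∧ ∀ φ : L2,
      (schrodingerOp V).resolvent z φ ∈ (mulOp a).domain ∧
      (mulOp a).compResolvent (schrodingerOp V) φ z =
        weightedResolvent a b (upperSqrt s z) φ := by
    intro s hs z hz
    have hk := upperSqrt_im_pos hs hz
    have hu := hunit _ hk.le
    have h1 := F.isResolventAt_perturbedResolvent hk hu
    have h2 := F.resolvent_mem_domain hk hu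
    rw [upperSqrt_sq hs hz.le] at h1 h2
    exact ⟨⟨_, h1⟩, h2⟩
  have hres : ∀ z : ℂ, z.im ≠ 0 → z ∈ (schrodingerOp V).resolventSet := fun z hz => by
    obtain ⟨s, hs, hsz⟩ := exists_sign_mul_pos hz
    exact (key s hs z hsz).1
  have hdom : ∀ z : ℂ, z.im ≠ 0 → ∀ φ : L2,
      (schrodingerOp V).resolvent z φ ∈ (mulOp a).domain := fun z hz φ => by
    obtain ⟨s, hs, hsz⟩ := exists_sign_mul_pos hz
    exact ((key s hs z hsz).2 φ).1
  refine ⟨hres, hdom, fun s hs z hz φ => ((key s hs z hz).2 φ).2, fun φ w hw => ?_⟩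
  have hopen : IsOpen {z : ℂ | z.im ≠ 0} := isOpen_ne_fun Complex.continuous_im continuous_const
  obtain ⟨s, hs, hsw⟩ := exists_sign_mul_pos hw
  refine (LinearPMap.differentiableAt_compResolvent ?_ (hdom w hw)
    (fun φ => ((key s hs w hsw).2 φ).2) φ).differentiableWithinAt
  filter_upwards [hopen.mem_nhds hw] with z hz using hres z hz

theorem enorm_weightedResolvent_sq_le {k : ℂ} {D : ℝ} (hD0 : 0 ≤ D)
    (hD : ‖Ring.inverse (1 + bsOp a b k)‖ ≤ D) (φ : L2) :
    ‖weightedResolvent a b k φ‖ₑ ^ 2 ≤ ENNReal.ofReal (D ^ 2) * ‖mulFreeResolvent a k φ‖ₑ ^ 2 := by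
  have h : ‖weightedResolvent a b k φ‖ ≤ D * ‖mulFreeResolvent a k φ‖ :=
    (Ring.inverse (1 + bsOp a b k)).le_of_opNorm_le hD _
  rw [ENNReal.ofReal_pow hD0, ← mul_pow, ← ofReal_norm, ← ofReal_norm, ← ENNReal.ofReal_mul hD0]
  exact pow_le_pow_left' (ENNReal.ofReal_le_ofReal h) 2

/-- The inverse converges in operator norm up to real k₀, and evaluation is jointly continuous, so a
norm limit of the free vectors suffices. -/
theorem tendsto_weightedResolvent (F : Factorization V a b)
    (hJost : ∀ k : ℂ, 0 ≤ k.im → ∀ e : ℝ → ℂ, IsJostSolution V k e → e 0 ≠ 0) {ι : Type*}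
    {l : Filter ι} {κ : ι → ℂ} {k₀ : ℂ} (hk₀ : 0 ≤ k₀.im)
    (hκ : Tendsto κ l (𝓝[{k | 0 ≤ k.im}] k₀)) {φ g : L2}
    (hg : Tendsto (fun i => mulFreeResolvent a (κ i) φ) l (𝓝 g)) :
    Tendsto (fun i => weightedResolvent a b (κ i) φ) l
      (𝓝 (Ring.inverse (1 + bsOp a b k₀) g)) := by
  have hQ : Tendsto (fun i => 1 + bsOp a b (κ i)) l (𝓝 (1 + bsOp a b k₀)) :=
    ((F.continuousOn_bsOp k₀ hk₀).tendsto.comp hκ).const_add 1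
  obtain ⟨w, hw⟩ := F.isUnit_one_add_bsOp hk₀ (hJost k₀ hk₀)
  have hinv : ContinuousAt Ring.inverse (1 + bsOp a b k₀) := by
    rw [← hw]; exact NormedRing.inverse_continuousAt w
  have hR : Tendsto (fun i => Ring.inverse (1 + bsOp a b (κ i))) l
      (𝓝 (Ring.inverse (1 + bsOp a b k₀))) := hinv.tendsto.comp hQ
  have hcont : Continuous fun p : (L2 →L[ℂ] L2) × L2 => p.1 p.2 := by fun_prop
  exact (hcont.tendsto (Ring.inverse (1 + bsOp a b k₀), g)).comp (hR.prodMk_nhds hg)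

/-- The uniform bound `D` on the inverse is combined with `cauchyTransform` applied to `density`. -/
theorem exists_boundary_bound (F : Factorization V a b)
    (hJost : ∀ k : ℂ, 0 ≤ k.im → ∀ e : ℝ → ℂ, IsJostSolution V k e → e 0 ≠ 0) :
    ∃ C : ℝ≥0, ∀ φ : L2, ‖φ‖ = 1 → ∀ s : ℝ, (s = 1 ∨ s = -1) →
      (∀ ε : ℝ, 0 < ε → ∫⁻ τ : ℝ,
        ‖weightedResolvent a b (upperSqrt s (τ + (s * ε : ℝ) * Complex.I)) φ‖ₑ ^ 2 ≤ C) ∧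
      ∀ᵐ τ : ℝ, ∃ g, Tendsto (fun ε : ℝ =>
        weightedResolvent a b (upperSqrt s (τ + (s * ε : ℝ) * Complex.I)) φ) (𝓝[>] 0) (𝓝 g) := by
  obtain ⟨D, hD0, hD⟩ := F.exists_norm_inverse_le hJost
  set B : ℝ≥0∞ := ENNReal.ofReal (8 * (∫ x, x * ‖V x‖ ∂μ) / Real.pi) with hB
  set C : ℝ≥0∞ := ENNReal.ofReal (D ^ 2) * (ENNReal.ofReal ((2 * Real.pi) ^ 2) * B) with hC
  have hCtop : C ≠ ∞ := ENNReal.mul_ne_top ENNReal.ofReal_ne_top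
    (ENNReal.mul_ne_top ENNReal.ofReal_ne_top ENNReal.ofReal_ne_top)
  refine ⟨C.toNNReal, fun φ hφ s hs => ?_⟩
  rw [ENNReal.coe_toNNReal hCtop]
  have hden := F.lintegral_density_le φ
  rw [hφ, one_pow, mul_one] at hden
  obtain ⟨h1, h2⟩ := cauchyTransform (F.memLp_density φ) hden hs
  have him : ∀ τ ε : ℝ, s * ((τ : ℂ) + (s * ε : ℝ) * Complex.I).im = ε := fun τ ε => by
    have hs2 : s * s = 1 := by rcases hs with rfl | rfl <;> norm_num
    simp
    linear_combination ε * hs2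
  have hfree : ∀ τ ε : ℝ, 0 < ε →
      mulFreeResolvent a (upperSqrt s (τ + (s * ε : ℝ) * Complex.I)) φ =
        ∫ l : ℝ, ((l : ℂ) - (τ + (s * ε : ℝ) * Complex.I))⁻¹ • F.density φ l := by
    intro τ ε hε
    have hz : 0 < s * ((τ : ℂ) + (s * ε : ℝ) * Complex.I).im := by rwa [him]
    have e := upperSqrt_sq hs hz.le
    rw [F.mulFreeResolvent_eq_cauchy (upperSqrt_im_pos hs hz) ?_ φ, e]
    rw [e]
    intro h
    rw [h, mul_zero] at hz
    exact lt_irrefl _ hz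
  constructor
  · intro ε hε
    calc _ ≤ ∫⁻ τ : ℝ, ENNReal.ofReal (D ^ 2) *
          ‖∫ l : ℝ, ((l : ℂ) - (τ + (s * ε : ℝ) * Complex.I))⁻¹ • F.density φ l‖ₑ ^ 2 := by
          refine lintegral_mono fun τ => ?_
          rw [← hfree τ ε hε]
          exact enorm_weightedResolvent_sq_le hD0 (hD _ (upperSqrt_im_nonneg _ _)) φ
      _ ≤ C := by
          rw [lintegral_const_mul' _ _ ENNReal.ofReal_ne_top]
          exact mul_le_mul_right (h1 ε hε) _
  · filter_upwards [h2] with τ hτ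
    obtain ⟨g, hg⟩ := hτ
    set k₀ := upperSqrt s τ with hk₀
    have hk₀' : 0 ≤ k₀.im := upperSqrt_im_nonneg _ _
    refine ⟨Ring.inverse (1 + bsOp a b k₀) g, ?_⟩
    have hk : Tendsto (fun ε : ℝ => upperSqrt s (τ + (s * ε : ℝ) * Complex.I)) (𝓝[>] 0)
        (𝓝[{k | 0 ≤ k.im}] k₀) := by
      refine tendsto_nhdsWithin_iff.2 ⟨?_, Eventually.of_forall fun ε => upperSqrt_im_nonneg _ _⟩
      have hc : Continuous fun ε : ℝ => upperSqrt s (τ + (s * ε : ℝ) * Complex.I) :=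
        (continuous_upperSqrt s).comp (by fun_prop)
      have := hc.tendsto 0
      simp only [mul_zero, Complex.ofReal_zero, zero_mul, add_zero] at this
      exact this.mono_left nhdsWithin_le_nhds
    refine F.tendsto_weightedResolvent hJost hk₀' hk (hg.congr' ?_)
    filter_upwards [self_mem_nhdsWithin] with ε hε using (hfree τ ε hε).symm

end Factorization

end HalfLine

/-! ### Assembly of the theorem. -/

theorem mainTheorem5 (V a : ℝ → ℂ)
    (hV : AEStronglyMeasurable V HalfLine.μ)
    (hV1 : Integrable (fun x : ℝ => x * ‖V x‖) HalfLine.μ)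
    (ha : AEStronglyMeasurable a HalfLine.μ)
    (haV : ∀ᵐ x ∂HalfLine.μ, ‖a x‖ ^ 2 = ‖V x‖)
    (hJost : ∀ k : ℂ, 0 ≤ k.im → ∀ e : ℝ → ℂ, HalfLine.IsJostSolution V k e → e 0 ≠ 0) :
    (HalfLine.mulOp a).IsKatoSmooth (HalfLine.schrodingerOp V) := by
  obtain ⟨b, F⟩ := HalfLine.exists_factorization hV hV1 ha haV
  obtain ⟨hres, hdom, hcomp, hdiff⟩ := F.differentiableOn_compResolvent hJost
  obtain ⟨C, hC⟩ := F.exists_boundary_bound hJost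
  refine ⟨hres, hdom, hdiff, C, fun φ hφ s hs => ?_⟩
  have him : ∀ τ ε : ℝ, s * ((τ : ℂ) + (s * ε : ℝ) * Complex.I).im = ε := fun τ ε => by
    have hs2 : s * s = 1 := by rcases hs with rfl | rfl <;> norm_num
    simp
    linear_combination ε * hs2
  have heq : ∀ τ ε : ℝ, 0 < ε → (HalfLine.mulOp a).compResolvent (HalfLine.schrodingerOp V) φ
      (τ + (s * ε : ℝ) * Complex.I) =
        HalfLine.weightedResolvent a b (upperSqrt s (τ + (s * ε : ℝ) * Complex.I)) φ :=
    fun τ ε hε => hcomp s hs _ (by rwa [him]) φ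
  obtain ⟨h1, h2⟩ := hC φ hφ s hs
  have hbound : ∀ ε : ℝ, 0 < ε → ∫⁻ τ : ℝ, ‖(HalfLine.mulOp a).compResolvent
      (HalfLine.schrodingerOp V) φ (τ + (s * ε : ℝ) * Complex.I)‖ₑ ^ 2 ≤ C := by
    intro ε hε
    simp_rw [heq _ ε hε]
    exact h1 ε hε
  have hlim : ∀ᵐ τ : ℝ, ∃ g, Tendsto (fun ε : ℝ => (HalfLine.mulOp a).compResolvent
      (HalfLine.schrodingerOp V) φ (τ + (s * ε : ℝ) * Complex.I)) (𝓝[>] 0) (𝓝 g) := by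
    filter_upwards [h2] with τ hτ
    obtain ⟨g, hg⟩ := hτ
    refine ⟨g, hg.congr' ?_⟩
    filter_upwards [self_mem_nhdsWithin] with ε hε using (heq τ ε hε).symm
  obtain ⟨G, hG⟩ : ∃ G : ℝ → HalfLine.L2, ∀ᵐ τ : ℝ, Tendsto (fun ε : ℝ =>
      (HalfLine.mulOp a).compResolvent (HalfLine.schrodingerOp V) φ
        (τ + (s * ε : ℝ) * Complex.I)) (𝓝[>] 0) (𝓝 (G τ)) := by
    classical
    refine ⟨fun τ => if h : ∃ g, Tendsto (fun ε : ℝ => (HalfLine.mulOp a).compResolvent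
      (HalfLine.schrodingerOp V) φ (τ + (s * ε : ℝ) * Complex.I)) (𝓝[>] 0) (𝓝 g)
      then h.choose else 0, ?_⟩
    filter_upwards [hlim] with τ hτ
    rw [dif_pos hτ]
    exact hτ.choose_spec
  refine ⟨hbound, G, hG, ?_⟩
  -- The bound for the boundary values follows from Fatou's lemma along this sequence; the
  -- integrands are measurable because the vectors are analytic, hence continuous, on horizontal
  -- lines off the real axis.
  set ε : ℕ → ℝ := fun n => 1 / ((n : ℝ) + 1) with hε
  have hεpos : ∀ n, 0 < ε n := fun n => Nat.one_div_pos_of_nat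
  have hεlim : Tendsto ε atTop (𝓝[>] 0) :=
    tendsto_nhdsWithin_iff.2 ⟨tendsto_one_div_add_atTop_nhds_zero_nat,
      Eventually.of_forall hεpos⟩
  have hmeas : ∀ n, Measurable fun τ : ℝ => ‖(HalfLine.mulOp a).compResolvent
      (HalfLine.schrodingerOp V) φ (τ + (s * ε n : ℝ) * Complex.I)‖ₑ ^ 2 := by
    intro n
    have hc : Continuous fun τ : ℝ => (HalfLine.mulOp a).compResolvent
        (HalfLine.schrodingerOp V) φ (τ + (s * ε n : ℝ) * Complex.I) := by
      refine (hdiff φ).continuousOn.comp_continuous (by fun_prop) fun τ h => ?_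
      have := him τ (ε n)
      rw [h, mul_zero] at this
      exact (hεpos n).ne this
    exact (hc.enorm.measurable).pow_const 2
  calc ∫⁻ τ : ℝ, ‖G τ‖ₑ ^ 2
      ≤ ∫⁻ τ : ℝ, liminf (fun n => ‖(HalfLine.mulOp a).compResolvent
          (HalfLine.schrodingerOp V) φ (τ + (s * ε n : ℝ) * Complex.I)‖ₑ ^ 2) atTop := by
        refine lintegral_mono_ae ?_
        filter_upwards [hG] with τ hτ
        have h := ((ENNReal.continuous_pow 2).tendsto _).comp
          ((continuous_enorm.tendsto (G τ)).comp (hτ.comp hεlim))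
        exact h.liminf_eq.ge
    _ ≤ liminf (fun n => ∫⁻ τ : ℝ, ‖(HalfLine.mulOp a).compResolvent
          (HalfLine.schrodingerOp V) φ (τ + (s * ε n : ℝ) * Complex.I)‖ₑ ^ 2) atTop :=
        lintegral_liminf_le hmeas
    _ ≤ C := by
        refine (liminf_le_liminf (Eventually.of_forall fun n => hbound _ (hεpos n))).trans ?_
        rw [liminf_const]
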